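/- **Setting.** Let $M$ be a connected smooth manifold of dimension $m>2$ (Hausdorff, second countable) and $g=\langle\cdot,\cdot\rangle$ a smooth symmetric $(0,2)$-tensor field on $M$. Let $\Sigma\neq\emptyset$ be the set of points where $g$ is degenerate, and $\mathrm{Rad}_p\subset T_pM$ ($p\in\Sigma$) the radical of $g_p$. Assume that $(M,g)$ is a *transverse Riemann–Lorentz space with tangent radical*: in every coordinate system $\det(g_{ab})$ has non-zero differential at the points of $\Sigma$ (so $\Sigma$ is a smooth hypersurface and $\dim \mathrm{Rad}_p=1$); $\mathrm{Rad}_p\subset T_p\Sigma$ for all $p\in\Sigma$; off $\Sigma$ the metric is Riemannian or Lorentzian, and both types occur arbitrarily close to every point of $\Sigma$. For vector fields on $M$ the dual connection is given by $$2\,\square_{\mathcal A}\mathcal B(\mathcal C)=\mathcal A\langle\mathcal B,\mathcal C\rangle+\mathcal B\langle\mathcal C,\mathcal A\rangle-\mathcal C\langle\mathcal A,\mathcal B\rangle+\langle[\mathcal A,\mathcal B],\mathcal C\rangle-\langle[\mathcal B,\mathcal C],\mathcal A\rangle+\langle[\mathcal C,\mathcal A],\mathcal B\rangle .$$ At $p\in\Sigma$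 put $II_r(a,b)=\square_ab(r)$ for $r\in\mathrm{Rad}_p$, $a,b\in T_pM$, and $\mathcal H_n(x,y)=\square_xy(n)$ for $x,y\in T_p\Sigma$, $n\perp T_p\Sigma$ ($y$ being extended tangentially to $\Sigma$); these do not depend on the extensions used. The main normal $N(p)\in T_pM$ and the main radical vector $R(p)\in\mathrm{Rad}_p$ (unique, the latter up to sign) are given by $N\perp T_p\Sigma$, $II_r(N,N)=0$ for all $r\in\mathrm{Rad}_p$, $\langle N,N\rangle=1$ and $\mathcal H_N(R,R)=-1$. Write $II=II_R$, $\mathcal H=\mathcal H_N$, $S_p=\{v\in T_p\Sigma:\mathcal H(v,R)=0\}$ (the screen), $\nu(a)=\langle a,N\rangle$, $\rho(a)=-\mathcal H(a-\nu(a)N,R)$ for $a\in T_pM$. $\Sigma$ is *$II$-flat* if $II(v,w)=0$ for all $v,w\in S_p$, $p\in\Sigma$. Let $\nabla$ be the Levi-Civita connection of $g$ on $M-\Sigma$, with curvature $\langle R(\mathcal A,\mathcal B)\mathcal C,\mathcal D\rangle=\langle\nabla_{\mathcal A}\nabla_{\mathcal B}\mathcal C-\nabla_{\mathcal B}\nabla_{\mathcal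 A}\mathcal C-\nabla_{[\mathcal A,\mathcal B]}\mathcal C,\mathcal D\rangle$ and $K_{\mathcal A\wedge\mathcal B}=\langle R(\mathcal A,\mathcal B)\mathcal A,\mathcal B\rangle/\det(g_{\mathcal A\wedge\mathcal B})$, where $g_{\mathcal A\wedge\mathcal B}$ is the $2\times2$ matrix of $g$ on $\mathcal A,\mathcal B$. For $p\in\Sigma$ the tensor $\Upsilon_p$ on $T_pM$ is defined by $\Upsilon(A,B,C,D)(p)=\lim_{x\to p,\,x\notin\Sigma}\tau(x)\langle R(\mathcal A,\mathcal B)\mathcal C,\mathcal D\rangle(x)$, where $\tau=\langle\mathcal R,\mathcal R\rangle$ and $\mathcal R$ is a smooth extension of $R$, and $\mathcal A,\dots,\mathcal D$ are smooth extensions of $A,\dots,D$. Let $U\subset M$ be open and let $A,B$ be smooth vector fields along $\Sigma\cap U$ (sections of $TM|_{\Sigma\cap U}$) with $\mathrm{rank}(g_{A\wedge B})=2$ at every point. *$K_{A\wedge B}$ is well-defined* if, for all open $W\subset U$ and all smooth vector fields $\mathcal A,\mathcal B$ on $W$ extending $A,B$ with $\mathrm{rank}(g_{\mathcal A\wedge\mathcal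 B})=2$ on $W$, the function $K_{\mathcal A\wedge\mathcal B}$ on $W-\Sigma$ extends to a smooth function on $W$, and the restriction of this extension to $\Sigma\cap W$ does not depend on the choice of $\mathcal A,\mathcal B$. **Proposition.** (a) For all such $U,A,B$: * $K_{A\wedge B}$ is well-defined if and only if $\Upsilon(\cdot,B,A,B)=\Upsilon(A,\cdot,A,B)=0$ on $\Sigma\cap U$; * if $\Sigma$ is $II$-flat, then $\Upsilon(\cdot,B,A,B)=\Upsilon(A,\cdot,A,B)=0$ on $\Sigma\cap U$ if and only if $\det\begin{pmatrix}\nu(A)&\nu(B)\\ \rho(A)&\rho(B)\end{pmatrix}=0$ on $\Sigma\cap U$; * at each $p\in\Sigma\cap U$, this determinant vanishes if and only if $\dim(\mathrm{Span}(A(p),B(p))\cap S_p)\ge1$. (b) The following three assertions are equivalent: 1. for all such $U,A,B$: if $\dim(\mathrm{Span}(A(p),B(p))\cap S_p)\ge1$ for all $p\in\Sigma\cap U$, then $K_{A\wedge B}$ is well-defined; 2. $\Sigma$ is $II$-flat; 3. for all such $U,A,B$: if $\dim(\mathrm{Span}(A(p),B(p))\cap S_p)=1$ for all $p\in\Sigma\cap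 U$, then $K_{A\wedge B}$ is well-defined. -/

import Mathlib

open Set Filter Topology Bundle
open scoped Manifold ContDiff

noncomputable section

namespace RiemannLorentz

variable {m : ℕ} {M : Type*} [TopologicalSpace M] [ChartedSpace (EuclideanSpace ℝ (Fin m)) M]

/-- A (not necessarily continuous) vector field on the `m`-dimensional manifold `M`. Only its
values on the set under consideration matter. -/
abbrev VField (m : ℕ) (M : Type*) [TopologicalSpace M]
    [ChartedSpace (EuclideanSpace ℝ (Fin m)) M] : Type _ :=
  ∀ x : M, TangentSpace (𝓡 m) x

/-- The vector field `A` is smooth on the set `W` (used for open sets `W`). -/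
def SmoothFieldOn [IsManifold (𝓡 m) ∞ M] (A : VField m M) (W : Set M) : Prop :=
  ContMDiffOn (𝓡 m) (𝓡 m).tangent ∞ (fun x => (⟨x, A x⟩ : TangentBundle (𝓡 m) M)) W

/-- The vector field `A` is smooth on some neighbourhood of `p`. -/
def SmoothFieldNear [IsManifold (𝓡 m) ∞ M] (A : VField m M) (p : M) : Prop :=
  ∃ W : Set M, IsOpen W ∧ p ∈ W ∧ SmoothFieldOn A W

/-- A smooth symmetric `(0,2)`-tensor field on `M`; it may be degenerate and of any signature. -/
structure SymTensor (m : ℕ) (M : Type*) [TopologicalSpace M]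
    [ChartedSpace (EuclideanSpace ℝ (Fin m)) M] [IsManifold (𝓡 m) ∞ M] where
  form (x : M) : TangentSpace (𝓡 m) x →L[ℝ] TangentSpace (𝓡 m) x →L[ℝ] ℝ
  symm (x : M) (v w : TangentSpace (𝓡 m) x) : form x v w = form x w v
  contMDiff : ContMDiff (𝓡 m)
    ((𝓡 m).prod 𝓘(ℝ, EuclideanSpace ℝ (Fin m) →L[ℝ] EuclideanSpace ℝ (Fin m) →L[ℝ] ℝ)) ∞
    (fun x ↦ TotalSpace.mk'
      (EuclideanSpace ℝ (Fin m) →L[ℝ] EuclideanSpace ℝ (Fin m) →L[ℝ] ℝ) x (form x))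

variable [IsManifold (𝓡 m) ∞ M]

namespace SymTensor

variable (g : SymTensor m M)

/-! ### Singular set, radical, transversality, signature -/

/-- The radical of `g` at `p`. -/
def radical (p : M) : Submodule ℝ (TangentSpace (𝓡 m) p) where
  carrier := {v | ∀ w, g.form p v w = 0}
  add_mem' := by intro a b ha hb w; simp [ha w, hb w]
  zero_mem' := by intro w; simp
  smul_mem' := by intro c a ha w; simp [ha w]

/-- The singular set `Σ`: the points where `g` fails to have maximal rank. -/
def singularSet : Set M := {p | g.radical p ≠ ⊥}

/-- `det (g_ab)` in the coordinate system `e`, as a function on the range of the coordinates. -/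
def coordDet (e : OpenPartialHomeomorph M (EuclideanSpace ℝ (Fin m)))
    (z : EuclideanSpace ℝ (Fin m)) : ℝ :=
  Matrix.det (Matrix.of fun a b : Fin m =>
    g.form (e.symm z)
      (mfderiv (𝓡 m) (𝓡 m) e.symm z (EuclideanSpace.single a (1 : ℝ)))
      (mfderiv (𝓡 m) (𝓡 m) e.symm z (EuclideanSpace.single b (1 : ℝ))))

/-- `(M,g)` is a transverse singular space: `Σ` is non-void and, in every smooth coordinate
system, `det (g_ab)` has non-zero differential at the points of `Σ`. -/
def IsTransverse : Prop :=
  g.singularSet.Nonempty ∧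
    ∀ e ∈ IsManifold.maximalAtlas (𝓡 m) ∞ M, ∀ z ∈ e.target,
      e.symm z ∈ g.singularSet → fderiv ℝ (g.coordDet e) z ≠ 0

/-- The tangent space `T_pΣ` of the singular hypersurface, as a subspace of `T_pM`: the vectors
annihilated by the differentials of all smooth functions which vanish on `Σ` near `p`. -/
def tangentSigma (p : M) : Submodule ℝ (TangentSpace (𝓡 m) p) where
  carrier := {v | ∀ f : M → ℝ, ContMDiffAt (𝓡 m) 𝓘(ℝ, ℝ) ∞ f p →
    (∀ᶠ x in 𝓝 p, x ∈ g.singularSet → f x = 0) →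
      mvfderiv (𝓡 m) f p v = 0}
  add_mem' := by
    intro a b ha hb f hf h0
    rw [map_add, ha f hf h0, hb f hf h0, add_zero]
  zero_mem' := by intro f _ _; exact map_zero _
  smul_mem' := by
    intro c a ha f hf h0
    rw [map_smul, ha f hf h0, smul_zero]

/-- The radical is tangent to `Σ`. -/
def HasTangentRadical : Prop := ∀ p ∈ g.singularSet, g.radical p ≤ g.tangentSigma p

/-- `g` is positive definite at `p`. -/
def IsRiemannAt (p : M) : Prop := ∀ v : TangentSpace (𝓡 m) p, v ≠ 0 → 0 < g.form p v v

/-- `g` is nondegenerate of index one at `p`: there is a vector `v` of negative square, and `g` is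
positive definite on its orthogonal complement. -/
def IsLorentzAt (p : M) : Prop :=
  ∃ v : TangentSpace (𝓡 m) p, g.form p v v < 0 ∧
    ∀ w : TangentSpace (𝓡 m) p, w ≠ 0 → g.form p v w = 0 → 0 < g.form p w w

/-- The signature changes from Riemann to Lorentz upon crossing `Σ`. -/
def IsRiemannLorentz : Prop :=
  (∀ p ∉ g.singularSet, g.IsRiemannAt p ∨ g.IsLorentzAt p) ∧
    ∀ p ∈ g.singularSet, p ∈ closure {x | g.IsRiemannAt x} ∧ p ∈ closure {x | g.IsLorentzAt x}

/-- `(M,g)` is a transverse Riemann-Lorentz space with tangent radical. -/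
structure IsTransverseRiemannLorentzTangent : Prop where
  transverse : g.IsTransverse
  tangentRadical : g.HasTangentRadical
  riemannLorentz : g.IsRiemannLorentz

/-! ### The dual connection -/

/-- The dual connection `□_A B (C)` at `x`, by the Koszul formula. -/
def dual (A B C : VField m M) (x : M) : ℝ :=
  (1 / 2 : ℝ) *
    (mvfderiv (𝓡 m) (fun y => g.form y (B y) (C y)) x (A x)
      + mvfderiv (𝓡 m) (fun y => g.form y (C y) (A y)) x (B x)
      - mvfderiv (𝓡 m) (fun y => g.form y (A y) (B y)) x (C x)
      + g.form x (VectorField.mlieBracket (𝓡 m) A B x) (C x)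
      - g.form x (VectorField.mlieBracket (𝓡 m) B C x) (A x)
      + g.form x (VectorField.mlieBracket (𝓡 m) C A x) (B x))

/-- A vector field, smooth near `p`, with value `v` at `p` (constant in the preferred
trivialization of `TM` at `p`). -/
def ext {p : M} (v : TangentSpace (𝓡 m) p) : VField m M :=
  FiberBundle.extend (EuclideanSpace ℝ (Fin m)) v

/-- `Y` is a smooth extension near `p` of `y` which is tangent to `Σ` at the points of `Σ`. -/
def IsTangentExtension (p : M) (y : TangentSpace (𝓡 m) p) (Y : VField m M) : Prop :=
  SmoothFieldNear Y p ∧ Y p = y ∧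
    ∀ᶠ q in 𝓝 p, q ∈ g.singularSet → Y q ∈ g.tangentSigma q

/-- An extension of `y ∈ T_pΣ` as in `IsTangentExtension`. -/
def tangentExt (p : M) (y : TangentSpace (𝓡 m) p) : VField m M :=
  Classical.epsilon (g.IsTangentExtension p y)

/-- `II_r(a,b) = □_a b (r)` for `r ∈ Rad_p` and `a, b ∈ T_pM`; since `r` is in the radical, the
value does not depend on the extensions. -/
def IIof {p : M} (r a b : TangentSpace (𝓡 m) p) : ℝ :=
  g.dual (ext a) (ext b) (ext r) p

/-- `H_n(x,y) = □_x y (n)` for `x, y ∈ T_pΣ` and `n` orthogonal to `T_pΣ`; the value does not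
depend on the extensions, as long as `y` is extended tangentially to `Σ`. -/
def Hof {p : M} (n x y : TangentSpace (𝓡 m) p) : ℝ :=
  g.dual (ext x) (g.tangentExt p y) (ext n) p

/-! ### Main normal, main radical vector, screen distribution -/

/-- `n` and `r` are the main normal and the main radical vector at `p ∈ Σ`: `n` is orthogonal to
`T_pΣ`, `II_Rad`-isotropic and unitary, and `r ∈ Rad_p` satisfies `H(r,r) = -1`. This determines
`n`, and determines `r` up to a sign. -/
def IsMainPair (p : M) (n r : TangentSpace (𝓡 m) p) : Prop :=
  (∀ v ∈ g.tangentSigma p, g.form p n v = 0) ∧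
  (∀ s ∈ g.radical p, g.IIof s n n = 0) ∧
  g.form p n n = 1 ∧
  r ∈ g.radical p ∧
  g.Hof n r r = -1

/-- The main normal and the main radical vector at `p` (the sign of the latter is chosen at each
point of `Σ`). -/
def mainPair (p : M) : TangentSpace (𝓡 m) p × TangentSpace (𝓡 m) p :=
  Classical.epsilon fun q => g.IsMainPair p q.1 q.2

/-- The main normal `N(p)`. -/
def N (p : M) : TangentSpace (𝓡 m) p := (g.mainPair p).1

/-- The main radical vector `R(p)`. -/
def R (p : M) : TangentSpace (𝓡 m) p := (g.mainPair p).2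

/-- The form `II(a,b) = □_a b (R)` on `T_pM`. -/
def II {p : M} (a b : TangentSpace (𝓡 m) p) : ℝ := g.IIof (g.R p) a b

/-- The second fundamental form `H = H_N` on `T_pΣ`. -/
def H {p : M} (x y : TangentSpace (𝓡 m) p) : ℝ := g.Hof (g.N p) x y

/-- The canonical screen `S_p = {v ∈ T_pΣ : H(v,R(p)) = 0}`. The set is a linear subspace; taking
its span only bundles it as such. -/
def screen (p : M) : Submodule ℝ (TangentSpace (𝓡 m) p) :=
  Submodule.span ℝ {v | v ∈ g.tangentSigma p ∧ g.H v (g.R p) = 0}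

/-- `Σ` is `II`-flat. -/
def IIFlat : Prop :=
  ∀ p ∈ g.singularSet, ∀ v ∈ g.screen p, ∀ w ∈ g.screen p, g.II v w = 0

/-- The normal component `ν(a) = ⟨a,N⟩`. -/
def nu {p : M} (a : TangentSpace (𝓡 m) p) : ℝ := g.form p a (g.N p)

/-- The radical component `ρ(a) = -H(a - ν(a)N, R)`. -/
def rho {p : M} (a : TangentSpace (𝓡 m) p) : ℝ := -g.H (a - g.nu a • g.N p) (g.R p)

/-! ### Levi-Civita connection and curvature outside `Σ` -/

/-- The Levi-Civita derivative `∇_A B` at a point `x ∉ Σ`: the vector `v` with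
`⟨v,C⟩ = □_A B (C)` for all vector fields `C` smooth near `x`. -/
def nabla (A B : VField m M) : VField m M := fun x =>
  Classical.epsilon fun v : TangentSpace (𝓡 m) x =>
    ∀ C : VField m M, SmoothFieldNear C x → g.form x v (C x) = g.dual A B C x

/-- The Levi-Civita covariant curvature `⟨R(A,B)C,D⟩` at a point `x ∉ Σ`. -/
def curv (A B C D : VField m M) (x : M) : ℝ :=
  g.form x (g.nabla A (g.nabla B C) x - g.nabla B (g.nabla A C) x
    - g.nabla (VectorField.mlieBracket (𝓡 m) A B) C x) (D x)

/-- A smooth extension near `p` of the main radical vector at `p` which lies in the radical at the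
points of `Σ`. -/
def IsRadicalExtension (p : M) (Y : VField m M) : Prop :=
  SmoothFieldNear Y p ∧ Y p = g.R p ∧ ∀ᶠ q in 𝓝 p, q ∈ g.singularSet → Y q ∈ g.radical q

/-- An extension of the main radical vector at `p` as in `IsRadicalExtension`. -/
def radicalExt (p : M) : VField m M := Classical.epsilon (g.IsRadicalExtension p)

/-- The value at `p ∈ Σ` of the tensor field `Υ`, which is determined by `⟨R(A,B)C,D⟩ = τ⁻¹ Υ(A,B,C,D)`
outside `Σ`, where `τ = ⟨R,R⟩` for an extension of the main radical vector field: the limit of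
`τ ⟨R(A,B)C,D⟩` at `p` from outside `Σ`. The value does not depend on the extensions. -/
def Upsilon {p : M} (a b c d : TangentSpace (𝓡 m) p) : ℝ :=
  limUnder (𝓝[g.singularSetᶜ] p) fun x =>
    g.form x (g.radicalExt p x) (g.radicalExt p x) * g.curv (ext a) (ext b) (ext c) (ext d) x

/-! ### Sectional curvature -/

/-- The matrix of `g` on the pair of tangent vectors `a, b`. -/
def gram {p : M} (a b : TangentSpace (𝓡 m) p) : Matrix (Fin 2) (Fin 2) ℝ :=
  !![g.form p a a, g.form p a b; g.form p b a, g.form p b b]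

/-- The sectional curvature `K_{A ∧ B}` outside `Σ`. -/
def sectional (A B : VField m M) (x : M) : ℝ :=
  g.curv A B A B x / (g.gram (A x) (B x)).det

/-- `A` is a smooth vector field along `Σ ∩ U`: near each point of `Σ ∩ U`, it is the restriction
to `Σ` of a smooth vector field of `M`. -/
def SmoothAlong (U : Set M) (A : VField m M) : Prop :=
  ∀ p ∈ g.singularSet ∩ U, ∃ W : Set M, IsOpen W ∧ p ∈ W ∧ W ⊆ U ∧
    ∃ A' : VField m M, SmoothFieldOn A' W ∧ ∀ x ∈ g.singularSet ∩ W, A' x = A x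

/-- The pair `(A', B')` of smooth vector fields on the open set `W` extends the pair `(A, B)` of
vector fields along `Σ`, and spans planes on which `g` has rank two. -/
def IsExtensionPair (W : Set M) (A B A' B' : VField m M) : Prop :=
  SmoothFieldOn A' W ∧ SmoothFieldOn B' W ∧
    (∀ x ∈ g.singularSet ∩ W, A' x = A x ∧ B' x = B x) ∧
    ∀ x ∈ W, (g.gram (A' x) (B' x)).rank = 2

/-- `F` is a smooth function on `W` which agrees with `f` outside `Σ`; the existence of such an `F`
means that `f` has a good limit on `Σ`. -/
def IsGoodLimit (W : Set M) (f F : M → ℝ) : Prop :=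
  ContMDiffOn (𝓡 m) 𝓘(ℝ, ℝ) ∞ F W ∧ ∀ x ∈ W \ g.singularSet, F x = f x

/-- For vector fields `A, B` along `Σ ∩ U`, `K_{A ∧ B}` is well-defined on `Σ ∩ U`: for all local
extensions `A', B'` of `A, B`, the function `K_{A' ∧ B'}` has a good limit on `Σ`, and the values of
this limit at the points of `Σ` depend only on `A, B`. -/
def SectionalWellDefined (U : Set M) (A B : VField m M) : Prop :=
  (∀ W : Set M, IsOpen W → W ⊆ U → ∀ A' B' : VField m M, g.IsExtensionPair W A B A' B' →
    ∃ F : M → ℝ, g.IsGoodLimit W (g.sectional A' B') F) ∧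
  ∀ W : Set M, IsOpen W → W ⊆ U → ∀ A₁ B₁ A₂ B₂ : VField m M,
    g.IsExtensionPair W A B A₁ B₁ → g.IsExtensionPair W A B A₂ B₂ →
    ∀ F₁ F₂ : M → ℝ, g.IsGoodLimit W (g.sectional A₁ B₁) F₁ →
      g.IsGoodLimit W (g.sectional A₂ B₂) F₂ → ∀ x ∈ g.singularSet ∩ W, F₁ x = F₂ x

/-- `A, B` are smooth vector fields along `Σ ∩ U` such that `g` has rank two on `A ∧ B`. -/
def IsRankTwoPair (U : Set M) (A B : VField m M) : Prop :=
  g.SmoothAlong U A ∧ g.SmoothAlong U B ∧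
    ∀ p ∈ g.singularSet ∩ U, (g.gram (A p) (B p)).rank = 2

/-- The dimension of the intersection of the span of `a, b` with the screen `S_p`. -/
def screenDim {p : M} (a b : TangentSpace (𝓡 m) p) : ℕ :=
  Module.finrank ℝ ↥(Submodule.span ℝ {a, b} ⊓ g.screen p)

end SymTensor

end RiemannLorentz

end

noncomputable section

namespace RiemannLorentz

/-! ### Smooth division by a defining function -/

section Division

universe u

variable {E F : Type u} [NormedAddCommGroup E] [NormedSpace ℝ E] [FiniteDimensional ℝ E]
  [NormedAddCommGroup F] [NormedSpace ℝ F] [CompleteSpace F]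

/-! Everything is read in coordinates near a singular point. Let G be the matrix of the metric, δ =
det G and Γ the Christoffel symbols of the first kind. Then Σ = {δ = 0} with dδ ≠ 0, and Γ is smooth
across Σ. Off Σ the Levi-Civita derivative is ∂_A B + δ⁻¹ adj(G) Γ(A,B). In the curvature the worst
pole cancels, so δ⟨R(A,B)C,D⟩ is a smooth tensor `curvNum`, built from δ∂Γ and Γ·adj(G)·Γ
(`metricDet_mul_curvature`).

At a singular point adj(G) has rank one: adj(G)α = c α(R) R with c ≠ 0. Since Γ(a,b,R) = II(a,b),
the numerator becomes c (II(a,c)II(b,d) − II(b,c)II(a,d)). The function τ = ⟨R,R⟩ equals hδ with hc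
= 1, so the constants cancel and Υ(a,b,c,d) = II(a,c)II(b,d) − II(b,c)II(a,d) (`Upsilon_eq`).

For the first equivalence of (a), Hadamard division by δ shows that K extends as soon as Υ(A,B,A,B)
= 0 on Σ. Two extensions of A and B differ by δX and δY. Their limiting curvatures, multiplied by
the Gram determinant, then differ by 2c (Υ(X,B,A,B) + Υ(A,Y,A,B)) (`isGoodLimit_sub`). Since X and Y
are arbitrary, this gives the criterion (`sectionalWellDefined_iff`).

The rest is linear algebra of the symmetric form II. Here II(R,R) = II(N,N) = 0 and II(R,N) = 1,
while ν = II(·,R) and ρ = II(·,N), so the screen is the common kernel of ν and ρ. Hence the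
determinant vanishes exactly when the plane meets the screen. Flatness means II = ν⊗ρ + ρ⊗ν, which
makes the contractions of Υ multiples of that determinant.

For 3 → 2 in (b), a screen vector v with II(v,v) ≠ 0 is extended to a screen field A and paired with
a field B along the main normal. These planes meet the screen in a line, yet Υ(A,R,A,B) is a
non-zero multiple of II(v,v). -/

theorem hasFDerivAt_parametric_integral {k : E × ℝ → F} (hk : ContDiff ℝ 1 k) (y : E) :
    HasFDerivAt (fun y => ∫ s in (0 : ℝ)..1, k (y, s))
      (∫ s in (0 : ℝ)..1, (fderiv ℝ k (y, s)).comp (ContinuousLinearMap.inl ℝ E ℝ)) y := by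
  have hc : Continuous fun q : E × ℝ =>
      (fderiv ℝ k q).comp (ContinuousLinearMap.inl ℝ E ℝ) :=
    (hk.continuous_fderiv one_ne_zero).clm_comp continuous_const
  obtain ⟨C, hC⟩ := ((isCompact_closedBall y 1).prod isCompact_Icc).exists_bound_of_continuousOn
    (hc.continuousOn (s := Metric.closedBall y 1 ×ˢ Icc (0 : ℝ) 1))
  refine (intervalIntegral.hasFDerivAt_integral_of_dominated_of_fderiv_le
    (𝕜 := ℝ) (μ := MeasureTheory.volume) (F := fun y s => k (y, s))
    (F' := fun y s => (fderiv ℝ k (y, s)).comp (ContinuousLinearMap.inl ℝ E ℝ)) (bound := fun _ => C)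
    (Metric.ball_mem_nhds y one_pos)
    ?_ ?_ ?_ ?_ ?_ ?_)
  · refine Eventually.of_forall fun x => ?_
    exact (hk.continuous.comp (by fun_prop : Continuous fun s : ℝ => (x, s))).aestronglyMeasurable
  · exact (hk.continuous.comp (by fun_prop : Continuous fun s : ℝ => (y, s))).intervalIntegrable _ _
  · exact (hc.comp (by fun_prop : Continuous fun s : ℝ => (y, s))).aestronglyMeasurable
  · refine Eventually.of_forall fun s hs x hx => hC (x, s) ⟨Metric.ball_subset_closedBall hx, ?_⟩
    rw [uIoc_of_le zero_le_one] at hs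
    exact ⟨hs.1.le, hs.2⟩
  · exact intervalIntegrable_const
  · refine Eventually.of_forall fun s _ x _ => ?_
    have h1 : HasFDerivAt k (fderiv ℝ k (x, s)) (x, s) :=
      (hk.differentiable one_ne_zero (x, s)).hasFDerivAt
    exact h1.comp x (hasFDerivAt_prodMk_left x s)

/-- The derivative is again a parametric integral, with values in `E →L[ℝ] F`. The induction
therefore runs over all target spaces at once, which requires `E` and `F` in one universe. -/
theorem contDiff_nat_parametric_integral (n : ℕ) {F : Type u} [NormedAddCommGroup F]
    [NormedSpace ℝ F] [CompleteSpace F] {k : E × ℝ → F} (hk : ContDiff ℝ n k) :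
    ContDiff ℝ n fun y => ∫ s in (0 : ℝ)..1, k (y, s) := by
  induction n generalizing F with
  | zero =>
    rw [Nat.cast_zero, contDiff_zero] at hk ⊢
    exact intervalIntegral.continuous_parametric_intervalIntegral_of_continuous'
      (f := fun y s => k (y, s)) hk 0 1
  | succ n ih =>
    have h1 : ContDiff ℝ 1 k := hk.of_le (by norm_cast; omega)
    rw [Nat.cast_succ, contDiff_succ_iff_hasFDerivAt]
    refine ⟨_, ?_, hasFDerivAt_parametric_integral h1⟩
    refine ih (k := fun q => (fderiv ℝ k q).comp (ContinuousLinearMap.inl ℝ E ℝ)) ?_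
    exact (hk.fderiv_right (m := n) (by norm_cast)).clm_comp contDiff_const

theorem contDiff_parametric_integral {k : E × ℝ → F} (hk : ContDiff ℝ ∞ k) :
    ContDiff ℝ ∞ fun y => ∫ s in (0 : ℝ)..1, k (y, s) :=
  contDiff_infty.2 fun n => contDiff_nat_parametric_integral n (hk.of_le (mod_cast le_top))

/-- Hadamard's lemma for an affine hyperplane. -/
theorem exists_contDiff_factor_linear {f : E → F} (hf : ContDiff ℝ ∞ f) (l : E →L[ℝ] ℝ) (z₀ u : E)
    (hu : l u = 1) (h0 : ∀ y, l (y - z₀) = 0 → f y = 0) :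
    ∃ h : E → F, ContDiff ℝ ∞ h ∧ ∀ y, f y = l (y - z₀) • h y := by
  -- For fixed y this is the segment in direction u from the hyperplane (s = 0) to y (s = 1), with l
  -- (c − z₀) = s · l (y − z₀). Integrating the derivative of f along it produces the factor l (y −
  -- z₀).
  let c : E × ℝ → E := fun q => q.1 - ((1 - q.2) * l (q.1 - z₀)) • u
  have hc : ContDiff ℝ ∞ c := by fun_prop
  refine ⟨fun y => ∫ s in (0 : ℝ)..1, fderiv ℝ f (c (y, s)) u,
    contDiff_parametric_integral (k := fun q => fderiv ℝ f (c q) u) ?_, fun y => ?_⟩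
  · exact ((hf.fderiv_right (m := ∞) (by simp)).comp hc).clm_apply contDiff_const
  · have hd : ∀ s : ℝ, HasDerivAt (fun s => f (c (y, s)))
        (l (y - z₀) • fderiv ℝ f (c (y, s)) u) s := by
      intro s
      have h1 : HasDerivAt (fun s : ℝ => c (y, s)) (l (y - z₀) • u) s := by
        have h2 : HasDerivAt (fun s : ℝ => (1 - s) * l (y - z₀)) (-1 * l (y - z₀)) s :=
          ((hasDerivAt_id s).const_sub 1).mul_const _
        have := (h2.smul_const u).const_sub y
        refine this.congr_deriv ?_
        rw [neg_one_mul, neg_smul, neg_neg]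
      have := ((hf.differentiable (by simp) (c (y, s))).hasFDerivAt).comp_hasDerivAt s h1
      rw [map_smul] at this
      exact this
    have hint := intervalIntegral.integral_eq_sub_of_hasDerivAt (a := 0) (b := 1)
      (fun s _ => hd s) (by
        refine Continuous.intervalIntegrable ?_ _ _
        refine continuous_const.smul ?_
        exact (((hf.continuous_fderiv (by simp)).comp
          (hc.continuous.comp (by fun_prop : Continuous fun s : ℝ => (y, s)))).clm_apply
            continuous_const))
    have hc1 : c (y, 1) = y := by simp [c]
    have hc0 : f (c (y, 0)) = 0 := by
      apply h0
      simp only [c, map_sub, map_smul, hu, smul_eq_mul]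
      ring
    rw [intervalIntegral.integral_smul, hc1, hc0, sub_zero] at hint
    exact hint.symm

/-- Hadamard's lemma: a smooth map vanishing on the zero set of a submersion `d` near a zero of
`d` is a smooth multiple of `d`. -/
theorem exists_contDiffOn_factor {Ω : Set E} (hΩ : IsOpen Ω) {f : E → F} {d : E → ℝ}
    (hf : ContDiffOn ℝ ∞ f Ω) (hd : ContDiffOn ℝ ∞ d Ω) {z₀ : E} (hz : z₀ ∈ Ω) (hd0 : d z₀ = 0)
    (hd' : fderiv ℝ d z₀ ≠ 0) (h0 : ∀ z ∈ Ω, d z = 0 → f z = 0) :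
    ∃ V ⊆ Ω, IsOpen V ∧ z₀ ∈ V ∧ ∃ h : E → F, ContDiffOn ℝ ∞ h V ∧ ∀ z ∈ V, f z = d z • h z := by
  set l := fderiv ℝ d z₀ with hl
  obtain ⟨u, hu⟩ : ∃ u, l u = 1 := by
    obtain ⟨w, hw⟩ : ∃ w, l w ≠ 0 := by
      by_contra! h
      exact hd' (ContinuousLinearMap.ext h)
    exact ⟨(l w)⁻¹ • w, by simp [hw]⟩
  -- A straightening map: l (Φ z − z₀) = d z, and the derivative at z₀ is the identity. It carries
  -- the zero set of d to an affine hyperplane, where the linear case applies.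
  let Φ : E → E := fun z => z + (d z - l (z - z₀)) • u
  have hΦl : ∀ z, l (Φ z - z₀) = d z := by
    intro z
    simp only [Φ, map_sub, map_add, map_smul, hu, smul_eq_mul]
    ring
  have hΦ : ContDiffOn ℝ ∞ Φ Ω :=
    contDiffOn_id.add ((hd.sub (by fun_prop)).smul contDiffOn_const)
  have hΦz : Φ z₀ = z₀ := by simp [Φ, hd0]
  have hΦa : ContDiffAt ℝ ∞ Φ z₀ := hΦ.contDiffAt (hΩ.mem_nhds hz)
  have hder : HasFDerivAt Φ ((ContinuousLinearEquiv.refl ℝ E : E ≃L[ℝ] E) : E →L[ℝ] E) z₀ := by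
    have h1 : HasFDerivAt d l z₀ :=
      ((hd.contDiffAt (hΩ.mem_nhds hz)).differentiableAt (by simp)).hasFDerivAt
    have h2 : HasFDerivAt (fun z => l (z - z₀)) l z₀ :=
      l.hasFDerivAt.comp z₀ ((hasFDerivAt_id z₀).sub_const z₀)
    have := (hasFDerivAt_id z₀).add ((h1.sub h2).smul_const u)
    refine this.congr_fderiv ?_
    ext v
    simp
  let Ψ := hΦa.toOpenPartialHomeomorph Φ hder (by simp)
  have hΨ : ∀ z, Ψ z = Φ z := fun z => rfl
  have hz0s : z₀ ∈ Ψ.source := hΦa.mem_toOpenPartialHomeomorph_source hder (by simp)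
  have hz0t : z₀ ∈ Ψ.target := by
    have := Ψ.map_source hz0s
    rwa [hΨ, hΦz] at this
  have hinv0 : Ψ.symm z₀ = z₀ := by
    have := Ψ.left_inv hz0s
    rwa [hΨ, hΦz] at this
  have hcont : ContinuousOn (fderiv ℝ Φ) Ω := hΦ.continuousOn_fderiv_of_isOpen hΩ (by simp)
  -- The local inverse is smooth at the images of points where the derivative of Φ is invertible,
  -- and these points form an open set.
  let G : Set E := Ω ∩ fderiv ℝ Φ ⁻¹' range ((↑) : (E ≃L[ℝ] E) → E →L[ℝ] E)
  have hG : IsOpen G := hcont.isOpen_inter_preimage hΩ ContinuousLinearEquiv.isOpen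
  let O : Set E := Ψ.target ∩ Ψ.symm ⁻¹' G
  have hO : IsOpen O := Ψ.isOpen_inter_preimage_symm hG
  have hzO : z₀ ∈ O := by
    refine ⟨hz0t, ?_⟩
    rw [mem_preimage, hinv0]
    exact ⟨hz, ⟨_, hder.fderiv.symm⟩⟩
  have hsymm : ∀ y ∈ O, ContDiffAt ℝ ∞ Ψ.symm y := by
    rintro y ⟨hyt, hyΩ, L, hL⟩
    have hs : ContDiffAt ℝ ∞ Φ (Ψ.symm y) := hΦ.contDiffAt (hΩ.mem_nhds hyΩ)
    refine Ψ.contDiffAt_symm hyt (f₀' := L) ?_ hs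
    rw [hL]
    exact (hs.differentiableAt (by simp)).hasFDerivAt
  obtain ⟨ε, hε, hball⟩ := Metric.isOpen_iff.1 hO z₀ hzO
  -- The linear case needs a map smooth on the whole space, so f ∘ Φ⁻¹ is cut off. Near z₀ the bump
  -- function is 1 and nothing changes.
  let χ : ContDiffBump z₀ := ⟨ε / 4, ε / 2, by positivity, by linarith⟩
  have hχO : tsupport χ ⊆ O := by
    rw [χ.tsupport_eq]
    exact (Metric.closedBall_subset_ball (by change ε / 2 < ε; linarith)).trans hball
  let g : E → F := fun y => χ y • f (Ψ.symm y)
  have hg : ContDiff ℝ ∞ g := by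
    rw [contDiff_iff_contDiffAt]
    intro y
    by_cases hy : y ∈ O
    · refine χ.contDiffAt.smul ?_
      exact ContDiffAt.comp y (hf.contDiffAt (hΩ.mem_nhds hy.2.1)) (hsymm y hy)
    · have h1 : y ∉ tsupport χ := fun h => hy (hχO h)
      have h2 : g =ᶠ[𝓝 y] fun _ => 0 := by
        filter_upwards [notMem_tsupport_iff_eventuallyEq.1 h1] with x hx
        simp only [g, hx, Pi.zero_apply, zero_smul]
      exact contDiffAt_const.congr_of_eventuallyEq h2
  have hg0 : ∀ y, l (y - z₀) = 0 → g y = 0 := by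
    intro y hy
    by_cases hyO : y ∈ O
    · have h1 : d (Ψ.symm y) = 0 := by
        rw [← hΦl, ← hΨ, Ψ.right_inv hyO.1, hy]
      simp only [g, h0 _ hyO.2.1 h1, smul_zero]
    · have h1 : χ y = 0 := image_eq_zero_of_notMem_tsupport fun h => hyO (hχO h)
      simp only [g, h1, zero_smul]
  obtain ⟨h, hh, hgh⟩ := exists_contDiff_factor_linear hg l z₀ u hu hg0
  refine ⟨Ψ.source ∩ (Ω ∩ Φ ⁻¹' Metric.ball z₀ (ε / 4)), fun z hz => hz.2.1,
    Ψ.open_source.inter (hΦ.continuousOn.isOpen_inter_preimage hΩ Metric.isOpen_ball),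
    ⟨hz0s, hz, ?_⟩, h ∘ Φ, ?_, ?_⟩
  · rw [mem_preimage, hΦz]
    exact Metric.mem_ball_self (by positivity)
  · exact hh.comp_contDiffOn (hΦ.mono fun z hz => hz.2.1)
  · rintro z ⟨hzs, hzΩ, hzb⟩
    have h1 : χ (Φ z) = 1 := χ.one_of_mem_closedBall (Metric.ball_subset_closedBall hzb)
    have h2 : Ψ.symm (Φ z) = z := Ψ.left_inv hzs
    have := hgh (Φ z)
    simp only [g, h1, h2, one_smul, hΦl] at this
    exact this

/-- The differential of a function vanishing on the zero set of a submersion `d` is a multiple of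
the differential of `d`. -/
theorem fderiv_apply_eq_zero_of_vanishing {f d : E → ℝ} {z₀ : E} (hf : ContDiffAt ℝ 1 f z₀)
    (hd : ContDiffAt ℝ 1 d z₀) (hd0 : d z₀ = 0) (hd' : fderiv ℝ d z₀ ≠ 0)
    (h0 : ∀ᶠ z in 𝓝 z₀, d z = 0 → f z = 0) {v : E} (hv : fderiv ℝ d z₀ v = 0) :
    fderiv ℝ f z₀ v = 0 := by
  -- Since f vanishes on the level set of d, z₀ is trivially a constrained extremum. Lagrange
  -- multipliers make the differentials dependent, and d' ≠ 0 makes the coefficient of f' non-zero.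
  have hext : IsLocalExtrOn f {x | d x = d z₀} z₀ := by
    refine Or.inl ?_
    filter_upwards [nhdsWithin_le_nhds h0, self_mem_nhdsWithin] with x hx hxd
    replace hxd : d x = 0 := hxd.trans hd0
    rw [hx hxd, h0.self_of_nhds hd0]
  obtain ⟨a, b, hab, h⟩ := hext.exists_multipliers_of_hasStrictFDerivAt_1d
    (hd.hasStrictFDerivAt one_ne_zero) (hf.hasStrictFDerivAt one_ne_zero)
  have h1 := congrArg (fun L : E →L[ℝ] ℝ => L v) h
  simp only [add_apply, smul_apply, hv, mul_zero, zero_add, smul_eq_mul, zero_apply] at h1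
  rcases mul_eq_zero.1 h1 with hb | hb
  · exfalso
    rw [hb, zero_smul, add_zero, smul_eq_zero] at h
    rcases h with ha | ha
    · exact hab (by rw [ha, hb]; rfl)
    · exact hd' ha
  · exact hb

end Division

/-! ### Christoffel symbols of a field of bilinear forms on a vector space -/

section Christoffel

variable {E : Type*} [NormedAddCommGroup E] [NormedSpace ℝ E]

instance instNormedAddCommGroupBilinear : NormedAddCommGroup (E →L[ℝ] E →L[ℝ] ℝ) :=
  ContinuousLinearMap.toNormedAddCommGroup

instance instNormedSpaceBilinear : NormedSpace ℝ (E →L[ℝ] E →L[ℝ] ℝ) :=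
  ContinuousLinearMap.toNormedSpace

instance instNormedAddCommGroupTrilinear : NormedAddCommGroup (E →L[ℝ] E →L[ℝ] E →L[ℝ] ℝ) :=
  ContinuousLinearMap.toNormedAddCommGroup

instance instNormedSpaceTrilinear : NormedSpace ℝ (E →L[ℝ] E →L[ℝ] E →L[ℝ] ℝ) :=
  ContinuousLinearMap.toNormedSpace

set_option synthInstance.maxHeartbeats 200000 in
/-- The Christoffel symbols of the first kind of the field `G` of bilinear forms,
`2 Γ(a,b,c) = ∂_a G(b,c) + ∂_b G(c,a) - ∂_c G(a,b)`. -/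
def christoffel (G : E → E →L[ℝ] E →L[ℝ] ℝ) (z : E) : E →L[ℝ] E →L[ℝ] E →L[ℝ] ℝ :=
  (1 / 2 : ℝ) • (fderiv ℝ G z + (fderiv ℝ G z).flip -
    ((ContinuousLinearMap.flipₗᵢ ℝ E E ℝ : (E →L[ℝ] E →L[ℝ] ℝ) →L[ℝ] E →L[ℝ] E →L[ℝ] ℝ).comp
      (fderiv ℝ G z).flip))

variable {G : E → E →L[ℝ] E →L[ℝ] ℝ} {Ω : Set E} {z : E}

set_option synthInstance.maxHeartbeats 200000 in
theorem christoffel_apply (a b c : E) :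
    christoffel G z a b c =
      (1 / 2 : ℝ) * (fderiv ℝ G z a b c + fderiv ℝ G z b a c - fderiv ℝ G z c a b) := by
  simp [christoffel]

set_option synthInstance.maxHeartbeats 200000 in
theorem contDiffOn_christoffel (hΩ : IsOpen Ω) (hG : ContDiffOn ℝ ∞ G Ω) :
    ContDiffOn ℝ ∞ (christoffel G) Ω := by
  have h1 : ContDiffOn ℝ ∞ (fderiv ℝ G) Ω := hG.fderiv_of_isOpen hΩ (by simp)
  have h2 : ContDiffOn ℝ ∞ (fun z => (fderiv ℝ G z).flip) Ω :=
    (ContinuousLinearMap.flipₗᵢ ℝ E E (E →L[ℝ] ℝ)).contDiff.comp_contDiffOn h1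
  exact ContDiffOn.const_smul (1 / 2 : ℝ) ((h1.add h2).sub (contDiffOn_const.clm_comp h2))

theorem fderiv_symm_of_symm (hΩ : IsOpen Ω) (hG : ContDiffOn ℝ ∞ G Ω)
    (hs : ∀ z ∈ Ω, ∀ v w, G z v w = G z w v) (hz : z ∈ Ω) (a v w : E) :
    fderiv ℝ G z a v w = fderiv ℝ G z a w v := by
  have hd : HasFDerivAt G (fderiv ℝ G z) z :=
    ((hG.contDiffAt (hΩ.mem_nhds hz)).differentiableAt (by simp)).hasFDerivAt
  have h1 : HasFDerivAt (fun z => G z v w) (((fderiv ℝ G z).flip v).flip w) z :=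
    ((hd.clm_apply (hasFDerivAt_const v z)).clm_apply (hasFDerivAt_const w z)).congr_fderiv
      (by ext; simp)
  have h2 : HasFDerivAt (fun z => G z w v) (((fderiv ℝ G z).flip w).flip v) z :=
    ((hd.clm_apply (hasFDerivAt_const w z)).clm_apply (hasFDerivAt_const v z)).congr_fderiv
      (by ext; simp)
  have h3 : (fun z => G z v w) =ᶠ[𝓝 z] fun z => G z w v := by
    filter_upwards [hΩ.mem_nhds hz] with x hx using hs x hx v w
  have := (h1.congr_of_eventuallyEq h3.symm).unique h2
  simpa using congrArg (fun L : E →L[ℝ] ℝ => L a) this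

/-- A field of symmetric bilinear forms which is smooth on an open set. -/
structure IsSmoothMetric (G : E → E →L[ℝ] E →L[ℝ] ℝ) (Ω : Set E) : Prop where
  isOpen : IsOpen Ω
  contDiffOn : ContDiffOn ℝ ∞ G Ω
  symm : ∀ z ∈ Ω, ∀ v w, G z v w = G z w v

namespace IsSmoothMetric

variable (hG : IsSmoothMetric G Ω)
include hG

theorem fderiv_symm (hz : z ∈ Ω) (a v w : E) : fderiv ℝ G z a v w = fderiv ℝ G z a w v :=
  fderiv_symm_of_symm hG.isOpen hG.contDiffOn hG.symm hz a v w

theorem christoffel_symm (hz : z ∈ Ω) (a b c : E) :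
    christoffel G z a b c = christoffel G z b a c := by
  rw [christoffel_apply, christoffel_apply, hG.fderiv_symm hz c a b]
  ring

/-- Compatibility of the Christoffel symbols with the metric. -/
theorem christoffel_add_christoffel (hz : z ∈ Ω) (a b c : E) :
    christoffel G z a b c + christoffel G z a c b = fderiv ℝ G z a b c := by
  rw [christoffel_apply, christoffel_apply, hG.fderiv_symm hz a c b, hG.fderiv_symm hz b a c,
    hG.fderiv_symm hz c a b]
  ring

theorem hasFDerivAt (hz : z ∈ Ω) : HasFDerivAt G (fderiv ℝ G z) z :=
  ((hG.contDiffOn.contDiffAt (hG.isOpen.mem_nhds hz)).differentiableAt (by simp)).hasFDerivAt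

theorem fderiv_apply_apply (hz : z ∈ Ω) {B C : E → E} (hB : DifferentiableAt ℝ B z)
    (hC : DifferentiableAt ℝ C z) (a : E) :
    fderiv ℝ (fun y => G y (B y) (C y)) z a =
      fderiv ℝ G z a (B z) (C z) + G z (fderiv ℝ B z a) (C z) + G z (B z) (fderiv ℝ C z a) := by
  rw [(((hG.hasFDerivAt hz).clm_apply hB.hasFDerivAt).clm_apply hC.hasFDerivAt).fderiv]
  simp
  ring

/-- The Koszul formula computes the Christoffel symbols. -/
theorem koszul (hz : z ∈ Ω) {A B C : E → E} (hA : DifferentiableAt ℝ A z)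
    (hB : DifferentiableAt ℝ B z) (hC : DifferentiableAt ℝ C z) :
    (1 / 2 : ℝ) * (fderiv ℝ (fun y => G y (B y) (C y)) z (A z)
      + fderiv ℝ (fun y => G y (C y) (A y)) z (B z)
      - fderiv ℝ (fun y => G y (A y) (B y)) z (C z)
      + G z (VectorField.lieBracket ℝ A B z) (C z)
      - G z (VectorField.lieBracket ℝ B C z) (A z)
      + G z (VectorField.lieBracket ℝ C A z) (B z)) =
    G z (fderiv ℝ B z (A z)) (C z) + christoffel G z (A z) (B z) (C z) := by
  rw [hG.fderiv_apply_apply hz hB hC, hG.fderiv_apply_apply hz hC hA,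
    hG.fderiv_apply_apply hz hA hB, christoffel_apply]
  simp only [VectorField.lieBracket, map_sub, sub_apply]
  rw [hG.fderiv_symm hz (B z) (C z) (A z), hG.symm z hz (A z) (fderiv ℝ B z (C z)),
    hG.symm z hz (B z) (fderiv ℝ C z (A z)), hG.symm z hz (C z) (fderiv ℝ A z (B z))]
  ring

theorem differentiableAt_christoffel (hz : z ∈ Ω) : DifferentiableAt ℝ (christoffel G) z :=
  ((contDiffOn_christoffel hG.isOpen hG.contDiffOn).contDiffAt
    (hG.isOpen.mem_nhds hz)).differentiableAt (by simp)

theorem fderiv_christoffel_apply (hz : z ∈ Ω) {B C : E → E} (hB : DifferentiableAt ℝ B z)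
    (hC : DifferentiableAt ℝ C z) (a d : E) :
    fderiv ℝ (fun y => christoffel G y (B y) (C y) d) z a =
      fderiv ℝ (christoffel G) z a (B z) (C z) d + christoffel G z (fderiv ℝ B z a) (C z) d
        + christoffel G z (B z) (fderiv ℝ C z a) d := by
  rw [((((hG.differentiableAt_christoffel hz).hasFDerivAt.clm_apply hB.hasFDerivAt).clm_apply
    hC.hasFDerivAt).clm_apply (hasFDerivAt_const d z)).fderiv]
  simp
  ring

/-- The second covariant derivative, expressed through a field `P` which represents the Christoffel
symbols of `B` and `C`. -/
theorem second_derivative (hz : z ∈ Ω) {B C P : E → E} (hB : DifferentiableAt ℝ B z)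
    (hC : ContDiffAt ℝ 2 C z) (hP : DifferentiableAt ℝ P z)
    (hGP : ∀ᶠ y in 𝓝 z, ∀ d, G y (P y) d = christoffel G y (B y) (C y) d) (a d : E) :
    G z (fderiv ℝ (fun y => fderiv ℝ C y (B y) + P y) z a) d
        + christoffel G z a (fderiv ℝ C z (B z) + P z) d =
      G z (fderiv ℝ (fderiv ℝ C) z a (B z) + fderiv ℝ C z (fderiv ℝ B z a)) d
        + fderiv ℝ (christoffel G) z a (B z) (C z) d + christoffel G z (fderiv ℝ B z a) (C z) d
        + (christoffel G z (B z) (fderiv ℝ C z a) d + christoffel G z a (fderiv ℝ C z (B z)) d)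
        - christoffel G z a d (P z) := by
  have hC1 : DifferentiableAt ℝ C z := hC.differentiableAt two_ne_zero
  have hC2 : DifferentiableAt ℝ (fderiv ℝ C) z :=
    (hC.fderiv_right (m := 1) (by norm_num)).differentiableAt one_ne_zero
  have h1 : fderiv ℝ (fun y => fderiv ℝ C y (B y) + P y) z a =
      fderiv ℝ (fderiv ℝ C) z a (B z) + fderiv ℝ C z (fderiv ℝ B z a) + fderiv ℝ P z a := by
    change fderiv ℝ ((fun y => fderiv ℝ C y (B y)) + P) z a = _
    rw [((hC2.hasFDerivAt.clm_apply hB.hasFDerivAt).add hP.hasFDerivAt).fderiv]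
    simp
    abel
  -- Differentiating the relation that defines P expresses G(∂P, d) without derivatives of P. Metric
  -- compatibility then leaves only −Γ(a, d, P).
  have h2 : fderiv ℝ (fun y => G y (P y) d) z a =
      fderiv ℝ (fun y => christoffel G y (B y) (C y) d) z a := by
    rw [Filter.EventuallyEq.fderiv_eq (hGP.mono fun y hy => hy d)]
  rw [hG.fderiv_apply_apply hz hP (differentiableAt_const d), hG.fderiv_christoffel_apply hz hB hC1,
    fderiv_fun_const] at h2
  have h3 := hG.christoffel_add_christoffel hz a (P z) d
  simp only [h1, map_add, add_apply, Pi.zero_apply, zero_apply, map_zero] at h2 h3 ⊢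
  linear_combination h2 + h3

end IsSmoothMetric

end Christoffel

/-! ### Determinant and adjugate of a field of bilinear forms -/

/-- The coordinate space of an `m`-dimensional manifold. -/
abbrev Coord (m : ℕ) : Type := EuclideanSpace ℝ (Fin m)

section Adjugate

variable {m : ℕ}

variable {G : Coord m → Coord m →L[ℝ] Coord m →L[ℝ] ℝ} {Ω : Set (Coord m)} {z : Coord m}

/-- The matrix of `G` in the standard basis. -/
def metricMatrix (G : Coord m → Coord m →L[ℝ] Coord m →L[ℝ] ℝ) (z : Coord m) :
    Matrix (Fin m) (Fin m) ℝ :=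
  Matrix.of fun a b => G z (EuclideanSpace.single a 1) (EuclideanSpace.single b 1)

/-- The determinant of `G` in the standard basis. -/
def metricDet (G : Coord m → Coord m →L[ℝ] Coord m →L[ℝ] ℝ) (z : Coord m) : ℝ :=
  (metricMatrix G z).det

/-- The adjugate of `G`, as a map from covectors to vectors: it satisfies
`G (metricAdj G α, v) = metricDet G * α v`. -/
def metricAdj (G : Coord m → Coord m →L[ℝ] Coord m →L[ℝ] ℝ) (z : Coord m)
    (α : Coord m →L[ℝ] ℝ) : Coord m :=
  ∑ a, ∑ b, ((metricMatrix G z).adjugate b a * α (EuclideanSpace.single b 1)) •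
    EuclideanSpace.single a (1 : ℝ)

theorem sum_smul_single (v : Coord m) : ∑ a, v a • EuclideanSpace.single a (1 : ℝ) = v := by
  have := (EuclideanSpace.basisFun (Fin m) ℝ).sum_repr v
  simpa using this

theorem metricAdj_add (α β : Coord m →L[ℝ] ℝ) :
    metricAdj G z (α + β) = metricAdj G z α + metricAdj G z β := by
  simp only [metricAdj, add_apply, mul_add, add_smul, Finset.sum_add_distrib]

theorem metricAdj_smul (c : ℝ) (α : Coord m →L[ℝ] ℝ) :
    metricAdj G z (c • α) = c • metricAdj G z α := by
  simp only [metricAdj, smul_apply, smul_eq_mul, mul_left_comm _ c, mul_smul, Finset.smul_sum]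

theorem contDiffOn_matrix_det {ι X : Type*} [Fintype ι] [DecidableEq ι] [NormedAddCommGroup X]
    [NormedSpace ℝ X] {s : Set X} {A : X → Matrix ι ι ℝ} {n : ℕ∞ω}
    (hA : ∀ i j, ContDiffOn ℝ n (fun x => A x i j) s) :
    ContDiffOn ℝ n (fun x => (A x).det) s := by
  simp only [Matrix.det_apply']
  exact ContDiffOn.sum fun σ _ => contDiffOn_const.mul (contDiffOn_prod fun i _ => hA _ _)

theorem contDiffOn_matrix_adjugate {ι X : Type*} [Fintype ι] [DecidableEq ι] [NormedAddCommGroup X]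
    [NormedSpace ℝ X] {s : Set X} {A : X → Matrix ι ι ℝ} {n : ℕ∞ω}
    (hA : ∀ i j, ContDiffOn ℝ n (fun x => A x i j) s) (i j : ι) :
    ContDiffOn ℝ n (fun x => (A x).adjugate i j) s := by
  simp only [Matrix.adjugate_apply]
  refine contDiffOn_matrix_det fun k l => ?_
  by_cases hk : k = j
  · subst hk
    simpa using contDiffOn_const
  · simpa [Matrix.updateRow_ne hk] using hA k l

theorem contDiffOn_metricMatrix (hG : ContDiffOn ℝ ∞ G Ω) (a b : Fin m) :
    ContDiffOn ℝ ∞ (fun z => metricMatrix G z a b) Ω :=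
  (hG.clm_apply contDiffOn_const).clm_apply contDiffOn_const

theorem contDiffOn_metricDet (hG : ContDiffOn ℝ ∞ G Ω) : ContDiffOn ℝ ∞ (metricDet G) Ω :=
  contDiffOn_matrix_det (contDiffOn_metricMatrix hG)

theorem contDiffOn_metricAdj (hG : ContDiffOn ℝ ∞ G Ω) {α : Coord m → Coord m →L[ℝ] ℝ}
    (hα : ContDiffOn ℝ ∞ α Ω) : ContDiffOn ℝ ∞ (fun z => metricAdj G z (α z)) Ω := by
  unfold metricAdj
  refine ContDiffOn.sum fun a _ => ContDiffOn.sum fun b _ => ?_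
  refine ContDiffOn.smul (f := fun z => (metricMatrix G z).adjugate b a *
    α z (EuclideanSpace.single b 1)) ?_ contDiffOn_const
  exact (contDiffOn_matrix_adjugate (contDiffOn_metricMatrix hG) b a).mul
    (hα.clm_apply contDiffOn_const)

theorem metric_metricAdj (α : Coord m →L[ℝ] ℝ) (v : Coord m) :
    G z (metricAdj G z α) v = metricDet G z * α v := by
  have h : ∀ c : Fin m, G z (metricAdj G z α) (EuclideanSpace.single c 1) =
      metricDet G z * α (EuclideanSpace.single c 1) := by
    intro c
    have h1 : ∀ b, ∑ a, (metricMatrix G z).adjugate b a * metricMatrix G z a c =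
        metricDet G z * (1 : Matrix (Fin m) (Fin m) ℝ) b c := by
      intro b
      rw [← Matrix.mul_apply, Matrix.adjugate_mul]
      rfl
    simp only [metricAdj, map_sum, map_smul, sum_apply, smul_apply, smul_eq_mul]
    rw [Finset.sum_comm]
    calc _ = ∑ b, α (EuclideanSpace.single b 1) *
          ∑ a, (metricMatrix G z).adjugate b a * metricMatrix G z a c := by
          refine Finset.sum_congr rfl fun b _ => ?_
          rw [Finset.mul_sum]
          refine Finset.sum_congr rfl fun a _ => ?_
          simp only [metricMatrix, Matrix.of_apply]
          ring
      _ = _ := by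
          simp only [h1, Matrix.one_apply]
          simp [mul_comm]
  rw [← sum_smul_single v]
  simp only [map_sum, map_smul, h, Finset.mul_sum, smul_eq_mul]
  exact Finset.sum_congr rfl fun _ _ => by ring

/-- The adjugate of a symmetric matrix is symmetric. At singular points this forces the adjugate,
whose image lies in the radical, to depend on α only through its value on the radical. -/
theorem metricAdj_symm (hs : ∀ v w, G z v w = G z w v) (α β : Coord m →L[ℝ] ℝ) :
    β (metricAdj G z α) = α (metricAdj G z β) := by
  have h1 : (metricMatrix G z).transpose = metricMatrix G z := by
    ext a b
    exact hs _ _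
  have h2 : ∀ a b, (metricMatrix G z).adjugate b a = (metricMatrix G z).adjugate a b := by
    intro a b
    conv_rhs => rw [← h1, ← Matrix.adjugate_transpose]
    rfl
  simp only [metricAdj, map_sum, map_smul, smul_eq_mul]
  rw [Finset.sum_comm]
  refine Finset.sum_congr rfl fun b _ => Finset.sum_congr rfl fun a _ => ?_
  rw [h2 a b]
  ring

theorem metricMatrix_mulVec (v : Coord m) (a : Fin m) :
    Matrix.mulVec (metricMatrix G z) v a = G z (EuclideanSpace.single a 1) v := by
  conv_rhs => rw [← sum_smul_single v]
  simp only [Matrix.mulVec, dotProduct, metricMatrix, Matrix.of_apply, map_sum, map_smul,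
    smul_eq_mul]
  exact Finset.sum_congr rfl fun _ _ => mul_comm _ _

theorem metricDet_eq_zero_iff (hs : ∀ v w, G z v w = G z w v) :
    metricDet G z = 0 ↔ ∃ v ≠ 0, ∀ w, G z v w = 0 := by
  rw [metricDet, ← Matrix.exists_mulVec_eq_zero_iff]
  constructor
  · rintro ⟨v, hv, h⟩
    refine ⟨WithLp.toLp 2 v, by simpa using hv, fun w => ?_⟩
    rw [hs, ← sum_smul_single w]
    simp only [map_sum, map_smul, sum_apply, smul_apply]
    refine Finset.sum_eq_zero fun a _ => ?_
    rw [← metricMatrix_mulVec]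
    change w a • Matrix.mulVec (metricMatrix G z) v a = 0
    rw [h, Pi.zero_apply, smul_zero]
  · rintro ⟨v, hv, h⟩
    refine ⟨v, fun h0 => hv (by ext i; exact congrFun h0 i), ?_⟩
    ext a
    rw [metricMatrix_mulVec, hs, h, Pi.zero_apply]

/-- If the adjugate does not vanish, then the kernel is at most one-dimensional. -/
theorem exists_eq_smul_of_metricAdj_ne_zero (hs : ∀ v w, G z v w = G z w v)
    {α : Coord m →L[ℝ] ℝ} (hα : metricAdj G z α ≠ 0) {r s : Coord m} (hr : r ≠ 0)
    (hGr : ∀ w, G z r w = 0)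
    (hGs : ∀ w, G z s w = 0) : ∃ c : ℝ, s = c • r := by
  by_contra! hc
  apply hα
  have h0 : ∀ i j, (metricMatrix G z).adjugate i j = 0 := by
    intro i j
    -- Two independent kernel vectors have a non-zero combination whose i-th coordinate vanishes. It
    -- is still killed after row j is replaced by the i-th unit row, so the (i, j) entry of the
    -- adjugate is zero.
    obtain ⟨t, ht, hti, hGt⟩ : ∃ t : Coord m, t ≠ 0 ∧ t i = 0 ∧ ∀ w, G z t w = 0 := by
      by_cases hri : r i = 0
      · exact ⟨r, hr, hri, hGr⟩
      · refine ⟨s - (s i / r i) • r, sub_ne_zero.2 (hc _), ?_, fun w => ?_⟩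
        · simp [hri]
        · simp [hGr, hGs]
    rw [Matrix.adjugate_apply, ← Matrix.exists_mulVec_eq_zero_iff]
    refine ⟨t, fun h => ht (by ext k; exact congrFun h k), ?_⟩
    ext k
    by_cases hk : k = j
    · subst hk
      simp [Matrix.mulVec, hti]
    · have := metricMatrix_mulVec (G := G) (z := z) t k
      rw [hs, hGt] at this
      simpa [Matrix.mulVec, Matrix.updateRow_ne hk] using this
  simp [metricAdj, h0]

end Adjugate

section CoordCurvature

variable {m : ℕ} {G : Coord m → Coord m →L[ℝ] Coord m →L[ℝ] ℝ} {Ω : Set (Coord m)} {z : Coord m}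

theorem two_le_infty : (2 : ℕ∞ω) ≤ ∞ :=
  WithTop.coe_le_coe.2 (le_top : (2 : ℕ∞) ≤ ⊤)

theorem metricAdj_sub (α β : Coord m →L[ℝ] ℝ) :
    metricAdj G z (α - β) = metricAdj G z α - metricAdj G z β := by
  rw [sub_eq_add_neg, ← neg_one_smul ℝ β, metricAdj_add, metricAdj_smul, neg_one_smul,
    ← sub_eq_add_neg]

/-! ### Covariant derivative and curvature in coordinates -/

/-- The Levi-Civita derivative of `G` in coordinates, where `G` is nondegenerate. -/
def covDeriv (G : Coord m → Coord m →L[ℝ] Coord m →L[ℝ] ℝ) (A B : Coord m → Coord m)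
    (z : Coord m) : Coord m :=
  fderiv ℝ B z (A z) + (metricDet G z)⁻¹ • metricAdj G z (christoffel G z (A z) (B z))

/-- The determinant of `G` times the covariant curvature of `G`: a tensor which is smooth also where
`G` is degenerate. -/
def curvNum (G : Coord m → Coord m →L[ℝ] Coord m →L[ℝ] ℝ) (z : Coord m) (a b c d : Coord m) : ℝ :=
  metricDet G z * (fderiv ℝ (christoffel G) z a b c d - fderiv ℝ (christoffel G) z b a c d)
    + christoffel G z b d (metricAdj G z (christoffel G z a c))
    - christoffel G z a d (metricAdj G z (christoffel G z b c))

/-- The differences and multiples in each slot serve to compare the curvatures of two extensions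
that differ by a multiple of the determinant. -/
theorem curvNum_sub₁ (a a' b c d : Coord m) :
    curvNum G z (a - a') b c d = curvNum G z a b c d - curvNum G z a' b c d := by
  simp only [curvNum, map_sub, sub_apply, metricAdj_sub]
  ring

theorem curvNum_sub₂ (a b b' c d : Coord m) :
    curvNum G z a (b - b') c d = curvNum G z a b c d - curvNum G z a b' c d := by
  simp only [curvNum, map_sub, sub_apply, metricAdj_sub]
  ring

theorem curvNum_sub₃ (a b c c' d : Coord m) :
    curvNum G z a b (c - c') d = curvNum G z a b c d - curvNum G z a b c' d := by
  simp only [curvNum, map_sub, sub_apply, metricAdj_sub]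
  ring

theorem curvNum_sub₄ (a b c d d' : Coord m) :
    curvNum G z a b c (d - d') = curvNum G z a b c d - curvNum G z a b c d' := by
  simp only [curvNum, map_sub, sub_apply]
  ring

set_option synthInstance.maxHeartbeats 200000 in
theorem curvNum_smul₁ (t : ℝ) (a b c d : Coord m) :
    curvNum G z (t • a) b c d = t * curvNum G z a b c d := by
  simp only [curvNum, map_smul, smul_apply, metricAdj_smul, smul_eq_mul]
  ring

set_option synthInstance.maxHeartbeats 200000 in
theorem curvNum_smul₂ (t : ℝ) (a b c d : Coord m) :
    curvNum G z a (t • b) c d = t * curvNum G z a b c d := by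
  simp only [curvNum, map_smul, smul_apply, metricAdj_smul, smul_eq_mul]
  ring

set_option synthInstance.maxHeartbeats 200000 in
theorem curvNum_smul₃ (t : ℝ) (a b c d : Coord m) :
    curvNum G z a b (t • c) d = t * curvNum G z a b c d := by
  simp only [curvNum, map_smul, smul_apply, metricAdj_smul, smul_eq_mul]
  ring

set_option synthInstance.maxHeartbeats 200000 in
theorem curvNum_smul₄ (t : ℝ) (a b c d : Coord m) :
    curvNum G z a b c (t • d) = t * curvNum G z a b c d := by
  simp only [curvNum, map_smul, smul_apply, smul_eq_mul]
  ring

namespace IsSmoothMetric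

variable (hG : IsSmoothMetric G Ω)
include hG

theorem contDiffOn_christoffel : ContDiffOn ℝ ∞ (christoffel G) Ω :=
  RiemannLorentz.contDiffOn_christoffel hG.isOpen hG.contDiffOn

theorem contDiffOn_metricDet : ContDiffOn ℝ ∞ (metricDet G) Ω :=
  RiemannLorentz.contDiffOn_metricDet hG.contDiffOn

theorem contDiffOn_christoffel_apply {U : Set (Coord m)} (hU : U ⊆ Ω) {A B C : Coord m → Coord m}
    (hA : ContDiffOn ℝ ∞ A U) (hB : ContDiffOn ℝ ∞ B U) (hC : ContDiffOn ℝ ∞ C U) :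
    ContDiffOn ℝ ∞ (fun z => christoffel G z (A z) (B z) (C z)) U :=
  (((hG.contDiffOn_christoffel.mono hU).clm_apply hA).clm_apply hB).clm_apply hC

theorem contDiffOn_curvNum {U : Set (Coord m)} (hU : U ⊆ Ω) {A B C D : Coord m → Coord m}
    (hA : ContDiffOn ℝ ∞ A U) (hB : ContDiffOn ℝ ∞ B U) (hC : ContDiffOn ℝ ∞ C U)
    (hD : ContDiffOn ℝ ∞ D U) :
    ContDiffOn ℝ ∞ (fun z => curvNum G z (A z) (B z) (C z) (D z)) U := by
  have hΓ := hG.contDiffOn_christoffel.mono hU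
  have hdΓ : ContDiffOn ℝ ∞ (fderiv ℝ (christoffel G)) U :=
    (hG.contDiffOn_christoffel.fderiv_of_isOpen hG.isOpen (by simp)).mono hU
  have h4 : ∀ {A B C D : Coord m → Coord m}, ContDiffOn ℝ ∞ A U → ContDiffOn ℝ ∞ B U →
      ContDiffOn ℝ ∞ C U → ContDiffOn ℝ ∞ D U →
      ContDiffOn ℝ ∞ (fun z => fderiv ℝ (christoffel G) z (A z) (B z) (C z) (D z)) U :=
    fun hA hB hC hD => (((hdΓ.clm_apply hA).clm_apply hB).clm_apply hC).clm_apply hD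
  have hQ : ∀ {A B C D : Coord m → Coord m}, ContDiffOn ℝ ∞ A U → ContDiffOn ℝ ∞ B U →
      ContDiffOn ℝ ∞ C U → ContDiffOn ℝ ∞ D U → ContDiffOn ℝ ∞ (fun z =>
        christoffel G z (A z) (B z) (metricAdj G z (christoffel G z (C z) (D z)))) U :=
    fun hA hB hC hD => hG.contDiffOn_christoffel_apply hU hA hB
      (contDiffOn_metricAdj (hG.contDiffOn.mono hU) ((hΓ.clm_apply hC).clm_apply hD))
  exact (((hG.contDiffOn_metricDet.mono hU).mul ((h4 hA hB hC hD).sub (h4 hB hA hC hD))).add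
    (hQ hB hD hA hC)).sub (hQ hA hD hB hC)

theorem contDiffOn_covDeriv {U : Set (Coord m)} (hU : U ⊆ Ω) (hUo : IsOpen U)
    (hδ : ∀ z ∈ U, metricDet G z ≠ 0) {A B : Coord m → Coord m} (hA : ContDiffOn ℝ ∞ A U)
    (hB : ContDiffOn ℝ ∞ B U) : ContDiffOn ℝ ∞ (covDeriv G A B) U :=
  ((hB.fderiv_of_isOpen (m := ∞) hUo (by simp)).clm_apply hA).add
    (((hG.contDiffOn_metricDet.mono hU).inv hδ).smul
      (contDiffOn_metricAdj (hG.contDiffOn.mono hU)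
        (((hG.contDiffOn_christoffel.mono hU).clm_apply hA).clm_apply hB)))

omit hG in
theorem metric_covDeriv (hδ : metricDet G z ≠ 0) (A B : Coord m → Coord m) (d : Coord m) :
    G z (covDeriv G A B z) d = G z (fderiv ℝ B z (A z)) d + christoffel G z (A z) (B z) d := by
  simp only [covDeriv, map_add, map_smul, add_apply, smul_apply, metric_metricAdj, smul_eq_mul]
  field_simp

theorem eventually_metricDet_ne_zero (hz : z ∈ Ω) (hδ : metricDet G z ≠ 0) :
    ∀ᶠ y in 𝓝 z, metricDet G y ≠ 0 :=
  (hG.contDiffOn_metricDet.continuousOn.continuousAt (hG.isOpen.mem_nhds hz)).eventually_ne hδ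

/-- After multiplication by the determinant no denominator remains: by `second_derivative` the
quotient adj Γ(B,C)/δ enters only undifferentiated. Apart from the ∂Γ term and the adjugate term,
what is left is either symmetric in A and B or matched by the bracket term of the curvature. -/
theorem covDeriv_covDeriv (hz : z ∈ Ω) (hδ : metricDet G z ≠ 0)
    {A B C : Coord m → Coord m} {U : Set (Coord m)} (hU : IsOpen U) (hzU : z ∈ U)
    (hB : ContDiffOn ℝ ∞ B U) (hC : ContDiffOn ℝ ∞ C U) (d : Coord m) :
    metricDet G z * G z (covDeriv G A (covDeriv G B C) z) d =
      metricDet G z * (G z (fderiv ℝ (fderiv ℝ C) z (A z) (B z)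
          + fderiv ℝ C z (fderiv ℝ B z (A z))) d
        + fderiv ℝ (christoffel G) z (A z) (B z) (C z) d
        + christoffel G z (fderiv ℝ B z (A z)) (C z) d
        + (christoffel G z (B z) (fderiv ℝ C z (A z)) d
          + christoffel G z (A z) (fderiv ℝ C z (B z)) d))
        - christoffel G z (A z) d (metricAdj G z (christoffel G z (B z) (C z))) := by
  obtain ⟨V, hV, hVo, hzV⟩ := eventually_nhds_iff.1 (hG.eventually_metricDet_ne_zero hz hδ)
  have hU' : IsOpen (U ∩ (Ω ∩ V)) := hU.inter (hG.isOpen.inter hVo)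
  have hzU' : z ∈ U ∩ (Ω ∩ V) := ⟨hzU, hz, hzV⟩
  -- P is the zeroth-order part of the Levi-Civita derivative, the vector representing Γ(B,C). It is
  -- smooth only where the determinant does not vanish, hence the smaller neighbourhood.
  let P : Coord m → Coord m := fun y =>
    (metricDet G y)⁻¹ • metricAdj G y (christoffel G y (B y) (C y))
  have hP : ContDiffOn ℝ ∞ P (U ∩ (Ω ∩ V)) := by
    have hs : U ∩ (Ω ∩ V) ⊆ Ω := fun y hy => hy.2.1
    exact ((hG.contDiffOn_metricDet.mono hs).inv fun y hy => hV y hy.2.2).smul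
      (contDiffOn_metricAdj (hG.contDiffOn.mono hs)
        (((hG.contDiffOn_christoffel.mono hs).clm_apply
          (hB.mono inter_subset_left)).clm_apply (hC.mono inter_subset_left)))
  have key := hG.second_derivative hz (B := B) (C := C) (P := P)
    ((hB.contDiffAt (hU.mem_nhds hzU)).differentiableAt (by simp))
    ((hC.contDiffAt (hU.mem_nhds hzU)).of_le two_le_infty)
    ((hP.contDiffAt (hU'.mem_nhds hzU')).differentiableAt (by simp))
    (by
      filter_upwards [hU'.mem_nhds hzU'] with y hy d
      have := hV y hy.2.2
      simp only [P, map_smul, smul_apply, metric_metricAdj, smul_eq_mul]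
      field_simp) (A z) d
  rw [metric_covDeriv hδ, show christoffel G z (A z) (covDeriv G B C z) d =
    christoffel G z (A z) (fderiv ℝ C z (B z) + P z) d from rfl]
  change metricDet G z * (G z (fderiv ℝ (fun y => fderiv ℝ C y (B y) + P y) z (A z)) d + _) = _
  rw [key]
  simp only [P, map_smul, smul_eq_mul]
  field_simp

/-- The coordinate expression of the covariant curvature. -/
theorem metricDet_mul_curvature (hz : z ∈ Ω) (hδ : metricDet G z ≠ 0)
    {A B C : Coord m → Coord m} {U : Set (Coord m)} (hU : IsOpen U) (hzU : z ∈ U)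
    (hA : ContDiffOn ℝ ∞ A U) (hB : ContDiffOn ℝ ∞ B U) (hC : ContDiffOn ℝ ∞ C U) (d : Coord m) :
    metricDet G z * G z (covDeriv G A (covDeriv G B C) z - covDeriv G B (covDeriv G A C) z
      - covDeriv G (VectorField.lieBracket ℝ A B) C z) d =
    curvNum G z (A z) (B z) (C z) d := by
  have h1 := hG.covDeriv_covDeriv hz hδ (A := A) hU hzU hB hC d
  have h2 := hG.covDeriv_covDeriv hz hδ (A := B) hU hzU hA hC d
  have h3 := metric_covDeriv hδ (VectorField.lieBracket ℝ A B) C d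
  have hCz : ContDiffAt ℝ ∞ C z := hC.contDiffAt (hU.mem_nhds hzU)
  have hsymm : fderiv ℝ (fderiv ℝ C) z (A z) (B z) = fderiv ℝ (fderiv ℝ C) z (B z) (A z) :=
    (hCz.isSymmSndFDerivAt (by simpa using two_le_infty)).eq (A z) (B z)
  have hQ := metricAdj_symm (hG.symm z hz) (christoffel G z (A z) (C z))
    (christoffel G z (B z) d)
  have hQ' := metricAdj_symm (hG.symm z hz) (christoffel G z (B z) (C z))
    (christoffel G z (A z) d)
  simp only [VectorField.lieBracket, map_sub, map_add, sub_apply, add_apply] at h1 h2 h3 ⊢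
  rw [mul_sub, mul_sub, h1, h2, h3, hsymm, curvNum]
  ring

end IsSmoothMetric

end CoordCurvature

/-! ### Singular points in coordinates -/

section SingularPoints

variable {m : ℕ} {G : Coord m → Coord m →L[ℝ] Coord m →L[ℝ] ℝ} {Ω : Set (Coord m)} {z : Coord m}

theorem exists_dual_eq_one {E : Type*} [NormedAddCommGroup E] [NormedSpace ℝ E] {r : E}
    (hr : r ≠ 0) : ∃ α : E →L[ℝ] ℝ, α r = 1 := by
  obtain ⟨α, hα⟩ := SeparatingDual.exists_eq_one (R := ℝ) hr
  exact ⟨α, hα⟩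

theorem exists_apply_ne_zero {E : Type*} [NormedAddCommGroup E] [NormedSpace ℝ E]
    {α : E →L[ℝ] ℝ} (h : α ≠ 0) : ∃ v, α v ≠ 0 := by
  by_contra! h'
  exact h (ContinuousLinearMap.ext h')

/-- Isotropic vectors of a positive semidefinite form lie in its radical. -/
theorem apply_eq_zero_of_nonneg {E : Type*} [AddCommGroup E] [Module ℝ E]
    {b : E → E → ℝ} (hadd : ∀ x y w, b (x + y) w = b x w + b y w)
    (hsmul : ∀ (c : ℝ) x w, b (c • x) w = c * b x w) (hs : ∀ v w, b v w = b w v)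
    (h0 : ∀ v, 0 ≤ b v v) {v : E} (hv : b v v = 0) (w : E) : b v w = 0 := by
  have hq : ∀ t : ℝ, 0 ≤ 2 * t * b v w + b w w := by
    intro t
    have := h0 (t • v + w)
    rw [hadd, hsmul, hs v, hs w, hadd, hadd, hsmul, hsmul, hv, hs w v] at this
    linarith
  by_contra hne
  -- The inequality says that an affine function of t is nowhere negative. If its slope were
  -- non-zero, this t would give it the value −1.
  have h1 := hq (-(b w w + 1) / (2 * b v w))
  have h2 : 2 * (-(b w w + 1) / (2 * b v w)) * b v w = -(b w w + 1) := by field_simp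
  linarith

namespace IsSmoothMetric

variable (hG : IsSmoothMetric G Ω)
include hG

theorem hasFDerivAt_metricDet (hz : z ∈ Ω) :
    HasFDerivAt (metricDet G) (fderiv ℝ (metricDet G) z) z :=
  ((hG.contDiffOn_metricDet.contDiffAt (hG.isOpen.mem_nhds hz)).differentiableAt
    (by simp)).hasFDerivAt

/-- The derivative of the adjugate identity, evaluated on a vector of the radical. -/
theorem fderiv_metricAdj_radical (hz : z ∈ Ω) {r : Coord m} (hr : ∀ w, G z r w = 0)
    (α : Coord m →L[ℝ] ℝ) (v : Coord m) :
    fderiv ℝ G z v (metricAdj G z α) r = fderiv ℝ (metricDet G) z v * α r := by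
  have hQ : DifferentiableAt ℝ (fun z => metricAdj G z α) z :=
    ((contDiffOn_metricAdj hG.contDiffOn contDiffOn_const).contDiffAt
      (hG.isOpen.mem_nhds hz)).differentiableAt (by simp)
  have h1 := hG.fderiv_apply_apply hz hQ (differentiableAt_const r) v
  have h2 : fderiv ℝ (fun y => G y (metricAdj G y α) r) z v =
      fderiv ℝ (metricDet G) z v * α r := by
    simp only [metric_metricAdj]
    rw [((hG.hasFDerivAt_metricDet hz).mul_const (α r)).fderiv]
    simp [mul_comm]
  rw [h2, fderiv_fun_const, hG.symm z hz _ r, hr] at h1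
  simpa using h1.symm

section

variable (hz : z ∈ Ω) (hδ : metricDet G z = 0) (hdδ : fderiv ℝ (metricDet G) z ≠ 0)
include hz hδ hdδ

/-- If the adjugate vanished on a covector α with α r = 1, `fderiv_metricAdj_radical` would give dδ
= 0. So the adjugate is non-zero, which forces corank one. -/
theorem radical_eq_smul {r s : Coord m} (hr0 : r ≠ 0) (hr : ∀ w, G z r w = 0)
    (hs : ∀ w, G z s w = 0) : ∃ c : ℝ, s = c • r := by
  obtain ⟨α, hα⟩ := exists_dual_eq_one hr0
  obtain ⟨v, hv⟩ := exists_apply_ne_zero hdδ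
  refine exists_eq_smul_of_metricAdj_ne_zero (hG.symm z hz) (α := α) ?_ hr0 hr hs
  intro h0
  have := hG.fderiv_metricAdj_radical hz hr α v
  rw [h0, hα] at this
  apply hv
  simpa using this.symm

/-- At a singular point the adjugate has rank one. -/
theorem exists_metricAdj_eq {r : Coord m} (hr0 : r ≠ 0) (hr : ∀ w, G z r w = 0) :
    ∃ c : ℝ, c ≠ 0 ∧ (∀ α, metricAdj G z α = (c * α r) • r) ∧
      ∀ v, fderiv ℝ (metricDet G) z v = c * fderiv ℝ G z v r r := by
  obtain ⟨β, hβ⟩ := exists_dual_eq_one hr0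
  -- Since G(adj α, ·) = δ α = 0 at z, every adj α lies in the radical line. Symmetry of the
  -- adjugate then determines the coefficient.
  have him : ∀ α, ∃ c : ℝ, metricAdj G z α = c • r := fun α =>
    hG.radical_eq_smul hz hδ hdδ hr0 hr fun w => by rw [metric_metricAdj, hδ, zero_mul]
  obtain ⟨c, hc⟩ := him β
  have hQ : ∀ α, metricAdj G z α = (c * α r) • r := by
    intro α
    obtain ⟨c', hc'⟩ := him α
    have := metricAdj_symm (hG.symm z hz) α β
    rw [hc, hc', map_smul, map_smul, hβ, smul_eq_mul, smul_eq_mul, mul_one] at this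
    rw [hc', this]
  have hd : ∀ v, fderiv ℝ (metricDet G) z v = c * fderiv ℝ G z v r r := by
    intro v
    have := hG.fderiv_metricAdj_radical hz hr β v
    rw [hc, hβ, mul_one, map_smul] at this
    exact this.symm
  refine ⟨c, ?_, hQ, hd⟩
  rintro rfl
  exact hdδ (ContinuousLinearMap.ext fun v => by simp [hd])

/-- A vector of the radical extends to a smooth field which is radical at all singular points. -/
theorem exists_radicalField {r : Coord m} (hr0 : r ≠ 0) (hr : ∀ w, G z r w = 0) :
    ∃ Y : Coord m → Coord m, ContDiffOn ℝ ∞ Y Ω ∧ Y z = r ∧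
      ∀ y, metricDet G y = 0 → ∀ w, G y (Y y) w = 0 := by
  obtain ⟨c, hc, hQ, -⟩ := hG.exists_metricAdj_eq hz hδ hdδ hr0 hr
  obtain ⟨α, hα⟩ := exists_dual_eq_one hr0
  -- The identity G(adj α, ·) = δ α makes the adjugate of a fixed covector radical at every zero of
  -- δ, not only at z.
  refine ⟨fun y => metricAdj G y (c⁻¹ • α), contDiffOn_metricAdj hG.contDiffOn contDiffOn_const,
    ?_, fun y hy w => by rw [metric_metricAdj, hy, zero_mul]⟩
  simp [hQ, hα, hc]

/-- The terms with ∂Γ carry the factor δ and drop out. The rank-one adjugate turns Γ·adj·Γ into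
products of values of the second fundamental form. -/
theorem curvNum_singular {r : Coord m} {c : ℝ}
    (hQ : ∀ α, metricAdj G z α = (c * α r) • r) (a b d e : Coord m) :
    curvNum G z a b d e = c * (christoffel G z a d r * christoffel G z b e r
      - christoffel G z b d r * christoffel G z a e r) := by
  simp only [curvNum, hδ, hQ, map_smul, smul_eq_mul]
  ring

/-- Γ(v,r,r) is half of ∂_v G(r,r), which the rank-one formula relates to dδ(v). This identifies the
tangent space of Σ with the kernel of II(·,R). -/
theorem christoffel_radical {r : Coord m} {c : ℝ} (hc : c ≠ 0)
    (hd : ∀ v, fderiv ℝ (metricDet G) z v = c * fderiv ℝ G z v r r) (v : Coord m) :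
    christoffel G z v r r = (2 * c)⁻¹ * fderiv ℝ (metricDet G) z v := by
  rw [hd, christoffel_apply, hG.fderiv_symm hz r v r]
  field_simp
  ring

/-- The limit which defines the tensor `Υ`. -/
theorem tendsto_curvature {V : Set (Coord m)} (hV : IsOpen V) (hzV : z ∈ V)
    {Y A B C D : Coord m → Coord m} (hY : ContDiffOn ℝ ∞ Y V) (hA : ContDiffOn ℝ ∞ A V)
    (hB : ContDiffOn ℝ ∞ B V) (hC : ContDiffOn ℝ ∞ C V) (hD : ContDiffOn ℝ ∞ D V)
    (hY0 : Y z ≠ 0) (hYr : ∀ y ∈ V, metricDet G y = 0 → ∀ w, G y (Y y) w = 0) :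
    Tendsto (fun y => G y (Y y) (Y y) *
        (curvNum G y (A y) (B y) (C y) (D y) / metricDet G y))
      (𝓝[{y | metricDet G y ≠ 0}] z)
      (𝓝 (christoffel G z (A z) (C z) (Y z) * christoffel G z (B z) (D z) (Y z)
        - christoffel G z (B z) (C z) (Y z) * christoffel G z (A z) (D z) (Y z))) := by
  have hr := hYr z hzV hδ
  obtain ⟨c, hc, hQ, hd⟩ := hG.exists_metricAdj_eq hz hδ hdδ hY0 hr
  have hU : IsOpen (V ∩ Ω) := hV.inter hG.isOpen
  have hzU : z ∈ V ∩ Ω := ⟨hzV, hz⟩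
  have hYU := hY.mono (inter_subset_left : V ∩ Ω ⊆ V)
  have hYz : DifferentiableAt ℝ Y z := (hY.contDiffAt (hV.mem_nhds hzV)).differentiableAt (by simp)
  -- The function τ = G(Y,Y) vanishes with δ, so τ = δ h with h smooth, and τ · curvNum / δ = h ·
  -- curvNum extends continuously.
  obtain ⟨V', hV'U, hV', hzV', h, hh, hfac⟩ := exists_contDiffOn_factor hU
    (f := fun y => G y (Y y) (Y y)) (d := metricDet G)
    (((hG.contDiffOn.mono inter_subset_right).clm_apply hYU).clm_apply hYU)
    (hG.contDiffOn_metricDet.mono inter_subset_right) hzU hδ hdδ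
    fun y hy hy0 => hYr y hy.1 hy0 _
  have hhz : ContDiffAt ℝ ∞ h z := hh.contDiffAt (hV'.mem_nhds hzV')
  obtain ⟨v, hv⟩ := exists_apply_ne_zero hdδ
  -- Differentiating τ = δ h at z gives dδ(v) h = ∂_v G(r,r), while dδ(v) = c ∂_v G(r,r). Hence the
  -- limit is free of c.
  have hhc : h z * c = 1 := by
    have h1 := hG.fderiv_apply_apply hz hYz hYz v
    have h2 : fderiv ℝ (fun y => G y (Y y) (Y y)) z = fderiv ℝ (fun y => metricDet G y * h y) z :=
      Filter.EventuallyEq.fderiv_eq (by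
        filter_upwards [hV'.mem_nhds hzV'] with y hy using hfac y hy)
    rw [h2, ((hG.hasFDerivAt_metricDet hz).fun_mul
      (hhz.differentiableAt (by simp)).hasFDerivAt).fderiv, hG.symm z hz _ (Y z), hr] at h1
    simp only [add_apply, smul_apply, smul_eq_mul, hδ, zero_mul, zero_add, add_zero] at h1
    rw [hd] at h1 hv
    have h3 : fderiv ℝ G z v (Y z) (Y z) ≠ 0 := right_ne_zero_of_mul hv
    apply mul_right_cancel₀ h3
    linarith
  have hS := hG.contDiffOn_curvNum inter_subset_right (hA.mono (inter_subset_left : V ∩ Ω ⊆ V))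
    (hB.mono inter_subset_left) (hC.mono inter_subset_left) (hD.mono inter_subset_left)
  have hlim : Tendsto (fun y => h y * curvNum G y (A y) (B y) (C y) (D y)) (𝓝 z)
      (𝓝 (h z * curvNum G z (A z) (B z) (C z) (D z))) :=
    hhz.continuousAt.mul (hS.contDiffAt (hU.mem_nhds hzU)).continuousAt
  rw [hG.curvNum_singular hz hδ hdδ hQ, ← mul_assoc, hhc, one_mul] at hlim
  refine (hlim.mono_left nhdsWithin_le_nhds).congr' ?_
  filter_upwards [self_mem_nhdsWithin, mem_nhdsWithin_of_mem_nhds (hV'.mem_nhds hzV')] with y hy hyV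
  have hy' : metricDet G y ≠ 0 := hy
  rw [hfac y hyV, smul_eq_mul]
  field_simp

end

end IsSmoothMetric

end SingularPoints

/-! ### Adapted frames along the singular hypersurface -/

section Frames

variable {m : ℕ} {G : Coord m → Coord m →L[ℝ] Coord m →L[ℝ] ℝ} {Ω : Set (Coord m)} {z : Coord m}

/-- A smooth field of positive semidefinite bilinear forms, degenerate along the zero set of its
determinant, where the determinant has non-zero differential and the radical is tangent. -/
structure IsTransverseMetric (G : Coord m → Coord m →L[ℝ] Coord m →L[ℝ] ℝ) (Ω : Set (Coord m)) :
    Prop extends IsSmoothMetric G Ω where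
  fderiv_ne_zero : ∀ z ∈ Ω, metricDet G z = 0 → fderiv ℝ (metricDet G) z ≠ 0
  tangent : ∀ z ∈ Ω, metricDet G z = 0 → ∀ r, (∀ w, G z r w = 0) → fderiv ℝ (metricDet G) z r = 0
  nonneg : ∀ z ∈ Ω, metricDet G z = 0 → ∀ v, 0 ≤ G z v v

namespace IsSmoothMetric

/-- The second fundamental form on a radical vector, computed by a tangent extension. -/
theorem tangentField_radical (hG : IsSmoothMetric G Ω) (hz : z ∈ Ω) (hδ : metricDet G z = 0)
    (hdδ : fderiv ℝ (metricDet G) z ≠ 0) {V : Set (Coord m)} (hV : IsOpen V) (hzV : z ∈ V)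
    {Y : Coord m → Coord m} (hY : ContDiffOn ℝ ∞ Y V) (hYz : ∀ w, G z (Y z) w = 0)
    (hrad : ∀ y ∈ Ω, metricDet G y = 0 → ∀ r, (∀ w, G y r w = 0) → fderiv ℝ (metricDet G) y r = 0)
    (hYt : ∀ᶠ y in 𝓝 z, metricDet G y = 0 → fderiv ℝ (metricDet G) y (Y y) = 0)
    {x n : Coord m} (hx : fderiv ℝ (metricDet G) z x = 0) {k : ℝ}
    (hn : ∀ w, G z n w = k * fderiv ℝ (metricDet G) z w) :
    G z (fderiv ℝ Y z x) n + christoffel G z x (Y z) n = - christoffel G z x n (Y z) := by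
  -- Y is compared with a field Z that is radical on the singular set and has the same value at z.
  -- The difference Y − Z is tangent and vanishes at z, so its derivative along the tangent vector x
  -- is tangent (`h1`) and hence orthogonal to n. For Z itself, G(Z, n) vanishes on the singular
  -- set, which gives `h4`.
  obtain ⟨Z, hZ, hZz, hZr⟩ : ∃ Z : Coord m → Coord m, ContDiffOn ℝ ∞ Z Ω ∧ Z z = Y z ∧
      ∀ y, metricDet G y = 0 → ∀ w, G y (Z y) w = 0 := by
    by_cases h0 : Y z = 0
    · exact ⟨fun _ => 0, contDiffOn_const, h0.symm, by simp⟩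
    · exact hG.exists_radicalField hz hδ hdδ h0 hYz
  have hYa : ContDiffAt ℝ ∞ Y z := hY.contDiffAt (hV.mem_nhds hzV)
  have hZa : ContDiffAt ℝ ∞ Z z := hZ.contDiffAt (hG.isOpen.mem_nhds hz)
  have hGa : ContDiffAt ℝ ∞ G z := hG.contDiffOn.contDiffAt (hG.isOpen.mem_nhds hz)
  have hda : ContDiffAt ℝ ∞ (metricDet G) z :=
    hG.contDiffOn_metricDet.contDiffAt (hG.isOpen.mem_nhds hz)
  have hdda : ContDiffAt ℝ ∞ (fderiv ℝ (metricDet G)) z := hda.fderiv_right (by simp)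
  have hYd := hYa.differentiableAt (by simp : (∞ : ℕ∞ω) ≠ 0)
  have hZd := hZa.differentiableAt (by simp : (∞ : ℕ∞ω) ≠ 0)
  have hone : (1 : ℕ∞ω) ≤ ∞ := one_le_two.trans two_le_infty
  have h1 : fderiv ℝ (metricDet G) z (fderiv ℝ Y z x - fderiv ℝ Z z x) = 0 := by
    have h2 := fderiv_apply_eq_zero_of_vanishing
      (f := fun y => fderiv ℝ (metricDet G) y (Y y - Z y)) (d := metricDet G) (z₀ := z)
      ((hdda.clm_apply (hYa.sub hZa)).of_le hone) (hda.of_le hone) hδ hdδ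
      (by
        filter_upwards [hYt, hG.isOpen.mem_nhds hz] with y hy hyΩ hy0
        rw [map_sub, hy hy0, hrad y hyΩ hy0 _ (hZr y hy0), sub_zero]) hx
    rw [((hdda.differentiableAt (by simp)).hasFDerivAt.clm_apply
      (hYd.hasFDerivAt.fun_sub hZd.hasFDerivAt)).fderiv] at h2
    simpa [hZz] using h2
  have h3 : G z (fderiv ℝ Y z x) n = G z (fderiv ℝ Z z x) n := by
    rw [hG.symm z hz _ n, hG.symm z hz _ n, hn, hn, ← sub_eq_zero, ← mul_sub, ← map_sub, h1,
      mul_zero]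
  have h4 : fderiv ℝ G z x (Y z) n + G z (fderiv ℝ Z z x) n = 0 := by
    have h5 := fderiv_apply_eq_zero_of_vanishing
      (f := fun y => G y (Z y) n) (d := metricDet G) (z₀ := z)
      (((hGa.clm_apply hZa).clm_apply contDiffAt_const).of_le hone) (hda.of_le hone) hδ hdδ
      (Eventually.of_forall fun y hy0 => hZr y hy0 n) hx
    rw [hG.fderiv_apply_apply hz hZd (differentiableAt_const n), hZz] at h5
    simpa using h5
  have h6 := hG.christoffel_add_christoffel hz x (Y z) n
  rw [h3]
  linarith

end IsSmoothMetric

namespace IsTransverseMetric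

variable (hG : IsTransverseMetric G Ω)
include hG

theorem exists_radical (hz : z ∈ Ω) (hδ : metricDet G z = 0) : ∃ r ≠ 0, ∀ w, G z r w = 0 :=
  (metricDet_eq_zero_iff (hG.symm z hz)).1 hδ

/-- Near a singular point there is a smooth field orthogonal to the singular hypersurface. -/
theorem exists_normalField (hz : z ∈ Ω) (hδ : metricDet G z = 0) :
    ∃ V ⊆ Ω, IsOpen V ∧ z ∈ V ∧ ∃ n : Coord m → Coord m, ContDiffOn ℝ ∞ n V ∧
      ∀ y ∈ V, metricDet G y = 0 →
        ∃ k ≠ 0, ∀ w, G y (n y) w = k * fderiv ℝ (metricDet G) y w := by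
  have hdδ := hG.fderiv_ne_zero z hz hδ
  obtain ⟨r, hr0, hr⟩ := hG.exists_radical hz hδ
  obtain ⟨Y, hY, hYz, hYr⟩ := hG.exists_radicalField hz hδ hdδ hr0 hr
  obtain ⟨ξ, hξ⟩ := exists_dual_eq_one hr0
  -- Adding ξ⊗ξ with ξ r = 1 makes the form nondegenerate near z, so dδ can be represented by a
  -- smooth field n through G'. At singular points, testing against the radical, which is tangent,
  -- gives ξ n = 0. Thus n represents a multiple of dδ through G as well.
  let G' : Coord m → Coord m →L[ℝ] Coord m →L[ℝ] ℝ := fun y => G y + ξ.smulRight ξ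
  have hG'a : ∀ y v w, G' y v w = G y v w + ξ v * ξ w := fun y v w => by simp [G']
  have hG' : IsSmoothMetric G' Ω := by
    refine ⟨hG.isOpen, hG.contDiffOn.add contDiffOn_const, fun y hy v w => ?_⟩
    rw [hG'a, hG'a, hG.symm y hy, mul_comm]
  have hδ' : metricDet G' z ≠ 0 := by
    intro h0
    obtain ⟨v, hv0, hv⟩ := (metricDet_eq_zero_iff (hG'.symm z hz)).1 h0
    have h1 := hv r
    rw [hG'a, hG.symm z hz, hr, hξ, zero_add, mul_one] at h1
    obtain ⟨c, rfl⟩ := hG.radical_eq_smul hz hδ hdδ hr0 hr (s := v) fun w => by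
      have := hv w
      rwa [hG'a, h1, zero_mul, add_zero] at this
    rw [map_smul, hξ, smul_eq_mul, mul_one] at h1
    exact hv0 (by rw [h1, zero_smul])
  have hev : ∀ᶠ y in 𝓝 z, y ∈ Ω ∧ metricDet G' y ≠ 0 ∧ ξ (Y y) ≠ 0 := by
    have : ContinuousAt (fun y => ξ (Y y)) z :=
      ξ.continuous.continuousAt.comp (hY.continuousOn.continuousAt (hG.isOpen.mem_nhds hz))
    filter_upwards [hG.isOpen.mem_nhds hz, hG'.eventually_metricDet_ne_zero hz hδ',
      this.eventually_ne (by rw [hYz, hξ]; exact one_ne_zero)] with y h1 h2 h3 using ⟨h1, h2, h3⟩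
  obtain ⟨V, hV, hVo, hzV⟩ := eventually_nhds_iff.1 hev
  have hVΩ : V ⊆ Ω := fun y hy => (hV y hy).1
  have hdd : ContDiffOn ℝ ∞ (fderiv ℝ (metricDet G)) Ω :=
    hG.contDiffOn_metricDet.fderiv_of_isOpen hG.isOpen (by simp)
  refine ⟨V, hVΩ, hVo, hzV, fun y => metricAdj G' y (fderiv ℝ (metricDet G) y),
    (contDiffOn_metricAdj hG'.contDiffOn hdd).mono hVΩ, fun y hy hy0 => ?_⟩
  obtain ⟨hyΩ, hyδ, hyξ⟩ := hV y hy
  refine ⟨metricDet G' y, hyδ, fun w => ?_⟩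
  have h1 := fun w => metric_metricAdj (G := G') (z := y) (fderiv ℝ (metricDet G) y) w
  have h2 := h1 (Y y)
  rw [hG.tangent y hyΩ hy0 _ (hYr y hy0), mul_zero, hG'a, hG.symm y hyΩ, hYr y hy0, zero_add] at h2
  have h3 := (mul_eq_zero.1 h2).resolve_right hyξ
  have h4 := h1 w
  rwa [hG'a, h3, zero_mul, add_zero] at h4

/-- A vector orthogonal to the singular hypersurface, but not radical, is transverse to it. -/
theorem fderiv_normal_ne_zero (hz : z ∈ Ω) (hδ : metricDet G z = 0) {n : Coord m} {k : ℝ}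
    (hk : k ≠ 0) (hn : ∀ w, G z n w = k * fderiv ℝ (metricDet G) z w) :
    fderiv ℝ (metricDet G) z n ≠ 0 := by
  intro h0
  obtain ⟨v, hv⟩ := exists_apply_ne_zero (hG.fderiv_ne_zero z hz hδ)
  -- If n were tangent, it would be isotropic for a semidefinite form, hence radical, contradicting
  -- G(n, ·) = k dδ ≠ 0.
  have h1 := apply_eq_zero_of_nonneg (b := fun v w => G z v w) (by simp) (by simp)
    (hG.symm z hz) (hG.nonneg z hz hδ) (v := n) (by rw [hn, h0, mul_zero]) v
  rw [hn] at h1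
  exact mul_ne_zero hk hv h1

/-- Smooth fields near a singular point which at singular points are radical, respectively
orthogonal to the singular hypersurface and isotropic for the second fundamental form. -/
theorem exists_frame (hz : z ∈ Ω) (hδ : metricDet G z = 0) :
    ∃ V ⊆ Ω, IsOpen V ∧ z ∈ V ∧ ∃ n Y : Coord m → Coord m, ContDiffOn ℝ ∞ n V ∧
      ContDiffOn ℝ ∞ Y V ∧
      (∀ y ∈ V, fderiv ℝ (metricDet G) y (n y) ≠ 0 ∧ christoffel G y (Y y) (n y) (Y y) ≠ 0) ∧
      ∀ y ∈ V, metricDet G y = 0 → Y y ≠ 0 ∧ (∀ w, G y (Y y) w = 0) ∧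
        (∃ k ≠ 0, ∀ w, G y (n y) w = k * fderiv ℝ (metricDet G) y w) ∧
        christoffel G y (n y) (n y) (Y y) = 0 := by
  have hdδ := hG.fderiv_ne_zero z hz hδ
  obtain ⟨r, hr0, hr⟩ := hG.exists_radical hz hδ
  obtain ⟨Y, hY, hYz, hYr⟩ := hG.exists_radicalField hz hδ hdδ hr0 hr
  obtain ⟨V, hVΩ, hV, hzV, n, hn, hnk⟩ := hG.exists_normalField hz hδ
  have hdd : ContDiffOn ℝ ∞ (fderiv ℝ (metricDet G)) V :=
    (hG.contDiffOn_metricDet.fderiv_of_isOpen hG.isOpen (by simp)).mono hVΩ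
  have hYV := hY.mono hVΩ
  have hrel : ∀ y ∈ V, metricDet G y = 0 → Y y ≠ 0 →
      christoffel G y (Y y) (Y y) (Y y) = 0 ∧
        (∀ v, fderiv ℝ (metricDet G) y v ≠ 0 → christoffel G y v (Y y) (Y y) ≠ 0) := by
    intro y hy hy0 hYy
    obtain ⟨c, hc, -, hd⟩ := hG.exists_metricAdj_eq (hVΩ hy) hy0
      (hG.fderiv_ne_zero y (hVΩ hy) hy0) hYy (hYr y hy0)
    have h1 := hG.christoffel_radical (hVΩ hy) hy0 (hG.fderiv_ne_zero y (hVΩ hy) hy0) hc hd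
    refine ⟨by rw [h1, hG.tangent y (hVΩ hy) hy0 _ (hYr y hy0), mul_zero], fun v hv => ?_⟩
    rw [h1]
    exact mul_ne_zero (by positivity) hv
  have hYz0 : Y z ≠ 0 := by rwa [hYz]
  have hdn : fderiv ℝ (metricDet G) z (n z) ≠ 0 := by
    obtain ⟨k, hk, h⟩ := hnk z hzV hδ
    exact hG.fderiv_normal_ne_zero hz hδ hk h
  have hsub : ∀ {A B C : Coord m → Coord m}, ContDiffOn ℝ ∞ A V → ContDiffOn ℝ ∞ B V →
      ContDiffOn ℝ ∞ C V → ContDiffOn ℝ ∞ (fun z => christoffel G z (A z) (B z) (C z)) V :=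
    fun hA hB hC => hG.contDiffOn_christoffel_apply hVΩ hA hB hC
  have hev1 : ∀ᶠ y in 𝓝 z, y ∈ V ∧ Y y ≠ 0 ∧ christoffel G y (n y) (Y y) (Y y) ≠ 0 := by
    have h1 := hYV.continuousOn.continuousAt (hV.mem_nhds hzV)
    have h2 := (hsub hn hYV hYV).continuousOn.continuousAt (hV.mem_nhds hzV)
    filter_upwards [hV.mem_nhds hzV, h1.eventually_ne hYz0,
      h2.eventually_ne ((hrel z hzV hδ hYz0).2 _ hdn)] with y h1 h2 h3 using ⟨h1, h2, h3⟩
  obtain ⟨V₁, hV₁, hV₁o, hzV₁⟩ := eventually_nhds_iff.1 hev1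
  have hV₁V : V₁ ⊆ V := fun y hy => (hV₁ y hy).1
  -- On the singular set Γ(Y,Y,Y) = 0, so Γ(n + tY, n + tY, Y) = Γ(n,n,Y) + 2t Γ(n,Y,Y). This t
  -- makes it vanish, and adding the radical tY does not affect orthogonality to Σ.
  let t : Coord m → ℝ := fun y =>
    -(christoffel G y (n y) (n y) (Y y) / (2 * christoffel G y (n y) (Y y) (Y y)))
  have ht : ContDiffOn ℝ ∞ t V₁ :=
    (((hsub hn hn hYV).mono hV₁V).div (contDiffOn_const.mul ((hsub hn hYV hYV).mono hV₁V))
      fun y hy => mul_ne_zero two_ne_zero (hV₁ y hy).2.2).neg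
  let n' : Coord m → Coord m := fun y => n y + t y • Y y
  have hn' : ContDiffOn ℝ ∞ n' V₁ := (hn.mono hV₁V).add (ht.smul (hYV.mono hV₁V))
  have hk' : ∀ y ∈ V₁, metricDet G y = 0 →
      ∃ k ≠ 0, ∀ w, G y (n' y) w = k * fderiv ℝ (metricDet G) y w := by
    intro y hy hy0
    obtain ⟨k, hk, h⟩ := hnk y (hV₁V hy) hy0
    refine ⟨k, hk, fun w => ?_⟩
    simp only [n', map_add, map_smul, add_apply, smul_apply, h, hYr y hy0, smul_zero, add_zero]
  have hΓ' : ∀ y ∈ V₁, metricDet G y = 0 → christoffel G y (n' y) (n' y) (Y y) = 0 := by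
    intro y hy hy0
    have h1 := (hrel y (hV₁V hy) hy0 (hV₁ y hy).2.1).1
    have h2 := hG.christoffel_symm (hVΩ (hV₁V hy)) (Y y) (n y) (Y y)
    have h3 := (hV₁ y hy).2.2
    simp only [n', t, map_add, map_smul, add_apply, smul_apply, smul_eq_mul, h1, h2]
    field_simp
    ring
  have hdn' : fderiv ℝ (metricDet G) z (n' z) ≠ 0 := by
    obtain ⟨k, hk, h⟩ := hk' z hzV₁ hδ
    exact hG.fderiv_normal_ne_zero hz hδ hk h
  have hΓn' : christoffel G z (Y z) (n' z) (Y z) ≠ 0 := by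
    rw [hG.christoffel_symm hz]
    exact (hrel z hzV hδ hYz0).2 _ hdn'
  have hsub' : ContDiffOn ℝ ∞ (fun y => christoffel G y (Y y) (n' y) (Y y)) V₁ :=
    hG.contDiffOn_christoffel_apply (hV₁V.trans hVΩ) (hYV.mono hV₁V) hn' (hYV.mono hV₁V)
  have hev2 : ∀ᶠ y in 𝓝 z, y ∈ V₁ ∧ fderiv ℝ (metricDet G) y (n' y) ≠ 0 ∧
      christoffel G y (Y y) (n' y) (Y y) ≠ 0 := by
    have h1 : ContinuousAt (fun y => fderiv ℝ (metricDet G) y (n' y)) z :=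
      ((hdd.mono hV₁V).clm_apply hn').continuousOn.continuousAt (hV₁o.mem_nhds hzV₁)
    have h2 := hsub'.continuousOn.continuousAt (hV₁o.mem_nhds hzV₁)
    filter_upwards [hV₁o.mem_nhds hzV₁, h1.eventually_ne hdn', h2.eventually_ne hΓn']
      with y h1 h2 h3 using ⟨h1, h2, h3⟩
  obtain ⟨V₂, hV₂, hV₂o, hzV₂⟩ := eventually_nhds_iff.1 hev2
  have hV₂V : V₂ ⊆ V₁ := fun y hy => (hV₂ y hy).1
  exact ⟨V₂, (hV₂V.trans hV₁V).trans hVΩ, hV₂o, hzV₂, n', Y, hn'.mono hV₂V,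
    hYV.mono (hV₂V.trans hV₁V), fun y hy => (hV₂ y hy).2, fun y hy hy0 =>
      ⟨(hV₁ y (hV₂V hy)).2.1, hYr y hy0, hk' y (hV₂V hy) hy0, hΓ' y (hV₂V hy) hy0⟩⟩

/-- Screen vectors extend to smooth fields of screen vectors. -/
theorem exists_screenField {V : Set (Coord m)} (hVΩ : V ⊆ Ω) {n Y : Coord m → Coord m}
    (hn : ContDiffOn ℝ ∞ n V) (hY : ContDiffOn ℝ ∞ Y V)
    (hne : ∀ y ∈ V, fderiv ℝ (metricDet G) y (n y) ≠ 0 ∧ christoffel G y (Y y) (n y) (Y y) ≠ 0)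
    (hYr : ∀ y ∈ V, metricDet G y = 0 → ∀ w, G y (Y y) w = 0) {v : Coord m}
    (hv : fderiv ℝ (metricDet G) z v = 0) (hv' : christoffel G z v (n z) (Y z) = 0) :
    ∃ A : Coord m → Coord m, ContDiffOn ℝ ∞ A V ∧ A z = v ∧ ∀ y ∈ V, metricDet G y = 0 →
      fderiv ℝ (metricDet G) y (A y) = 0 ∧ christoffel G y (A y) (n y) (Y y) = 0 := by
  have hdd : ContDiffOn ℝ ∞ (fderiv ℝ (metricDet G)) V :=
    (hG.contDiffOn_metricDet.fderiv_of_isOpen hG.isOpen (by simp)).mono hVΩ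
  -- The constant field v is first corrected along n to be annihilated by dδ, then along Y to be
  -- annihilated by Γ(·, n, Y). The second correction preserves the first because the radical is
  -- tangent, and at z both corrections vanish.
  let A₁ : Coord m → Coord m := fun y =>
    v - (fderiv ℝ (metricDet G) y v / fderiv ℝ (metricDet G) y (n y)) • n y
  have hA₁ : ContDiffOn ℝ ∞ A₁ V :=
    contDiffOn_const.sub (((hdd.clm_apply contDiffOn_const).div (hdd.clm_apply hn)
      fun y hy => (hne y hy).1).smul hn)
  have hA₁z : A₁ z = v := by simp [A₁, hv]
  refine ⟨fun y => A₁ y - (christoffel G y (A₁ y) (n y) (Y y) /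
    christoffel G y (Y y) (n y) (Y y)) • Y y, ?_, ?_, fun y hy hy0 => ⟨?_, ?_⟩⟩
  · exact hA₁.sub (((hG.contDiffOn_christoffel_apply hVΩ hA₁ hn hY).div
      (hG.contDiffOn_christoffel_apply hVΩ hY hn hY) fun y hy => (hne y hy).2).smul hY)
  · simp [hA₁z, hv']
  · have h1 := (hne y hy).1
    rw [map_sub, map_smul, hG.tangent y (hVΩ hy) hy0 _ (hYr y hy hy0), smul_zero, sub_zero]
    simp only [A₁, map_sub, map_smul, smul_eq_mul]
    field_simp
    ring
  · have h1 := (hne y hy).2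
    simp only [map_sub, map_smul, sub_apply, smul_apply, smul_eq_mul]
    field_simp
    ring

end IsTransverseMetric

end Frames

/-! ### Vector fields and symmetric tensors in a coordinate system -/

section Transport

theorem exists_symm_eq {M : Type*} [TopologicalSpace M] {m : ℕ}
    {e : OpenPartialHomeomorph M (Coord m)} {x : M} (hx : x ∈ e.source) :
    ∃ z ∈ e.target, e.symm z = x := ⟨e x, e.map_source hx, e.left_inv hx⟩

variable {m : ℕ} {M : Type*} [TopologicalSpace M] [ChartedSpace (EuclideanSpace ℝ (Fin m)) M]

/-- The coordinate isomorphism from the coordinate space to the tangent space. -/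
def push (e : OpenPartialHomeomorph M (Coord m)) (z : Coord m) :
    Coord m →L[ℝ] TangentSpace (𝓡 m) (e.symm z) :=
  mfderiv (𝓡 m) (𝓡 m) e.symm z

/-- The components of tangent vectors in a coordinate system. -/
def pull (e : OpenPartialHomeomorph M (Coord m)) (z : Coord m) :
    TangentSpace (𝓡 m) (e.symm z) →L[ℝ] Coord m :=
  (push e z).inverse

/-- The coordinate expression of a vector field. -/
def coordField (e : OpenPartialHomeomorph M (Coord m)) (A : VField m M) (z : Coord m) : Coord m :=
  pull e z (A (e.symm z))

/-- The vector field with a given coordinate expression. -/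
def ofCoord (e : OpenPartialHomeomorph M (Coord m)) (X : Coord m → Coord m) : VField m M :=
  VectorField.mpullback (𝓡 m) (𝓡 m) e X

variable {e : OpenPartialHomeomorph M (Coord m)}

theorem mdifferentiable_of_mem_maximalAtlas
    (he : e ∈ IsManifold.maximalAtlas (𝓡 m) ∞ M) : e.MDifferentiable (𝓡 m) (𝓡 m) :=
  ⟨(contMDiffOn_of_mem_maximalAtlas he).mdifferentiableOn (by simp),
    (contMDiffOn_symm_of_mem_maximalAtlas he).mdifferentiableOn (by simp)⟩

variable [IsManifold (𝓡 m) ∞ M] (he : e ∈ IsManifold.maximalAtlas (𝓡 m) ∞ M) {z : Coord m}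
include he

theorem push_isInvertible (hz : z ∈ e.target) : (push e z).IsInvertible :=
  ⟨(mdifferentiable_of_mem_maximalAtlas he).symm.mfderiv hz, rfl⟩

theorem push_pull (hz : z ∈ e.target) (v : TangentSpace (𝓡 m) (e.symm z)) :
    push e z (pull e z v) = v :=
  (push_isInvertible he hz).self_apply_inverse v

theorem pull_push (hz : z ∈ e.target) (v : Coord m) : pull e z (push e z v) = v :=
  (push_isInvertible he hz).inverse_apply_self v

theorem pull_eq_zero_iff (hz : z ∈ e.target) {v : TangentSpace (𝓡 m) (e.symm z)} :
    pull e z v = 0 ↔ v = 0 := by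
  refine ⟨fun h => ?_, fun h => by rw [h, map_zero]⟩
  rw [← push_pull he hz v, h, map_zero]

theorem ofCoord_symm_apply (hz : z ∈ e.target) (X : Coord m → Coord m) :
    ofCoord e X (e.symm z) = push e z (X z) := by
  have he' := mdifferentiable_of_mem_maximalAtlas he
  have hinv : (mfderiv (𝓡 m) (𝓡 m) e (e.symm z)).IsInvertible :=
    ⟨he'.mfderiv (e.map_target hz), rfl⟩
  have h1 : ∀ w : Coord m, (mfderiv (𝓡 m) (𝓡 m) e (e.symm z)).inverse w = push e z w := by
    intro w
    refine hinv.inverse_apply_eq.2 ?_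
    exact (congrArg (fun L : Coord m →L[ℝ] Coord m => L w) (he'.comp_symm_deriv hz)).symm
  have h2 : X (e (e.symm z)) = X z := by rw [e.right_inv hz]
  exact (congrArg (mfderiv (𝓡 m) (𝓡 m) e (e.symm z)).inverse h2).trans (h1 (X z))

theorem coordField_ofCoord (hz : z ∈ e.target) (X : Coord m → Coord m) :
    coordField e (ofCoord e X) z = X z := by
  rw [coordField, ofCoord_symm_apply he hz, pull_push he hz]

theorem ofCoord_coordField {x : M} (hx : x ∈ e.source) (A : VField m M) :
    ofCoord e (coordField e A) x = A x := by
  obtain ⟨z, hz, rfl⟩ := exists_symm_eq hx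
  rw [ofCoord_symm_apply he hz, coordField, push_pull he hz]

theorem contDiffOn_coordField {A : VField m M} {W : Set M} (hW : IsOpen W)
    (hA : SmoothFieldOn A W) : ContDiffOn ℝ ∞ (coordField e A) (e.target ∩ e.symm ⁻¹' W) := by
  rintro z ⟨hz, hzW⟩
  have h1 := (hA.contMDiffAt (hW.mem_nhds hzW))
  have h2 := (contMDiffOn_symm_of_mem_maximalAtlas he).contMDiffAt (e.open_target.mem_nhds hz)
  have h3 := ContMDiffAt.mpullback_vectorField_preimage (f := e.symm) (x₀ := z) (V := A) h1 h2
    (push_isInvertible he hz) (by simp)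
  exact (contMDiffAt_vectorSpace_iff_contDiffAt.1 h3).contDiffWithinAt

theorem smoothFieldOn_ofCoord {X : Coord m → Coord m} {V : Set (Coord m)} (hV : IsOpen V)
    (hX : ContDiffOn ℝ ∞ X V) : SmoothFieldOn (ofCoord e X) (e.source ∩ e ⁻¹' V) := by
  rintro x ⟨hx, hxV⟩
  have h1 := contMDiffAt_vectorSpace_iff_contDiffAt.2 (hX.contDiffAt (hV.mem_nhds hxV))
  have h2 := (contMDiffOn_of_mem_maximalAtlas he).contMDiffAt (e.open_source.mem_nhds hx)
  have h3 := ContMDiffAt.mpullback_vectorField_preimage (f := e) (x₀ := x) (V := X) h1 h2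
    ⟨(mdifferentiable_of_mem_maximalAtlas he).mfderiv hx, rfl⟩ (by simp)
  exact h3.contMDiffWithinAt

theorem coordField_mlieBracket {A B : VField m M} {W : Set M} (hW : IsOpen W)
    (hA : SmoothFieldOn A W) (hB : SmoothFieldOn B W) (hz : z ∈ e.target) (hzW : e.symm z ∈ W) :
    coordField e (VectorField.mlieBracket (𝓡 m) A B) z =
      VectorField.lieBracket ℝ (coordField e A) (coordField e B) z := by
  have h2 := (contMDiffOn_symm_of_mem_maximalAtlas he).contMDiffAt (e.open_target.mem_nhds hz)
  have h22 : minSmoothness ℝ 2 ≤ (∞ : ℕ∞ω) := by simpa using two_le_infty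
  have : IsManifold (𝓡 m) (minSmoothness ℝ 2) M := IsManifold.of_le (n := ∞) h22
  have := VectorField.mpullback_mlieBracket (I := 𝓡 m) (I' := 𝓡 m) (f := e.symm)
    (x₀ := z) (V := A) (W := B)
    (n := ∞) ((hA.contMDiffAt (hW.mem_nhds hzW)).mdifferentiableAt (by simp))
    ((hB.contMDiffAt (hW.mem_nhds hzW)).mdifferentiableAt (by simp)) h2 h22
  rw [← VectorField.mlieBracketWithin_univ (I := 𝓡 m) (M := EuclideanSpace ℝ (Fin m)),
    VectorField.mlieBracketWithin_eq_lieBracketWithin] at this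
  exact this.trans (congrFun (VectorField.lieBracketWithin_univ (𝕜 := ℝ) (V := coordField e A)
    (W := coordField e B)) z)

theorem fderiv_comp_symm {f : M → ℝ} (hz : z ∈ e.target)
    (hf : MDifferentiableAt (𝓡 m) 𝓘(ℝ, ℝ) f (e.symm z)) (v : TangentSpace (𝓡 m) (e.symm z)) :
    mvfderiv (𝓡 m) f (e.symm z) v = fderiv ℝ (fun y => f (e.symm y)) z (pull e z v) := by
  have h2 := ((contMDiffOn_symm_of_mem_maximalAtlas he).contMDiffAt
    (e.open_target.mem_nhds hz)).mdifferentiableAt (by simp)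
  have h3 := mvfderiv_comp_apply z hf h2 (pull e z v)
  have h4 : mfderiv (𝓡 m) (𝓡 m) e.symm z (pull e z v) = v := push_pull he hz v
  rw [h4] at h3
  exact h3.symm.trans (congrArg (fun L : Coord m →L[ℝ] ℝ => L (pull e z v)) mfderiv_eq_fderiv)

end Transport

/-! ### The metric, its connection and its curvature in coordinates -/

section Tensor

variable {m : ℕ} {M : Type*} [TopologicalSpace M] [ChartedSpace (EuclideanSpace ℝ (Fin m)) M]
  [IsManifold (𝓡 m) ∞ M] {e : OpenPartialHomeomorph M (Coord m)}

theorem SmoothFieldOn.mono {A : VField m M} {W W' : Set M} (hA : SmoothFieldOn A W)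
    (h : W' ⊆ W) : SmoothFieldOn A W' :=
  ContMDiffOn.mono hA h

theorem SmoothFieldOn.congr {A B : VField m M} {W : Set M} (hA : SmoothFieldOn A W)
    (h : ∀ x ∈ W, B x = A x) : SmoothFieldOn B W :=
  ContMDiffOn.congr hA fun x hx => by rw [h x hx]

theorem SmoothFieldOn.near {A : VField m M} {W : Set M} (hA : SmoothFieldOn A W) (hW : IsOpen W)
    {p : M} (hp : p ∈ W) : SmoothFieldNear A p :=
  ⟨W, hW, hp, hA⟩

theorem ext_self {p : M} (v : TangentSpace (𝓡 m) p) :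
    SymTensor.ext v p = v := FiberBundle.extend_apply_self (EuclideanSpace ℝ (Fin m)) v

theorem smoothFieldNear_ext {p : M} (v : TangentSpace (𝓡 m) p) :
    SmoothFieldNear (SymTensor.ext v) p := by
  let t := trivializationAt (EuclideanSpace ℝ (Fin m)) (TangentSpace (𝓡 m) : M → Type _) p
  refine ⟨t.baseSet, t.open_baseSet, FiberBundle.mem_baseSet_trivializationAt' p, ?_⟩
  unfold SmoothFieldOn
  rw [t.contMDiffOn_section_baseSet_iff]
  refine (contMDiffOn_const (c := (t ⟨p, v⟩).2)).congr fun x hx => ?_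
  have h := congrArg Prod.snd (t.apply_mk_symm hx (t ⟨p, v⟩).2)
  exact h

theorem SmoothFieldNear.exists_contDiffOn (he : e ∈ IsManifold.maximalAtlas (𝓡 m) ∞ M)
    {z : Coord m} (hz : z ∈ e.target) {A : VField m M} (hA : SmoothFieldNear A (e.symm z)) :
    ∃ U ⊆ e.target, IsOpen U ∧ z ∈ U ∧ ContDiffOn ℝ ∞ (coordField e A) U := by
  obtain ⟨W, hW, hzW, hAW⟩ := hA
  exact ⟨_, inter_subset_left, e.isOpen_inter_preimage_symm hW, ⟨hz, hzW⟩,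
    contDiffOn_coordField he hW hAW⟩

theorem SmoothFieldNear.differentiableAt (he : e ∈ IsManifold.maximalAtlas (𝓡 m) ∞ M)
    {z : Coord m} (hz : z ∈ e.target) {A : VField m M} (hA : SmoothFieldNear A (e.symm z)) :
    DifferentiableAt ℝ (coordField e A) z := by
  obtain ⟨U, -, hU, hzU, h⟩ := hA.exists_contDiffOn he hz
  exact (h.contDiffAt (hU.mem_nhds hzU)).differentiableAt (by simp)

theorem smoothFieldOn_of_coordField (he : e ∈ IsManifold.maximalAtlas (𝓡 m) ∞ M) {A : VField m M}
    {V : Set (Coord m)} (hV : IsOpen V) (hA : ContDiffOn ℝ ∞ (coordField e A) V) :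
    SmoothFieldOn A (e.source ∩ e ⁻¹' V) :=
  (smoothFieldOn_ofCoord he hV hA).congr fun _ hx => (ofCoord_coordField he hx.1 A).symm

namespace SymTensor

variable (g : SymTensor m M)

theorem contMDiffOn_form {A B : VField m M} {W : Set M} (hA : SmoothFieldOn A W)
    (hB : SmoothFieldOn B W) :
    ContMDiffOn (𝓡 m) 𝓘(ℝ, ℝ) ∞ (fun x => g.form x (A x) (B x)) W := by
  intro x hx
  have : ContMDiffWithinAt (𝓡 m) ((𝓡 m).prod 𝓘(ℝ)) ∞
      (fun x ↦ TotalSpace.mk' ℝ (E := Bundle.Trivial M ℝ) x (g.form x (A x) (B x))) W x := by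
    apply ContMDiffWithinAt.clm_bundle_apply₂ (F₁ := EuclideanSpace ℝ (Fin m))
      (F₂ := EuclideanSpace ℝ (Fin m))
    · exact g.contMDiff.contMDiffAt.contMDiffWithinAt
    · exact hA x hx
    · exact hB x hx
  simp only [contMDiffWithinAt_totalSpace] at this
  exact this.2

/-- The expression of `g` in a coordinate system. -/
def coordMetric (e : OpenPartialHomeomorph M (Coord m)) (z : Coord m) :
    Coord m →L[ℝ] Coord m →L[ℝ] ℝ :=
  let b : Coord m →L[ℝ] Coord m →L[ℝ] ℝ := g.form (e.symm z)
  let φ : Coord m →L[ℝ] Coord m := push e z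
  b.bilinearComp φ φ

theorem coordMetric_apply (e : OpenPartialHomeomorph M (Coord m)) (z v w : Coord m) :
    g.coordMetric e z v w = g.form (e.symm z) (push e z v) (push e z w) := rfl

variable (he : e ∈ IsManifold.maximalAtlas (𝓡 m) ∞ M) {z : Coord m}
include he

theorem coordMetric_pull (hz : z ∈ e.target) (v w : TangentSpace (𝓡 m) (e.symm z)) :
    g.coordMetric e z (pull e z v) (pull e z w) = g.form (e.symm z) v w := by
  rw [coordMetric_apply, push_pull he hz, push_pull he hz]

theorem isSmoothMetric_coordMetric : IsSmoothMetric (g.coordMetric e) e.target := by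
  refine ⟨e.open_target, ?_, fun z _ v w => g.symm _ _ _⟩
  refine contDiffOn_clm_apply.2 fun v => contDiffOn_clm_apply.2 fun w => ?_
  have h1 : ∀ v : Coord m, SmoothFieldOn (ofCoord e fun _ => v) e.source := fun v => by
    simpa using smoothFieldOn_ofCoord he isOpen_univ (contDiffOn_const (c := v))
  have h2 := (g.contMDiffOn_form (h1 v) (h1 w)).comp (contMDiffOn_symm_of_mem_maximalAtlas he)
    e.mapsTo_symm
  rw [contMDiffOn_iff_contDiffOn] at h2
  refine h2.congr fun z hz => ?_
  simp only [Function.comp, ofCoord_symm_apply he hz, coordMetric_apply]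

theorem mem_radical_iff (hz : z ∈ e.target) (v : TangentSpace (𝓡 m) (e.symm z)) :
    v ∈ g.radical (e.symm z) ↔ ∀ w, g.coordMetric e z (pull e z v) w = 0 := by
  constructor
  · intro h w
    rw [← pull_push he hz w, g.coordMetric_pull he hz]
    exact h _
  · intro h w
    rw [← g.coordMetric_pull he hz]
    exact h _

theorem push_mem_radical_iff (hz : z ∈ e.target) (v : Coord m) :
    push e z v ∈ g.radical (e.symm z) ↔ ∀ w, g.coordMetric e z v w = 0 := by
  rw [g.mem_radical_iff he hz, pull_push he hz]

theorem mem_singularSet_iff (hz : z ∈ e.target) :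
    e.symm z ∈ g.singularSet ↔ metricDet (g.coordMetric e) z = 0 := by
  rw [metricDet_eq_zero_iff ((g.isSmoothMetric_coordMetric he).symm z hz)]
  change g.radical (e.symm z) ≠ ⊥ ↔ _
  rw [Submodule.ne_bot_iff]
  constructor
  · rintro ⟨v, hv, hv0⟩
    exact ⟨pull e z v, fun h => hv0 ((pull_eq_zero_iff he hz).1 h),
      (g.mem_radical_iff he hz v).1 hv⟩
  · rintro ⟨v, hv0, hv⟩
    refine ⟨push e z v, (g.push_mem_radical_iff he hz v).2 hv, fun h => hv0 ?_⟩
    rw [← pull_push he hz v, h, map_zero]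

omit he in
theorem isClosed_singularSet : IsClosed g.singularSet := by
  rw [← isOpen_compl_iff, isOpen_iff_mem_nhds]
  intro p hp
  set e := chartAt (EuclideanSpace ℝ (Fin m)) p with he_def
  have he : e ∈ IsManifold.maximalAtlas (𝓡 m) ∞ M := IsManifold.chart_mem_maximalAtlas p
  have hps : p ∈ e.source := mem_chart_source _ p
  have hG := g.isSmoothMetric_coordMetric he
  have hz := e.map_source hps
  have h1 : metricDet (g.coordMetric e) (e p) ≠ 0 := by
    rw [Ne, ← g.mem_singularSet_iff he hz, e.left_inv hps]
    exact hp
  have h2 := hG.eventually_metricDet_ne_zero hz h1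
  filter_upwards [(e.continuousAt hps).eventually h2, e.open_source.mem_nhds hps] with x hx hxs
  rw [mem_compl_iff, ← e.left_inv hxs, g.mem_singularSet_iff he (e.map_source hxs)]
  exact hx

/-- The dual connection in coordinates. -/
theorem dual_eq (hz : z ∈ e.target) {A B C : VField m M} (hA : SmoothFieldNear A (e.symm z))
    (hB : SmoothFieldNear B (e.symm z)) (hC : SmoothFieldNear C (e.symm z)) :
    g.dual A B C (e.symm z) =
      g.coordMetric e z (fderiv ℝ (coordField e B) z (coordField e A z)) (coordField e C z)
        + christoffel (g.coordMetric e) z (coordField e A z) (coordField e B z)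
          (coordField e C z) := by
  have hG := g.isSmoothMetric_coordMetric he
  have hd : ∀ {A B C : VField m M}, SmoothFieldNear A (e.symm z) → SmoothFieldNear B (e.symm z) →
      mvfderiv (𝓡 m) (fun y => g.form y (A y) (B y)) (e.symm z) (C (e.symm z)) =
        fderiv ℝ (fun y => g.coordMetric e y (coordField e A y) (coordField e B y)) z
          (coordField e C z) := by
    rintro A B C ⟨W₁, hW₁, hz₁, hA⟩ ⟨W₂, hW₂, hz₂, hB⟩
    have h1 := g.contMDiffOn_form (hA.mono (inter_subset_left : W₁ ∩ W₂ ⊆ W₁))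
      (hB.mono inter_subset_right)
    rw [fderiv_comp_symm he hz ((h1.contMDiffAt ((hW₁.inter hW₂).mem_nhds
      ⟨hz₁, hz₂⟩)).mdifferentiableAt (by simp))]
    congr 1
    refine Filter.EventuallyEq.fderiv_eq ?_
    filter_upwards [e.open_target.mem_nhds hz] with y hy
    exact (g.coordMetric_pull he hy _ _).symm
  have hb : ∀ {A B C : VField m M}, SmoothFieldNear A (e.symm z) → SmoothFieldNear B (e.symm z) →
      g.form (e.symm z) (VectorField.mlieBracket (𝓡 m) A B (e.symm z)) (C (e.symm z)) =
        g.coordMetric e z (VectorField.lieBracket ℝ (coordField e A) (coordField e B) z)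
          (coordField e C z) := by
    rintro A B C ⟨W₁, hW₁, hz₁, hA⟩ ⟨W₂, hW₂, hz₂, hB⟩
    rw [← coordField_mlieBracket he (hW₁.inter hW₂) (hA.mono inter_subset_left)
      (hB.mono inter_subset_right) hz ⟨hz₁, hz₂⟩]
    exact (g.coordMetric_pull he hz _ _).symm
  rw [← hG.koszul hz (hA.differentiableAt he hz) (hB.differentiableAt he hz)
    (hC.differentiableAt he hz), dual, hd hB hC, hd hC hA, hd hA hB, hb hA hB, hb hB hC, hb hC hA]

/-- The Levi-Civita derivative in coordinates. -/
theorem coordField_nabla (hz : z ∈ e.target) (hδ : metricDet (g.coordMetric e) z ≠ 0)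
    {A B : VField m M} (hA : SmoothFieldNear A (e.symm z)) (hB : SmoothFieldNear B (e.symm z)) :
    coordField e (g.nabla A B) z =
      covDeriv (g.coordMetric e) (coordField e A) (coordField e B) z := by
  have hG := g.isSmoothMetric_coordMetric he
  -- `nabla` is an arbitrary choice among the vectors satisfying the Koszul identity. The coordinate
  -- formula supplies one such vector, and nondegeneracy, tested on constant coordinate fields,
  -- makes it the only one.
  have hex : ∃ v : TangentSpace (𝓡 m) (e.symm z), ∀ C : VField m M,
      SmoothFieldNear C (e.symm z) → g.form (e.symm z) v (C (e.symm z)) =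
        g.dual A B C (e.symm z) := by
    refine ⟨push e z (covDeriv (g.coordMetric e) (coordField e A) (coordField e B) z),
      fun C hC => ?_⟩
    rw [g.dual_eq he hz hA hB hC, ← IsSmoothMetric.metric_covDeriv hδ, coordMetric_apply]
    congr 1
    exact (push_pull he hz _).symm
  have hspec := Classical.epsilon_spec hex
  change ∀ C : VField m M, SmoothFieldNear C (e.symm z) →
    g.form (e.symm z) (g.nabla A B (e.symm z)) (C (e.symm z)) = g.dual A B C (e.symm z) at hspec
  by_contra hne
  refine hδ ((metricDet_eq_zero_iff (hG.symm z hz)).2 ⟨_, sub_ne_zero.2 hne, fun w => ?_⟩)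
  have h1 := hspec (ofCoord e fun _ => w)
    ((smoothFieldOn_ofCoord he isOpen_univ contDiffOn_const).near
      (e.isOpen_inter_preimage isOpen_univ) ⟨e.map_target hz, mem_univ _⟩)
  rw [g.dual_eq he hz hA hB ((smoothFieldOn_ofCoord he isOpen_univ contDiffOn_const).near
      (e.isOpen_inter_preimage isOpen_univ) ⟨e.map_target hz, mem_univ _⟩),
    ← IsSmoothMetric.metric_covDeriv hδ, coordField_ofCoord he hz, ofCoord_symm_apply he hz] at h1
  rw [map_sub, sub_apply, ← h1, coordMetric_apply, coordField, push_pull he hz, sub_self]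

theorem coordField_nabla_eqOn {A B : VField m M} {W : Set M} (hW : IsOpen W)
    (hA : SmoothFieldOn A W) (hB : SmoothFieldOn B W) :
    EqOn (coordField e (g.nabla A B)) (covDeriv (g.coordMetric e) (coordField e A) (coordField e B))
      (e.target ∩ e.symm ⁻¹' (W \ g.singularSet)) := fun _ hz =>
  g.coordField_nabla he hz.1 (fun h => hz.2.2 ((g.mem_singularSet_iff he hz.1).2 h))
    (hA.near hW hz.2.1) (hB.near hW hz.2.1)

theorem contDiffOn_coordField_nabla {A B : VField m M} {W : Set M} (hW : IsOpen W)
    (hA : SmoothFieldOn A W) (hB : SmoothFieldOn B W) :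
    ContDiffOn ℝ ∞ (coordField e (g.nabla A B)) (e.target ∩ e.symm ⁻¹' (W \ g.singularSet)) := by
  have hs : e.target ∩ e.symm ⁻¹' (W \ g.singularSet) ⊆ e.target ∩ e.symm ⁻¹' W :=
    inter_subset_inter_right _ (preimage_mono sdiff_subset)
  refine ((g.isSmoothMetric_coordMetric he).contDiffOn_covDeriv inter_subset_left
    (e.isOpen_inter_preimage_symm (hW.sdiff g.isClosed_singularSet))
    (fun _ hz h => hz.2.2 ((g.mem_singularSet_iff he hz.1).2 h))
    ((contDiffOn_coordField he hW hA).mono hs) ((contDiffOn_coordField he hW hB).mono hs)).congr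
    (g.coordField_nabla_eqOn he hW hA hB)

/-- The covariant curvature in coordinates. -/
theorem metricDet_mul_curv (hz : z ∈ e.target) (hδ : metricDet (g.coordMetric e) z ≠ 0)
    {A B C D : VField m M} {W : Set M} (hW : IsOpen W) (hzW : e.symm z ∈ W)
    (hA : SmoothFieldOn A W) (hB : SmoothFieldOn B W) (hC : SmoothFieldOn C W) :
    metricDet (g.coordMetric e) z * g.curv A B C D (e.symm z) =
      curvNum (g.coordMetric e) z (coordField e A z) (coordField e B z) (coordField e C z)
        (coordField e D z) := by
  have hG := g.isSmoothMetric_coordMetric he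
  have hzS : e.symm z ∉ g.singularSet := fun h => hδ ((g.mem_singularSet_iff he hz).1 h)
  have hW' : IsOpen (W \ g.singularSet) := hW.sdiff g.isClosed_singularSet
  set O := e.target ∩ e.symm ⁻¹' (W \ g.singularSet) with hO
  have hOo : IsOpen O := e.isOpen_inter_preimage_symm hW'
  have hzO : z ∈ O := ⟨hz, hzW, hzS⟩
  have hs : O ⊆ e.target ∩ e.symm ⁻¹' W :=
    inter_subset_inter_right _ (preimage_mono sdiff_subset)
  -- The coordinate formula for an outer derivative requires the inner one to be smooth near the
  -- point, which holds off the singular set.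
  have hnear : ∀ {X Y : VField m M}, SmoothFieldOn X W → SmoothFieldOn Y W →
      SmoothFieldNear (g.nabla X Y) (e.symm z) := fun hX hY =>
    (smoothFieldOn_of_coordField he hOo (g.contDiffOn_coordField_nabla he hW hX hY)).near
      (e.isOpen_inter_preimage hOo) ⟨e.map_target hz, by rwa [mem_preimage, e.right_inv hz]⟩
  have hnn : ∀ {X Y Z : VField m M}, SmoothFieldOn X W → SmoothFieldOn Y W → SmoothFieldOn Z W →
      coordField e (g.nabla X (g.nabla Y Z)) z = covDeriv (g.coordMetric e) (coordField e X)
        (covDeriv (g.coordMetric e) (coordField e Y) (coordField e Z)) z := by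
    intro X Y Z hX hY hZ
    rw [g.coordField_nabla he hz hδ (hX.near hW hzW) (hnear hY hZ)]
    have h1 : coordField e (g.nabla Y Z) =ᶠ[𝓝 z]
        covDeriv (g.coordMetric e) (coordField e Y) (coordField e Z) :=
      (g.coordField_nabla_eqOn he hW hY hZ).eventuallyEq_of_mem (hOo.mem_nhds hzO)
    simp only [covDeriv, h1.fderiv_eq]
    rw [h1.eq_of_nhds]
    rfl
  have hbr : SmoothFieldNear (VectorField.mlieBracket (𝓡 m) A B) (e.symm z) := by
    have h1 : ContDiffOn ℝ ∞ (coordField e (VectorField.mlieBracket (𝓡 m) A B))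
        (e.target ∩ e.symm ⁻¹' W) := by
      have hWo := e.isOpen_inter_preimage_symm hW
      have hA' := contDiffOn_coordField he hW hA
      have hB' := contDiffOn_coordField he hW hB
      refine ContDiffOn.congr (f := VectorField.lieBracket ℝ (coordField e A) (coordField e B))
        ?_ fun y hy => coordField_mlieBracket he hW hA hB hy.1 hy.2
      exact ((hB'.fderiv_of_isOpen (m := ∞) hWo (by simp)).clm_apply hA').sub
        ((hA'.fderiv_of_isOpen (m := ∞) hWo (by simp)).clm_apply hB')
    exact (smoothFieldOn_of_coordField he (e.isOpen_inter_preimage_symm hW) h1).near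
      (e.isOpen_inter_preimage (e.isOpen_inter_preimage_symm hW))
      ⟨e.map_target hz, by rw [mem_preimage, e.right_inv hz]; exact ⟨hz, hzW⟩⟩
  have hlast : coordField e (g.nabla (VectorField.mlieBracket (𝓡 m) A B) C) z =
      covDeriv (g.coordMetric e) (VectorField.lieBracket ℝ (coordField e A) (coordField e B))
        (coordField e C) z := by
    rw [g.coordField_nabla he hz hδ hbr (hC.near hW hzW)]
    simp only [covDeriv, coordField_mlieBracket he hW hA hB hz hzW]
  rw [← hG.metricDet_mul_curvature hz hδ hOo hzO ((contDiffOn_coordField he hW hA).mono hs)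
    ((contDiffOn_coordField he hW hB).mono hs) ((contDiffOn_coordField he hW hC).mono hs),
    ← hnn hA hB hC, ← hnn hB hA hC, ← hlast, curv]
  congr 1
  simp only [coordField]
  rw [← map_sub, ← map_sub, g.coordMetric_pull he hz]

end SymTensor

end Tensor

namespace SymTensor

variable {m : ℕ} {M : Type*} [TopologicalSpace M] [ChartedSpace (EuclideanSpace ℝ (Fin m)) M]
  [IsManifold (𝓡 m) ∞ M] {e : OpenPartialHomeomorph M (Coord m)} {g : SymTensor m M} {z : Coord m}

/-! ### The singular hypersurface in coordinates -/

theorem IsRiemannAt.notMem_singularSet {p : M} (h : g.IsRiemannAt p) : p ∉ g.singularSet := by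
  intro hp
  obtain ⟨v, hv, hv0⟩ := (Submodule.ne_bot_iff _).1 hp
  exact (h v hv0).ne' (hv v)

/-- The tangent space of the singular hypersurface is the kernel of the differential of the
determinant of the metric. -/
theorem mem_tangentSigma_iff (hg : g.IsTransverse) (he : e ∈ IsManifold.maximalAtlas (𝓡 m) ∞ M)
    (hz : z ∈ e.target) (hδ : metricDet (g.coordMetric e) z = 0)
    (v : TangentSpace (𝓡 m) (e.symm z)) :
    v ∈ g.tangentSigma (e.symm z) ↔
      fderiv ℝ (metricDet (g.coordMetric e)) z (pull e z v) = 0 := by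
  have hd := (g.isSmoothMetric_coordMetric he).contDiffOn_metricDet
  have hda : ContDiffAt ℝ ∞ (metricDet (g.coordMetric e)) z :=
    hd.contDiffAt (e.open_target.mem_nhds hz)
  have hone : (1 : ℕ∞ω) ≤ ∞ := one_le_two.trans two_le_infty
  constructor
  · intro h
    -- The determinant of the metric, read on the manifold, is itself one of the test functions
    -- vanishing on Σ. The converse is the Lagrange multiplier lemma.
    have hsm : ContMDiffAt (𝓡 m) 𝓘(ℝ, ℝ) ∞ (fun x => metricDet (g.coordMetric e) (e x))
        (e.symm z) := by
      have h2 := (contMDiffOn_of_mem_maximalAtlas he).contMDiffAt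
        (e.open_source.mem_nhds (e.map_target hz))
      have h1 : ContMDiffAt (𝓡 m) 𝓘(ℝ, ℝ) ∞ (metricDet (g.coordMetric e)) (e (e.symm z)) := by
        rw [e.right_inv hz]
        exact hda.contMDiffAt
      exact h1.comp _ h2
    have h3 := h _ hsm (by
      filter_upwards [e.open_source.mem_nhds (e.map_target hz)] with x hx hxS
      rwa [← e.left_inv hx, g.mem_singularSet_iff he (e.map_source hx)] at hxS)
    rw [fderiv_comp_symm he hz (hsm.mdifferentiableAt (by simp))] at h3
    rw [← h3]
    congr 1
    refine Filter.EventuallyEq.fderiv_eq ?_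
    filter_upwards [e.open_target.mem_nhds hz] with y hy
    rw [e.right_inv hy]
  · intro h f hf h0
    rw [fderiv_comp_symm he hz (hf.mdifferentiableAt (by simp))]
    have h2 := (contMDiffOn_symm_of_mem_maximalAtlas he).contMDiffAt (e.open_target.mem_nhds hz)
    refine fderiv_apply_eq_zero_of_vanishing (d := metricDet (g.coordMetric e))
      ((contMDiffAt_iff_contDiffAt.1 (hf.comp z h2)).of_le hone) (hda.of_le hone) hδ
      (hg.2 e he z hz ((g.mem_singularSet_iff he hz).2 hδ)) ?_ h
    filter_upwards [(e.continuousAt_symm hz).eventually h0, e.open_target.mem_nhds hz]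
      with y hy hyt h1
    exact hy ((g.mem_singularSet_iff he hyt).2 h1)

section

variable (hg : g.IsTransverseRiemannLorentzTangent)
include hg

/-- A negative square would persist nearby, but points where the metric is Riemannian accumulate at
p. -/
theorem form_nonneg {p : M} (hp : p ∈ g.singularSet) (v : TangentSpace (𝓡 m) p) :
    0 ≤ g.form p v v := by
  set e := chartAt (EuclideanSpace ℝ (Fin m)) p with he_def
  have he : e ∈ IsManifold.maximalAtlas (𝓡 m) ∞ M := IsManifold.chart_mem_maximalAtlas p
  have hps : p ∈ e.source := mem_chart_source _ p
  clear_value e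
  obtain ⟨z, hz, rfl⟩ := exists_symm_eq hps
  rw [← g.coordMetric_pull he hz]
  set w := pull e z v
  by_contra! hneg
  have hG := g.isSmoothMetric_coordMetric he
  have h1 : ContinuousAt (fun y => g.coordMetric e y w w) z :=
    ((hG.contDiffOn.clm_apply contDiffOn_const).clm_apply contDiffOn_const).continuousOn.continuousAt
      (e.open_target.mem_nhds hz)
  have h2 := h1.eventually_lt_const hneg
  have h3 : Tendsto e (𝓝 (e.symm z)) (𝓝 z) := by
    simpa [ContinuousAt, e.right_inv hz] using e.continuousAt (e.map_target hz)
  have h4 := (hg.riemannLorentz.2 _ hp).1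
  rw [mem_closure_iff_frequently] at h4
  obtain ⟨x, hx, hx1, hx2⟩ := (h4.and_eventually ((h3.eventually h2).and
    (e.open_source.mem_nhds (e.map_target hz)))).exists
  obtain ⟨y, hy, rfl⟩ := exists_symm_eq hx2
  rw [e.right_inv hy, coordMetric_apply] at hx1
  by_cases h0 : push e y w = 0
  · simp [h0] at hx1
  · exact (hx _ h0).not_gt hx1

/-- Riemannian points accumulate at each singular point and are nonsingular. This makes limits taken
off Σ unique. -/
theorem mem_closure_compl_singularSet (p : M) : p ∈ closure g.singularSetᶜ := by
  by_cases hp : p ∈ g.singularSet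
  · exact closure_mono (fun x hx => IsRiemannAt.notMem_singularSet hx)
      (hg.riemannLorentz.2 p hp).1
  · exact subset_closure hp

theorem isTransverseMetric_coordMetric (he : e ∈ IsManifold.maximalAtlas (𝓡 m) ∞ M) :
    IsTransverseMetric (g.coordMetric e) e.target where
  toIsSmoothMetric := g.isSmoothMetric_coordMetric he
  fderiv_ne_zero z hz hδ := hg.transverse.2 e he z hz ((g.mem_singularSet_iff he hz).2 hδ)
  tangent z hz hδ r hr := by
    have h := hg.tangentRadical _ ((g.mem_singularSet_iff he hz).2 hδ)
      ((g.push_mem_radical_iff he hz r).2 hr)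
    rwa [mem_tangentSigma_iff hg.transverse he hz hδ, pull_push he hz] at h
  nonneg z hz hδ v := form_nonneg hg ((g.mem_singularSet_iff he hz).2 hδ) (push e z v)

end

/-- The term of the dual connection that differentiates the extension is paired with a radical
vector and vanishes, so only the Christoffel symbol remains. -/
theorem IIof_eq (he : e ∈ IsManifold.maximalAtlas (𝓡 m) ∞ M) (hz : z ∈ e.target)
    {s : TangentSpace (𝓡 m) (e.symm z)} (hs : s ∈ g.radical (e.symm z))
    (a b : TangentSpace (𝓡 m) (e.symm z)) :
    g.IIof s a b = christoffel (g.coordMetric e) z (pull e z a) (pull e z b) (pull e z s) := by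
  rw [IIof, g.dual_eq he hz (smoothFieldNear_ext a) (smoothFieldNear_ext b) (smoothFieldNear_ext s)]
  simp only [coordField, ext_self]
  rw [(g.isSmoothMetric_coordMetric he).symm z hz _ (pull e z s), (g.mem_radical_iff he hz s).1 hs,
    zero_add]

/-- Linear forms with nested kernels are proportional. -/
theorem exists_eq_mul_of_ker_le {E : Type*} [AddCommGroup E] [Module ℝ E]
    {α β : E → ℝ} (hα : IsLinearMap ℝ α) (hβ : IsLinearMap ℝ β) {u : E} (hu : β u ≠ 0)
    (h : ∀ v, β v = 0 → α v = 0) : ∃ k, ∀ v, α v = k * β v := by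
  refine ⟨α u / β u, fun v => ?_⟩
  have h1 := h (v - (β v / β u) • u) (by
    rw [hβ.map_sub, hβ.map_smul, smul_eq_mul]
    field_simp
    ring)
  rw [hα.map_sub, hα.map_smul, smul_eq_mul, sub_eq_zero] at h1
  rw [h1]
  ring

section

variable (hg : g.IsTransverseRiemannLorentzTangent) (he : e ∈ IsManifold.maximalAtlas (𝓡 m) ∞ M)
  (hz : z ∈ e.target) (hδ : metricDet (g.coordMetric e) z = 0)
include hg he hz hδ

/-- Radical vectors extend to smooth vector fields which are radical on the singular set. -/
theorem exists_radicalExtension {s : TangentSpace (𝓡 m) (e.symm z)}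
    (hs : s ∈ g.radical (e.symm z)) :
    ∃ Y : VField m M, SmoothFieldNear Y (e.symm z) ∧ Y (e.symm z) = s ∧
      ∀ᶠ q in 𝓝 (e.symm z), q ∈ g.singularSet → Y q ∈ g.radical q := by
  have hG := isTransverseMetric_coordMetric hg he
  obtain ⟨Y, hY, hYz, hYr⟩ : ∃ Y : Coord m → Coord m, ContDiffOn ℝ ∞ Y e.target ∧
      Y z = pull e z s ∧ ∀ y, metricDet (g.coordMetric e) y = 0 →
        ∀ w, g.coordMetric e y (Y y) w = 0 := by
    by_cases h0 : pull e z s = 0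
    · exact ⟨fun _ => 0, contDiffOn_const, h0.symm, by simp⟩
    · exact hG.exists_radicalField hz hδ (hG.fderiv_ne_zero z hz hδ) h0
        ((g.mem_radical_iff he hz s).1 hs)
  refine ⟨ofCoord e Y, (smoothFieldOn_ofCoord he e.open_target hY).near
    (e.isOpen_inter_preimage e.open_target) ⟨e.map_target hz, e.map_source (e.map_target hz)⟩,
    by rw [ofCoord_symm_apply he hz, hYz, push_pull he hz], ?_⟩
  filter_upwards [e.open_source.mem_nhds (e.map_target hz)] with x hx hxS
  obtain ⟨y, hy, rfl⟩ := exists_symm_eq hx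
  rw [ofCoord_symm_apply he hy, g.push_mem_radical_iff he hy]
  exact hYr y ((g.mem_singularSet_iff he hy).1 hxS)

/-- The covector ⟨n, ·⟩ vanishes on the tangent space of Σ, which is the kernel of dδ. -/
theorem normal_eq_mul {n : TangentSpace (𝓡 m) (e.symm z)}
    (hn : ∀ v ∈ g.tangentSigma (e.symm z), g.form (e.symm z) n v = 0) :
    ∃ k, ∀ w, g.coordMetric e z (pull e z n) w =
      k * fderiv ℝ (metricDet (g.coordMetric e)) z w := by
  have hG := isTransverseMetric_coordMetric hg he
  obtain ⟨u, hu⟩ := exists_apply_ne_zero (hG.fderiv_ne_zero z hz hδ)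
  refine exists_eq_mul_of_ker_le ⟨map_add _, map_smul _⟩ ⟨map_add _, map_smul _⟩ hu fun v hv => ?_
  rw [← pull_push he hz v, g.coordMetric_pull he hz]
  refine hn _ ?_
  rwa [mem_tangentSigma_iff hg.transverse he hz hδ, pull_push he hz]

/-- The second fundamental form on radical vectors. -/
theorem Hof_radical {n x s : TangentSpace (𝓡 m) (e.symm z)}
    (hn : ∀ v ∈ g.tangentSigma (e.symm z), g.form (e.symm z) n v = 0)
    (hx : x ∈ g.tangentSigma (e.symm z)) (hs : s ∈ g.radical (e.symm z)) :
    g.Hof n x s = -g.IIof s x n := by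
  have hG := isTransverseMetric_coordMetric hg he
  obtain ⟨Y₀, hY₀, hY₀s, hY₀r⟩ := exists_radicalExtension hg he hz hδ hs
  -- `tangentExt` is an arbitrary tangent extension. A radical extension shows that one exists,
  -- because the radical is tangent, and `tangentField_radical` is valid for whichever was chosen.
  have hspec : g.IsTangentExtension (e.symm z) s (g.tangentExt (e.symm z) s) :=
    Classical.epsilon_spec (p := g.IsTangentExtension (e.symm z) s) ⟨Y₀, hY₀, hY₀s,
      hY₀r.mono fun q hq hqS => hg.tangentRadical q hqS (hq hqS)⟩
  obtain ⟨hYs, hYz, hYt⟩ := hspec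
  obtain ⟨k, hk⟩ := normal_eq_mul hg he hz hδ hn
  obtain ⟨U, -, hU, hzU, hYU⟩ := hYs.exists_contDiffOn he hz
  have hcz : coordField e (g.tangentExt (e.symm z) s) z = pull e z s := by rw [coordField, hYz]
  rw [IIof_eq he hz hs, Hof, g.dual_eq he hz (smoothFieldNear_ext x) hYs (smoothFieldNear_ext n)]
  rw [← hcz]
  simp only [coordField, ext_self]
  refine hG.tangentField_radical hz hδ (hG.fderiv_ne_zero z hz hδ) hU hzU hYU ?_ hG.tangent ?_
    ((mem_tangentSigma_iff hg.transverse he hz hδ x).1 hx) hk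
  · rw [hcz]
    exact (g.mem_radical_iff he hz s).1 hs
  · filter_upwards [(e.continuousAt_symm hz).eventually hYt, e.open_target.mem_nhds hz]
      with y hy hyt hy0
    exact (mem_tangentSigma_iff hg.transverse he hyt hy0 _).1
      (hy ((g.mem_singularSet_iff he hyt).2 hy0))

/-- The fields of `exists_frame` only have to be rescaled at the point, since the metric is positive
on the normal n and Γ(Y,n,Y) ≠ 0 there. -/
theorem exists_isMainPair_symm :
    ∃ q : TangentSpace (𝓡 m) (e.symm z) × TangentSpace (𝓡 m) (e.symm z),
      g.IsMainPair (e.symm z) q.1 q.2 := by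
  have hG := isTransverseMetric_coordMetric hg he
  have hdδ := hG.fderiv_ne_zero z hz hδ
  obtain ⟨V, -, -, hzV, n, Y, -, -, hne, hsing⟩ := hG.exists_frame hz hδ
  obtain ⟨hY0, hYr, ⟨k, hk, hn⟩, hnn⟩ := hsing z hzV hδ
  obtain ⟨hdn, hΓ⟩ := hne z hzV
  set Γ := christoffel (g.coordMetric e) z
  have hpos : 0 < g.coordMetric e z (n z) (n z) :=
    lt_of_le_of_ne (hG.nonneg z hz hδ _) (by rw [hn]; exact (mul_ne_zero hk hdn).symm)
  -- The absolute value of c normalises n. Its sign must make c Γ(Y,n,Y) positive: rescaling Y by t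
  -- multiplies −H(Y,Y) by t², so only a positive value can be brought to 1.
  obtain ⟨c, hc1, hc2⟩ : ∃ c : ℝ, c * c * g.coordMetric e z (n z) (n z) = 1 ∧
      0 < c * Γ (Y z) (n z) (Y z) := by
    set q := g.coordMetric e z (n z) (n z)
    have hq : (√q)⁻¹ * (√q)⁻¹ * q = 1 := by
      have := Real.mul_self_sqrt hpos.le
      have h0 : √q ≠ 0 := (Real.sqrt_pos.2 hpos).ne'
      field_simp
      linarith
    have hq' : 0 < (√q)⁻¹ := inv_pos.2 (Real.sqrt_pos.2 hpos)
    rcases lt_or_gt_of_ne hΓ with h | h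
    · exact ⟨-(√q)⁻¹, by linarith, by nlinarith⟩
    · exact ⟨(√q)⁻¹, hq, by positivity⟩
  set b := c * Γ (Y z) (n z) (Y z)
  obtain ⟨t, ht⟩ : ∃ t : ℝ, t * t * b = 1 := by
    refine ⟨(√b)⁻¹, ?_⟩
    have := Real.mul_self_sqrt hc2.le
    have h0 : √b ≠ 0 := (Real.sqrt_pos.2 hc2).ne'
    field_simp
    linarith
  have hnorm : ∀ v ∈ g.tangentSigma (e.symm z),
      g.form (e.symm z) (push e z (c • n z)) v = 0 := by
    intro v hv
    rw [← g.coordMetric_pull he hz, pull_push he hz, map_smul, smul_apply, hn,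
      (mem_tangentSigma_iff hg.transverse he hz hδ v).1 hv, mul_zero, smul_zero]
  have hrad : push e z (t • Y z) ∈ g.radical (e.symm z) := by
    rw [g.push_mem_radical_iff he hz]
    intro w
    rw [map_smul, smul_apply, hYr, smul_zero]
  refine ⟨(push e z (c • n z), push e z (t • Y z)), hnorm, fun s hs => ?_, ?_, hrad, ?_⟩
  · obtain ⟨d, hd⟩ := hG.radical_eq_smul hz hδ hdδ hY0 hYr ((g.mem_radical_iff he hz s).1 hs)
    rw [IIof_eq he hz hs, hd]
    simp only [pull_push he hz, map_smul, smul_apply]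
    change d • c • c • Γ (n z) (n z) (Y z) = 0
    rw [hnn, smul_zero, smul_zero, smul_zero]
  · rw [← g.coordMetric_pull he hz]
    simp only [pull_push he hz, map_smul, smul_apply, smul_eq_mul]
    linarith
  · rw [Hof_radical hg he hz hδ hnorm (hg.tangentRadical _ ((g.mem_singularSet_iff he hz).2 hδ) hrad)
      hrad, IIof_eq he hz hrad]
    simp only [pull_push he hz, map_smul, smul_apply, smul_eq_mul]
    change -(t * (c * (t * Γ (Y z) (n z) (Y z)))) = -1
    linarith

end

end SymTensor

namespace SymTensor

variable {m : ℕ} {M : Type*} [TopologicalSpace M] [ChartedSpace (EuclideanSpace ℝ (Fin m)) M]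
  [IsManifold (𝓡 m) ∞ M] {e : OpenPartialHomeomorph M (Coord m)} {g : SymTensor m M} {z : Coord m}

/-! ### The main normal, the main radical vector, the screen and the tensor `Υ` -/

variable (m) in
theorem exists_coord (p : M) : ∃ e ∈ IsManifold.maximalAtlas (𝓡 m) ∞ M, ∃ z ∈ e.target,
    e.symm z = p :=
  ⟨chartAt (EuclideanSpace ℝ (Fin m)) p, IsManifold.chart_mem_maximalAtlas p, _,
    mem_chart_target _ p, (chartAt (EuclideanSpace ℝ (Fin m)) p).left_inv (mem_chart_source _ p)⟩

theorem tendsto_chart (he : e ∈ IsManifold.maximalAtlas (𝓡 m) ∞ M) (hz : z ∈ e.target) :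
    Tendsto e (𝓝[g.singularSetᶜ] (e.symm z)) (𝓝[{y | metricDet (g.coordMetric e) y ≠ 0}] z) := by
  refine tendsto_nhdsWithin_iff.2 ⟨?_, ?_⟩
  · have h1 := e.continuousAt (e.map_target hz)
    rw [ContinuousAt, e.right_inv hz] at h1
    exact h1.mono_left nhdsWithin_le_nhds
  · filter_upwards [self_mem_nhdsWithin,
      mem_nhdsWithin_of_mem_nhds (e.open_source.mem_nhds (e.map_target hz))] with x hx hxs h0
    refine hx ?_
    rw [← e.left_inv hxs, g.mem_singularSet_iff he (e.map_source hxs)]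
    exact h0

variable (hg : g.IsTransverseRiemannLorentzTangent)
include hg

section

variable {p : M} (hp : p ∈ g.singularSet)
include hp

theorem isMainPair : g.IsMainPair p (g.N p) (g.R p) := by
  obtain ⟨e, he, z, hz, rfl⟩ := exists_coord m p
  exact Classical.epsilon_spec 
    (p := fun q : TangentSpace (𝓡 m) (e.symm z) × TangentSpace (𝓡 m) (e.symm z) =>
      g.IsMainPair (e.symm z) q.1 q.2)
    (exists_isMainPair_symm hg he hz ((g.mem_singularSet_iff he hz).1 hp))

theorem R_mem_radical : g.R p ∈ g.radical p := (isMainPair hg hp).2.2.2.1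

theorem form_N_N : g.form p (g.N p) (g.N p) = 1 := (isMainPair hg hp).2.2.1

theorem II_N_N : g.II (g.N p) (g.N p) = 0 := (isMainPair hg hp).2.1 _ (R_mem_radical hg hp)

/-- This replaces H by the symmetric form II. The normalisations of the main pair then say that N
and R are II-isotropic with II(R,N) = 1. -/
theorem H_R {x : TangentSpace (𝓡 m) p} (hx : x ∈ g.tangentSigma p) :
    g.H x (g.R p) = -g.II x (g.N p) := by
  obtain ⟨e, he, z, hz, rfl⟩ := exists_coord m p
  exact Hof_radical hg he hz ((g.mem_singularSet_iff he hz).1 hp) (isMainPair hg hp).1 hx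
    (R_mem_radical hg hp)

theorem II_R_N : g.II (g.R p) (g.N p) = 1 := by
  have h1 := H_R hg hp (hg.tangentRadical p hp (R_mem_radical hg hp))
  have h2 : g.H (g.R p) (g.R p) = -1 := (isMainPair hg hp).2.2.2.2
  linarith

end

section

variable (he : e ∈ IsManifold.maximalAtlas (𝓡 m) ∞ M) (hz : z ∈ e.target)
  (hp : e.symm z ∈ g.singularSet)
include he hz hp

theorem II_eq (a b : TangentSpace (𝓡 m) (e.symm z)) :
    g.II a b = christoffel (g.coordMetric e) z (pull e z a) (pull e z b)
      (pull e z (g.R (e.symm z))) :=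
  IIof_eq he hz (R_mem_radical hg hp) a b

theorem pull_R_ne_zero : pull e z (g.R (e.symm z)) ≠ 0 := by
  intro h0
  have h1 := II_R_N hg hp
  rw [II_eq hg he hz hp, h0, map_zero] at h1
  simp at h1

theorem exists_metricAdj_R : ∃ c : ℝ, c ≠ 0 ∧
    (∀ α, metricAdj (g.coordMetric e) z α =
      (c * α (pull e z (g.R (e.symm z)))) • pull e z (g.R (e.symm z))) ∧
    ∀ v : TangentSpace (𝓡 m) (e.symm z), g.II v (g.R (e.symm z)) =
      (2 * c)⁻¹ * fderiv ℝ (metricDet (g.coordMetric e)) z (pull e z v) := by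
  have hδ := (g.mem_singularSet_iff he hz).1 hp
  have hG := isTransverseMetric_coordMetric hg he
  have hdδ := hG.fderiv_ne_zero z hz hδ
  obtain ⟨c, hc, hQ, hd⟩ := hG.exists_metricAdj_eq hz hδ hdδ (pull_R_ne_zero hg he hz hp)
    ((g.mem_radical_iff he hz _).1 (R_mem_radical hg hp))
  refine ⟨c, hc, hQ, fun v => ?_⟩
  rw [II_eq hg he hz hp]
  exact hG.christoffel_radical hz hδ hdδ hc hd _

end

section

variable {p : M} (hp : p ∈ g.singularSet)
include hp

theorem II_comm (a b : TangentSpace (𝓡 m) p) : g.II a b = g.II b a := by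
  obtain ⟨e, he, z, hz, rfl⟩ := exists_coord m p
  rw [II_eq hg he hz hp, II_eq hg he hz hp, (g.isSmoothMetric_coordMetric he).christoffel_symm hz]

theorem II_add_left (a a' b : TangentSpace (𝓡 m) p) : g.II (a + a') b = g.II a b + g.II a' b := by
  obtain ⟨e, he, z, hz, rfl⟩ := exists_coord m p
  simp only [II_eq hg he hz hp, map_add, add_apply]

theorem II_smul_left (c : ℝ) (a b : TangentSpace (𝓡 m) p) : g.II (c • a) b = c * g.II a b := by
  obtain ⟨e, he, z, hz, rfl⟩ := exists_coord m p
  simp only [II_eq hg he hz hp, map_smul, smul_apply, smul_eq_mul]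

theorem II_zero_left (b : TangentSpace (𝓡 m) p) : g.II 0 b = 0 := by
  rw [← zero_smul ℝ (0 : TangentSpace (𝓡 m) p), II_smul_left hg hp, zero_mul]

theorem II_add_right (a b b' : TangentSpace (𝓡 m) p) :
    g.II a (b + b') = g.II a b + g.II a b' := by
  rw [II_comm hg hp, II_add_left hg hp, II_comm hg hp b, II_comm hg hp b']

theorem II_smul_right (c : ℝ) (a b : TangentSpace (𝓡 m) p) : g.II a (c • b) = c * g.II a b := by
  rw [II_comm hg hp, II_smul_left hg hp, II_comm hg hp b]

theorem mem_tangentSigma_iff_II {v : TangentSpace (𝓡 m) p} :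
    v ∈ g.tangentSigma p ↔ g.II v (g.R p) = 0 := by
  obtain ⟨e, he, z, hz, rfl⟩ := exists_coord m p
  obtain ⟨c, hc, -, h⟩ := exists_metricAdj_R hg he hz hp
  rw [mem_tangentSigma_iff hg.transverse he hz ((g.mem_singularSet_iff he hz).1 hp), h]
  simp [hc]

theorem II_R_R : g.II (g.R p) (g.R p) = 0 :=
  (mem_tangentSigma_iff_II hg hp).1 (hg.tangentRadical p hp (R_mem_radical hg hp))

theorem exists_eq_smul_R {s : TangentSpace (𝓡 m) p} (hs : s ∈ g.radical p) :
    ∃ c : ℝ, s = c • g.R p := by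
  obtain ⟨e, he, z, hz, rfl⟩ := exists_coord m p
  have hδ := (g.mem_singularSet_iff he hz).1 hp
  have hG := isTransverseMetric_coordMetric hg he
  obtain ⟨c, hc⟩ := hG.radical_eq_smul hz hδ (hG.fderiv_ne_zero z hz hδ)
    (pull_R_ne_zero hg he hz hp) ((g.mem_radical_iff he hz _).1 (R_mem_radical hg hp))
    ((g.mem_radical_iff he hz s).1 hs)
  refine ⟨c, ?_⟩
  rw [← push_pull he hz s, hc, map_smul, push_pull he hz]

/-- Both sides are multiples of dδ, and both take the value 1 on N. -/
theorem nu_eq (a : TangentSpace (𝓡 m) p) : g.nu a = g.II a (g.R p) := by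
  obtain ⟨e, he, z, hz, rfl⟩ := exists_coord m p
  have hδ := (g.mem_singularSet_iff he hz).1 hp
  obtain ⟨k, hk⟩ := normal_eq_mul hg he hz hδ (isMainPair hg hp).1
  obtain ⟨c, hc, -, h⟩ := exists_metricAdj_R hg he hz hp
  have h1 := h (g.N _)
  rw [II_comm hg hp, II_R_N hg hp] at h1
  have h2 := hk (pull e z (g.N _))
  rw [g.coordMetric_pull he hz, form_N_N hg hp] at h2
  have h3 : fderiv ℝ (metricDet (g.coordMetric e)) z (pull e z (g.N (e.symm z))) ≠ 0 := fun h0 => by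
    rw [h0, mul_zero] at h1
    exact one_ne_zero h1
  have h4 : k = (2 * c)⁻¹ := mul_right_cancel₀ h3 (h2.symm.trans h1)
  rw [nu, g.symm, ← g.coordMetric_pull he hz, hk, h, h4]

/-- The vector a − ν(a)N is tangent, so `H_R` applies to it. The subtracted part does not contribute
because II(N,N) = 0. -/
theorem rho_eq (a : TangentSpace (𝓡 m) p) : g.rho a = g.II a (g.N p) := by
  have h1 : a - g.nu a • g.N p = a + (-g.nu a) • g.N p := by rw [neg_smul, sub_eq_add_neg]
  have h2 : a - g.nu a • g.N p ∈ g.tangentSigma p := by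
    rw [mem_tangentSigma_iff_II hg hp, h1, II_add_left hg hp, II_smul_left hg hp,
      II_comm hg hp (g.N p), II_R_N hg hp, nu_eq hg hp]
    ring
  rw [rho, H_R hg hp h2, h1, II_add_left hg hp, II_smul_left hg hp, II_N_N hg hp]
  ring

/-- The set spanning the screen is the common kernel of two linear forms, hence already a subspace.
-/
theorem mem_screen_iff {v : TangentSpace (𝓡 m) p} :
    v ∈ g.screen p ↔ g.II v (g.R p) = 0 ∧ g.II v (g.N p) = 0 := by
  let S : Submodule ℝ (TangentSpace (𝓡 m) p) :=
    { carrier := {v | g.II v (g.R p) = 0 ∧ g.II v (g.N p) = 0}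
      add_mem' := fun ha hb => by
        rw [mem_ofPred_eq, II_add_left hg hp, II_add_left hg hp, ha.1, ha.2, hb.1, hb.2, add_zero]
        exact ⟨rfl, rfl⟩
      zero_mem' := ⟨II_zero_left hg hp _, II_zero_left hg hp _⟩
      smul_mem' := fun c a ha => by
        rw [mem_ofPred_eq, II_smul_left hg hp, II_smul_left hg hp, ha.1, ha.2, mul_zero]
        exact ⟨rfl, rfl⟩ }
  have h : {v | v ∈ g.tangentSigma p ∧ g.H v (g.R p) = 0} = (S : Set (TangentSpace (𝓡 m) p)) := by
    ext v
    constructor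
    · rintro ⟨h1, h2⟩
      rw [H_R hg hp h1, neg_eq_zero] at h2
      exact ⟨(mem_tangentSigma_iff_II hg hp).1 h1, h2⟩
    · rintro ⟨h1, h2⟩
      have h3 := (mem_tangentSigma_iff_II hg hp).2 h1
      exact ⟨h3, by rw [H_R hg hp h3, h2, neg_zero]⟩
  rw [screen, h, Submodule.span_eq]
  rfl

/-- A Gauss-type formula: it is the limit of `tendsto_curvature` applied to the chosen radical
extension on a common neighbourhood. Its right-hand side depends only on the values at p. -/
theorem Upsilon_eq (a b c d : TangentSpace (𝓡 m) p) :
    g.Upsilon a b c d = g.II a c * g.II b d - g.II b c * g.II a d := by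
  have : (𝓝[g.singularSetᶜ] p).NeBot :=
    mem_closure_iff_nhdsWithin_neBot.1 (mem_closure_compl_singularSet hg p)
  have hX (v : TangentSpace (𝓡 m) p) := smoothFieldNear_ext v
  obtain ⟨e, he, z, hz, rfl⟩ := exists_coord m p
  have hδ := (g.mem_singularSet_iff he hz).1 hp
  have hG := isTransverseMetric_coordMetric hg he
  obtain ⟨hYs, hYz, hYr⟩ : g.IsRadicalExtension (e.symm z) (g.radicalExt (e.symm z)) :=
    Classical.epsilon_spec (p := g.IsRadicalExtension (e.symm z))
      (exists_radicalExtension hg he hz hδ (R_mem_radical hg hp))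
  obtain ⟨W₁, hW₁, hzW₁, ha⟩ := hX a
  obtain ⟨W₂, hW₂, hzW₂, hb⟩ := hX b
  obtain ⟨W₃, hW₃, hzW₃, hc⟩ := hX c
  obtain ⟨W₄, hW₄, hzW₄, hd⟩ := hX d
  obtain ⟨W₅, hW₅, hzW₅, hY⟩ := hYs
  obtain ⟨W₆, hWr, hW₆, hzW₆⟩ := eventually_nhds_iff.1 hYr
  obtain ⟨W, hWo, hzW, hs₁, hs₂, hs₃, hs₄, hs₅, hs₆⟩ : ∃ W : Set M, IsOpen W ∧ e.symm z ∈ W ∧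
      W ⊆ W₁ ∧ W ⊆ W₂ ∧ W ⊆ W₃ ∧ W ⊆ W₄ ∧ W ⊆ W₅ ∧ W ⊆ W₆ := by
    refine ⟨W₁ ∩ W₂ ∩ W₃ ∩ W₄ ∩ W₅ ∩ W₆, by
      exact ((((hW₁.inter hW₂).inter hW₃).inter hW₄).inter hW₅).inter hW₆,
      ⟨⟨⟨⟨⟨hzW₁, hzW₂⟩, hzW₃⟩, hzW₄⟩, hzW₅⟩, hzW₆⟩, ?_, ?_, ?_, ?_, ?_, ?_⟩ <;>
    rintro x ⟨⟨⟨⟨⟨h1, h2⟩, h3⟩, h4⟩, h5⟩, h6⟩ <;> assumption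
  have hV := e.isOpen_inter_preimage_symm hWo
  have hf {A : VField m M} {W' : Set M} (h : SmoothFieldOn A W') (hs : W ⊆ W') :=
    contDiffOn_coordField he hWo (h.mono hs)
  have hcY : coordField e (g.radicalExt (e.symm z)) z = pull e z (g.R (e.symm z)) := by
    rw [coordField, hYz]
  have hlim := hG.tendsto_curvature hz hδ (hG.fderiv_ne_zero z hz hδ) hV ⟨hz, hzW⟩ (hf hY hs₅)
    (hf ha hs₁) (hf hb hs₂) (hf hc hs₃) (hf hd hs₄) (by
      rw [hcY]
      exact pull_R_ne_zero hg he hz hp) (fun y hy hy0 => by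
      have h1 := hWr _ (hs₆ hy.2) ((g.mem_singularSet_iff he hy.1).2 hy0)
      exact (g.mem_radical_iff he hy.1 _).1 h1)
  rw [hcY] at hlim
  simp only [coordField, ext_self] at hlim
  simp only [← II_eq hg he hz hp] at hlim
  refine ((hlim.comp (tendsto_chart he hz)).congr' ?_).limUnder_eq
  filter_upwards [self_mem_nhdsWithin, mem_nhdsWithin_of_mem_nhds
    (e.open_source.mem_nhds (e.map_target hz)), mem_nhdsWithin_of_mem_nhds (hWo.mem_nhds hzW)]
    with x hx hxs hxW
  obtain ⟨y, hy, rfl⟩ := exists_symm_eq hxs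
  have hy0 : metricDet (g.coordMetric e) y ≠ 0 := fun h => hx ((g.mem_singularSet_iff he hy).2 h)
  have h1 := g.metricDet_mul_curv he hy hy0 hWo hxW (ha.mono hs₁) (hb.mono hs₂) (hc.mono hs₃)
    (D := SymTensor.ext d)
  have h3 (F : Coord m → ℝ) : (F ∘ e) (e.symm y) = F y := congrArg F (e.right_inv hy)
  refine (h3 _).trans ?_
  have h2 := g.coordMetric_pull he hy (g.radicalExt (e.symm z) (e.symm y))
    (g.radicalExt (e.symm z) (e.symm y))
  rw [← h2]
  congr 1
  rw [div_eq_iff hy0, mul_comm _ (metricDet _ _)]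
  exact h1.symm

end

/-- The curvature numerator at singular points. -/
theorem exists_curvNum_eq (he : e ∈ IsManifold.maximalAtlas (𝓡 m) ∞ M) (hz : z ∈ e.target)
    (hp : e.symm z ∈ g.singularSet) : ∃ c : ℝ, c ≠ 0 ∧
      ∀ a₁ a₂ a₃ a₄ : TangentSpace (𝓡 m) (e.symm z),
        curvNum (g.coordMetric e) z (pull e z a₁) (pull e z a₂) (pull e z a₃) (pull e z a₄) =
          c * g.Upsilon a₁ a₂ a₃ a₄ := by
  have hδ := (g.mem_singularSet_iff he hz).1 hp
  have hG := isTransverseMetric_coordMetric hg he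
  obtain ⟨c, hc, hQ, -⟩ := exists_metricAdj_R hg he hz hp
  refine ⟨c, hc, fun a₁ a₂ a₃ a₄ => ?_⟩
  rw [hG.curvNum_singular hz hδ (hG.fderiv_ne_zero z hz hδ) hQ, Upsilon_eq hg hp]
  simp only [II_eq hg he hz hp]

end SymTensor

namespace SymTensor

variable {m : ℕ} {M : Type*} [TopologicalSpace M] [ChartedSpace (EuclideanSpace ℝ (Fin m)) M]
  [IsManifold (𝓡 m) ∞ M] {g : SymTensor m M}

/-! ### Planes at singular points -/

theorem gram_det {p : M} (a b : TangentSpace (𝓡 m) p) :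
    (g.gram a b).det = g.form p a a * g.form p b b - g.form p a b * g.form p b a := by
  rw [gram, Matrix.det_fin_two_of]

theorem rank_eq_two_iff (A : Matrix (Fin 2) (Fin 2) ℝ) : A.rank = 2 ↔ A.det ≠ 0 := by
  constructor
  · intro h h0
    obtain ⟨v, hv, hv0⟩ := Matrix.exists_mulVec_eq_zero_iff.2 h0
    have h1 := LinearMap.finrank_range_add_finrank_ker A.mulVecLin
    rw [← Matrix.rank, h, Module.finrank_fin_fun] at h1
    have h2 : LinearMap.ker A.mulVecLin = ⊥ := Submodule.finrank_eq_zero.1 (by omega)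
    refine hv ((Submodule.mem_bot ℝ).1 ?_)
    rw [← h2]
    exact hv0
  · intro h
    rw [Matrix.rank_of_isUnit A ((Matrix.isUnit_iff_isUnit_det A).2 h.isUnit), Fintype.card_fin]

theorem eq_zero_of_gram {p : M} {a b : TangentSpace (𝓡 m) p} (h : (g.gram a b).det ≠ 0) {x y : ℝ}
    (hxy : x • a + y • b = 0) : x = 0 ∧ y = 0 := by
  rw [gram_det] at h
  have h1 : g.form p (x • a + y • b) a = 0 := by rw [hxy, map_zero]; rfl
  have h2 : g.form p (x • a + y • b) b = 0 := by rw [hxy, map_zero]; rfl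
  simp only [map_add, map_smul, add_apply, smul_apply, smul_eq_mul] at h1 h2
  constructor
  · refine (mul_eq_zero.1 (?_ : x * _ = 0)).resolve_right h
    linear_combination g.form p b b * h1 - g.form p b a * h2
  · refine (mul_eq_zero.1 (?_ : y * _ = 0)).resolve_right h
    linear_combination g.form p a a * h2 - g.form p a b * h1

variable (hg : g.IsTransverseRiemannLorentzTangent) {p : M} (hp : p ∈ g.singularSet)
include hg hp

/-- A pair (x, y) is in the kernel of the matrix exactly when xa + yb lies in the screen, because ν
and ρ cut out the screen. Rank two of the Gram matrix makes a and b independent, so non-zero pairs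
give non-zero vectors. -/
theorem det_eq_zero_iff_screenDim {a b : TangentSpace (𝓡 m) p} (h : (g.gram a b).det ≠ 0) :
    Matrix.det !![g.nu a, g.nu b; g.rho a, g.rho b] = 0 ↔ 1 ≤ g.screenDim a b := by
  have : FiniteDimensional ℝ (TangentSpace (𝓡 m) p) :=
    inferInstanceAs (FiniteDimensional ℝ (EuclideanSpace ℝ (Fin m)))
  have key (x y : ℝ) : Matrix.mulVec !![g.nu a, g.nu b; g.rho a, g.rho b] ![x, y] = 0 ↔
      x • a + y • b ∈ g.screen p := by
    rw [mem_screen_iff hg hp, II_add_left hg hp, II_add_left hg hp, II_smul_left hg hp,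
      II_smul_left hg hp, II_smul_left hg hp, II_smul_left hg hp, nu_eq hg hp, nu_eq hg hp,
      rho_eq hg hp, rho_eq hg hp]
    simp [funext_iff, Fin.forall_fin_two]
  rw [screenDim, Submodule.one_le_finrank_iff, Submodule.ne_bot_iff,
    ← Matrix.exists_mulVec_eq_zero_iff]
  constructor
  · rintro ⟨v, hv, hv0⟩
    have h1 : v = ![v 0, v 1] := by
      ext i
      fin_cases i <;> rfl
    rw [h1, key] at hv0
    refine ⟨v 0 • a + v 1 • b, ⟨Submodule.mem_span_pair.2 ⟨_, _, rfl⟩, hv0⟩, fun h0 => hv ?_⟩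
    obtain ⟨h2, h3⟩ := eq_zero_of_gram h h0
    rw [h1, h2, h3]
    simp
  · rintro ⟨v, ⟨hv, hvS⟩, hv0⟩
    obtain ⟨x, y, rfl⟩ := Submodule.mem_span_pair.1 hv
    refine ⟨![x, y], fun h0 => hv0 ?_, (key x y).2 hvS⟩
    have h1 : x = 0 := congrFun h0 0
    have h2 : y = 0 := congrFun h0 1
    rw [h1, h2, zero_smul, zero_smul, add_zero]

/-- The second fundamental form on the radical of a flat singular hypersurface. -/
theorem II_eq_of_flat (hflat : g.IIFlat) (v w : TangentSpace (𝓡 m) p) :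
    g.II v w = g.nu v * g.rho w + g.rho v * g.nu w := by
  have hNR : g.II (g.N p) (g.R p) = 1 := by rw [II_comm hg hp, II_R_N hg hp]
  -- The tangent space splits into the screen and the II-hyperbolic plane spanned by N and R, with
  -- coordinates ν and ρ on the latter. Flatness removes the screen block of II.
  have hs (v : TangentSpace (𝓡 m) p) :
      ∃ s ∈ g.screen p, v = s + (g.nu v • g.N p + g.rho v • g.R p) := by
    refine ⟨v + ((-g.nu v) • g.N p + (-g.rho v) • g.R p), ?_, ?_⟩
    · rw [mem_screen_iff hg hp]
      simp only [II_add_left hg hp, II_smul_left hg hp, II_R_R hg hp, II_N_N hg hp, II_R_N hg hp,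
        hNR, nu_eq hg hp, rho_eq hg hp]
      constructor <;> ring
    · simp only [neg_smul]
      abel
  obtain ⟨s, hs1, hs2⟩ := hs v
  obtain ⟨t, ht1, ht2⟩ := hs w
  have h1 := (mem_screen_iff hg hp).1 hs1
  have h2 := (mem_screen_iff hg hp).1 ht1
  rw [II_comm hg hp t, II_comm hg hp t] at h2
  have h3 := hflat p hp s hs1 t ht1
  conv_lhs => rw [hs2, ht2]
  simp only [II_add_left hg hp, II_smul_left hg hp, II_add_right hg hp, II_smul_right hg hp,
    II_R_R hg hp, II_N_N hg hp, II_R_N hg hp, hNR, h1.1, h1.2, h2.1, h2.2, h3]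
  ring

/-- With II = ν⊗ρ + ρ⊗ν and Δ the determinant, Υ(c,b,a,b) = Δ (ρ(c)ν(b) − ν(c)ρ(b)), and similarly
for the other contraction. Taking c = N and c = R shows that Δ ≠ 0 would force ν(b) = ρ(b) = 0, and
hence Δ = 0. -/
theorem Upsilon_eq_zero_iff_of_flat (hflat : g.IIFlat) (a b : TangentSpace (𝓡 m) p) :
    (∀ c, g.Upsilon c b a b = 0 ∧ g.Upsilon a c a b = 0) ↔
      Matrix.det !![g.nu a, g.nu b; g.rho a, g.rho b] = 0 := by
  have hNR : g.II (g.N p) (g.R p) = 1 := by rw [II_comm hg hp, II_R_N hg hp]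
  rw [Matrix.det_fin_two_of]
  simp only [Upsilon_eq hg hp, II_eq_of_flat hg hp hflat]
  constructor
  · intro h
    obtain ⟨h1, h2⟩ := h (g.N p)
    obtain ⟨h3, h4⟩ := h (g.R p)
    rw [nu_eq hg hp (g.N p), rho_eq hg hp (g.N p), hNR, II_N_N hg hp] at h1 h2
    rw [nu_eq hg hp (g.R p), rho_eq hg hp (g.R p), II_R_N hg hp, II_R_R hg hp] at h3 h4
    by_contra hne
    have h5 : g.rho b = 0 := by
      refine (mul_eq_zero.1 (?_ : _ * (g.nu a * g.rho b - g.nu b * g.rho a) = 0)).resolve_right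
        hne
      linear_combination -h1
    have h6 : g.nu b = 0 := by
      refine (mul_eq_zero.1 (?_ : _ * (g.nu a * g.rho b - g.nu b * g.rho a) = 0)).resolve_right
        hne
      linear_combination h3
    exact hne (by rw [h5, h6]; ring)
  · intro h c
    constructor
    · linear_combination (g.rho c * g.nu b - g.nu c * g.rho b) * h
    · linear_combination (g.nu c * g.rho a - g.rho c * g.nu a) * h

/-- The canonical form of isotropic vectors normal to the singular hypersurface. -/
theorem eq_smul_N {n : TangentSpace (𝓡 m) p} (hn : ∀ v ∈ g.tangentSigma p, g.form p n v = 0)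
    (hnn : g.II n n = 0) (h0 : g.nu n ≠ 0) : n = g.nu n • g.N p := by
  have hNR : g.II (g.N p) (g.R p) = 1 := by rw [II_comm hg hp, II_R_N hg hp]
  -- The difference n − ν(n)N is orthogonal to TΣ and to N, hence radical, say tR. Isotropy of n
  -- then reads 2 ν(n) t = 0.
  have h1 : n + (-g.nu n) • g.N p ∈ g.radical p := by
    intro v
    have h2 : v + (-g.nu v) • g.N p ∈ g.tangentSigma p := by
      rw [mem_tangentSigma_iff_II hg hp, II_add_left hg hp, II_smul_left hg hp, hNR, nu_eq hg hp]
      ring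
    have h3 := hn _ h2
    have h4 := (isMainPair hg hp).1 _ h2
    have h5 : g.form p n (g.N p) = g.nu n := rfl
    have h6 : g.form p v (g.N p) = g.nu v := rfl
    rw [g.symm] at h6
    simp only [map_add, map_smul, add_apply, smul_apply, smul_eq_mul, form_N_N hg hp, h5, h6]
      at h3 h4 ⊢
    linear_combination h3
  obtain ⟨t, ht⟩ := exists_eq_smul_R hg hp h1
  have h2 : n = g.nu n • g.N p + t • g.R p := by
    rw [← ht, neg_smul]
    abel
  have h3 : t = 0 := by
    rw [h2] at hnn
    simp only [II_add_left hg hp, II_smul_left hg hp, II_add_right hg hp, II_smul_right hg hp,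
      II_R_R hg hp, II_N_N hg hp, II_R_N hg hp, hNR] at hnn
    have h4 : g.nu n * t = 0 := by linarith
    exact (mul_eq_zero.1 h4).resolve_left h0
  rw [h3, zero_smul, add_zero] at h2
  exact h2

/-- The metric is semidefinite at p, so an isotropic screen vector is radical, say tR. Then II(tR,
N) = t must vanish. -/
theorem form_pos_of_mem_screen {v : TangentSpace (𝓡 m) p} (hv : v ∈ g.screen p) (h0 : v ≠ 0) :
    0 < g.form p v v := by
  refine lt_of_le_of_ne (form_nonneg hg hp v) fun h => h0 ?_
  have h1 : v ∈ g.radical p := apply_eq_zero_of_nonneg (b := fun v w => g.form p v w)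
    (by simp) (by simp) (g.symm p) (form_nonneg hg hp) h.symm
  obtain ⟨t, rfl⟩ := exists_eq_smul_R hg hp h1
  have h2 := ((mem_screen_iff hg hp).1 hv).2
  rw [II_smul_left hg hp, II_R_N hg hp, mul_one] at h2
  rw [h2, zero_smul]

theorem screenDim_eq_one {a : TangentSpace (𝓡 m) p} (ha : a ∈ g.screen p) (h0 : a ≠ 0) {c : ℝ}
    (hc : c ≠ 0) : g.screenDim a (c • g.N p) = 1 := by
  have hNR : g.II (g.N p) (g.R p) = 1 := by rw [II_comm hg hp, II_R_N hg hp]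
  have h : Submodule.span ℝ {a, c • g.N p} ⊓ g.screen p = Submodule.span ℝ {a} := by
    ext v
    rw [Submodule.mem_inf, Submodule.mem_span_pair, Submodule.mem_span_singleton]
    constructor
    · rintro ⟨⟨x, y, rfl⟩, h⟩
      have h1 := ((mem_screen_iff hg hp).1 h).1
      simp only [II_add_left hg hp, II_smul_left hg hp, hNR, ((mem_screen_iff hg hp).1 ha).1] at h1
      have h2 : y = 0 := by simpa [hc] using h1
      exact ⟨x, by rw [h2, zero_smul, add_zero]⟩
    · rintro ⟨x, rfl⟩
      exact ⟨⟨x, 0, by rw [zero_smul, add_zero]⟩, (g.screen p).smul_mem x ha⟩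
  rw [screenDim, h, finrank_span_singleton h0]

omit hp in
/-- A singular hypersurface which is not flat contains a screen vector on which the second
fundamental form does not vanish. -/
theorem exists_II_self_ne_zero (hflat : ¬g.IIFlat) :
    ∃ p ∈ g.singularSet, ∃ v ∈ g.screen p, g.II v v ≠ 0 := by
  by_contra! h
  refine hflat fun p hp v hv w hw => ?_
  -- Polarisation: a symmetric form vanishing on the diagonal of a subspace vanishes on that
  -- subspace.
  have h1 := h p hp _ ((g.screen p).add_mem hv hw)
  rw [II_add_left hg hp, II_add_right hg hp, II_add_right hg hp, h p hp v hv, h p hp w hw,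
    II_comm hg hp w v] at h1
  linarith

end SymTensor

namespace SymTensor

variable {m : ℕ} {M : Type*} [TopologicalSpace M] [ChartedSpace (EuclideanSpace ℝ (Fin m)) M]
  [IsManifold (𝓡 m) ∞ M] {e : OpenPartialHomeomorph M (Coord m)} {g : SymTensor m M} {z : Coord m}

/-! ### Good limits of the sectional curvature -/

theorem contMDiffOn_gram_det {A B : VField m M} {W : Set M} (hA : SmoothFieldOn A W)
    (hB : SmoothFieldOn B W) :
    ContMDiffOn (𝓡 m) 𝓘(ℝ, ℝ) ∞ (fun x => (g.gram (A x) (B x)).det) W := by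
  simp only [gram_det]
  exact ((g.contMDiffOn_form hA hA).mul (g.contMDiffOn_form hB hB)).sub
    ((g.contMDiffOn_form hA hB).mul (g.contMDiffOn_form hB hA))

omit [IsManifold (𝓡 m) ∞ M] in
theorem contDiffOn_comp_symm (he : e ∈ IsManifold.maximalAtlas (𝓡 m) ∞ M) {f : M → ℝ} {W : Set M}
    (hf : ContMDiffOn (𝓡 m) 𝓘(ℝ, ℝ) ∞ f W) :
    ContDiffOn ℝ ∞ (fun y => f (e.symm y)) (e.target ∩ e.symm ⁻¹' W) :=
  contMDiffOn_iff_contDiffOn.1 (hf.comp ((contMDiffOn_symm_of_mem_maximalAtlas he).mono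
    inter_subset_left) fun _ hy => hy.2)

omit [IsManifold (𝓡 m) ∞ M] in
theorem contMDiffOn_comp_chart (he : e ∈ IsManifold.maximalAtlas (𝓡 m) ∞ M) {k : Coord m → ℝ}
    {V : Set (Coord m)} (hk : ContDiffOn ℝ ∞ k V) :
    ContMDiffOn (𝓡 m) 𝓘(ℝ, ℝ) ∞ (fun x => k (e x)) (e.source ∩ e ⁻¹' V) :=
  hk.contMDiffOn.comp ((contMDiffOn_of_mem_maximalAtlas he).mono inter_subset_left)
    fun _ hx => hx.2

/-- The sectional curvature in coordinates. -/
theorem sectional_mul (he : e ∈ IsManifold.maximalAtlas (𝓡 m) ∞ M) (hz : z ∈ e.target)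
    (hzS : e.symm z ∉ g.singularSet) {A B : VField m M} {W : Set M} (hW : IsOpen W)
    (hzW : e.symm z ∈ W) (hA : SmoothFieldOn A W) (hB : SmoothFieldOn B W)
    (hAB : (g.gram (A (e.symm z)) (B (e.symm z))).det ≠ 0) :
    metricDet (g.coordMetric e) z * (g.sectional A B (e.symm z) *
      (g.gram (A (e.symm z)) (B (e.symm z))).det) =
      curvNum (g.coordMetric e) z (coordField e A z) (coordField e B z) (coordField e A z)
        (coordField e B z) := by
  rw [sectional, div_mul_cancel₀ _ hAB, g.metricDet_mul_curv he hz
    (fun h => hzS ((g.mem_singularSet_iff he hz).2 h)) hW hzW hA hB hA]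

variable (hg : g.IsTransverseRiemannLorentzTangent)
include hg

/-- Continuous functions which agree off the singular set agree everywhere. -/
theorem eq_of_eq_off_singularSet (he : e ∈ IsManifold.maximalAtlas (𝓡 m) ∞ M) (hz : z ∈ e.target)
    {φ ψ : Coord m → ℝ} (hφ : ContinuousAt φ z) (hψ : ContinuousAt ψ z)
    (h : ∀ᶠ y in 𝓝 z, metricDet (g.coordMetric e) y ≠ 0 → φ y = ψ y) : φ z = ψ z := by
  have : (𝓝[g.singularSetᶜ] (e.symm z)).NeBot :=
    mem_closure_iff_nhdsWithin_neBot.1 (mem_closure_compl_singularSet hg _)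
  have : (𝓝[{y | metricDet (g.coordMetric e) y ≠ 0}] z).NeBot := (tendsto_chart he hz).neBot
  refine tendsto_nhds_unique_of_eventuallyEq
    (l := 𝓝[{y | metricDet (g.coordMetric e) y ≠ 0}] z) (hφ.mono_left nhdsWithin_le_nhds)
    (hψ.mono_left nhdsWithin_le_nhds) ?_
  filter_upwards [self_mem_nhdsWithin, mem_nhdsWithin_of_mem_nhds h] with y hy h1 using h1 hy

/-- Local smooth extensions across the singular set glue. -/
theorem exists_isGoodLimit {W : Set M} {f : M → ℝ}
    (h : ∀ q ∈ W, ∃ V : Set M, IsOpen V ∧ q ∈ V ∧ ∃ k : M → ℝ,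
      ContMDiffOn (𝓡 m) 𝓘(ℝ, ℝ) ∞ k V ∧ ∀ x ∈ V \ g.singularSet, k x = f x) :
    ∃ F : M → ℝ, g.IsGoodLimit W f F := by
  classical
  -- The nonsingular points are dense, so the value on Σ is forced to be the limit from outside.
  -- Hence F agrees with every local extension.
  let F : M → ℝ := fun x =>
    if x ∈ g.singularSet then limUnder (𝓝[g.singularSetᶜ] x) f else f x
  refine ⟨F, fun q hq => ?_, fun x hx => if_neg hx.2⟩
  obtain ⟨V, hV, hqV, k, hk, hkf⟩ := h q hq
  have hF : ∀ x ∈ V, F x = k x := by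
    intro x hx
    by_cases hxS : x ∈ g.singularSet
    · have : (𝓝[g.singularSetᶜ] x).NeBot :=
        mem_closure_iff_nhdsWithin_neBot.1 (mem_closure_compl_singularSet hg x)
      have h1 : Tendsto f (𝓝[g.singularSetᶜ] x) (𝓝 (k x)) := by
        refine ((hk.continuousOn.continuousAt (hV.mem_nhds hx)).mono_left
          nhdsWithin_le_nhds).congr' ?_
        filter_upwards [self_mem_nhdsWithin, mem_nhdsWithin_of_mem_nhds (hV.mem_nhds hx)]
          with y hy hyV using hkf y ⟨hyV, hy⟩
      rw [← h1.limUnder_eq]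
      exact if_pos hxS
    · rw [hkf x ⟨hx, hxS⟩]
      exact if_neg hxS
  refine ((hk.contMDiffAt (hV.mem_nhds hqV)).congr_of_eventuallyEq ?_).contMDiffWithinAt
  filter_upwards [hV.mem_nhds hqV] with x hx using hF x hx

/-- If the curvature numerator of a plane field vanishes on the singular set, then its sectional
curvature extends smoothly across the singular set. -/
theorem exists_isGoodLimit_sectional {W : Set M} (hW : IsOpen W) {A B : VField m M}
    (hA : SmoothFieldOn A W) (hB : SmoothFieldOn B W)
    (hAB : ∀ x ∈ W, (g.gram (A x) (B x)).det ≠ 0)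
    (h : ∀ x ∈ g.singularSet ∩ W, g.Upsilon (A x) (B x) (A x) (B x) = 0) :
    ∃ F : M → ℝ, g.IsGoodLimit W (g.sectional A B) F := by
  refine exists_isGoodLimit hg fun q hq => ?_
  obtain ⟨e, he, z, hz, rfl⟩ := exists_coord m q
  have hG := isTransverseMetric_coordMetric hg he
  set V := e.target ∩ e.symm ⁻¹' W with hVdef
  have hV : IsOpen V := e.isOpen_inter_preimage_symm hW
  have hzV : z ∈ V := ⟨hz, hq⟩
  have ha := contDiffOn_coordField he hW hA
  have hb := contDiffOn_coordField he hW hB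
  have hgr : ContDiffOn ℝ ∞ (fun y => (g.gram (A (e.symm y)) (B (e.symm y))).det) V :=
    contDiffOn_comp_symm he (contMDiffOn_gram_det hA hB)
  have hS := hG.contDiffOn_curvNum inter_subset_left ha hb ha hb
  have hS0 : ∀ y ∈ V, metricDet (g.coordMetric e) y = 0 → curvNum (g.coordMetric e) y
      (coordField e A y) (coordField e B y) (coordField e A y) (coordField e B y) = 0 := by
    intro y hy hy0
    have hyS := (g.mem_singularSet_iff he hy.1).2 hy0
    obtain ⟨c, -, hc⟩ := exists_curvNum_eq hg he hy.1 hyS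
    simp only [coordField, hc]
    rw [h _ ⟨hyS, hy.2⟩, mul_zero]
  -- At a singular point this is Hadamard's lemma; elsewhere it is ordinary division by a non-zero
  -- determinant.
  obtain ⟨V', hV'V, hV', hzV', k, hk, hfac⟩ : ∃ V' ⊆ V, IsOpen V' ∧ z ∈ V' ∧ ∃ k : Coord m → ℝ,
      ContDiffOn ℝ ∞ k V' ∧ ∀ y ∈ V', metricDet (g.coordMetric e) y ≠ 0 →
        curvNum (g.coordMetric e) y (coordField e A y) (coordField e B y) (coordField e A y)
          (coordField e B y) = metricDet (g.coordMetric e) y * k y := by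
    have hd := hG.contDiffOn_metricDet.mono (inter_subset_left : V ⊆ e.target)
    by_cases h0 : metricDet (g.coordMetric e) z = 0
    · obtain ⟨V', hV'V, hV', hzV', k, hk, hfac⟩ := exists_contDiffOn_factor hV hS hd hzV h0
        (hG.fderiv_ne_zero z hz h0) hS0
      exact ⟨V', hV'V, hV', hzV', k, hk, fun y hy _ => hfac y hy⟩
    · obtain ⟨V₁, hV₁, hV₁o, hzV₁⟩ := eventually_nhds_iff.1
        (hG.eventually_metricDet_ne_zero hz h0)
      have hs : V ∩ V₁ ⊆ V := inter_subset_left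
      refine ⟨V ∩ V₁, hs, hV.inter hV₁o, ⟨hzV, hzV₁⟩, _,
        (hS.mono hs).div (hd.mono hs) fun y hy => hV₁ y hy.2, fun y hy hy0 => ?_⟩
      simp only [Pi.div_apply]
      field_simp
  refine ⟨e.source ∩ e ⁻¹' V', e.isOpen_inter_preimage hV',
    ⟨e.map_target hz, by rwa [mem_preimage, e.right_inv hz]⟩, _,
    contMDiffOn_comp_chart he (hk.div (hgr.mono hV'V) fun y hy => hAB _ (hV'V hy).2), ?_⟩
  rintro x ⟨⟨hx, hxV⟩, hxS⟩
  obtain ⟨y, hy, rfl⟩ := exists_symm_eq hx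
  rw [mem_preimage, e.right_inv hy] at hxV
  have hyW : e.symm y ∈ W := (hV'V hxV).2
  have hy0 : metricDet (g.coordMetric e) y ≠ 0 := fun h => hxS ((g.mem_singularSet_iff he hy).2 h)
  have h1 := sectional_mul he hy hxS hW hyW hA hB (hAB _ hyW)
  rw [hfac y hxV hy0] at h1
  have h2 := mul_left_cancel₀ hy0 h1
  simp only [Pi.div_apply, e.right_inv hy]
  rw [← h2, mul_div_cancel_right₀ _ (hAB _ hyW)]

/-- The dependence of the limit of the sectional curvature on the extension of the plane field. -/
theorem isGoodLimit_sub (he : e ∈ IsManifold.maximalAtlas (𝓡 m) ∞ M) (hz : z ∈ e.target)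
    (hp : e.symm z ∈ g.singularSet) {W : Set M} (hW : IsOpen W) (hzW : e.symm z ∈ W)
    {A₁ B₁ A₂ B₂ : VField m M} (hA₁ : SmoothFieldOn A₁ W) (hB₁ : SmoothFieldOn B₁ W)
    (hA₂ : SmoothFieldOn A₂ W) (hB₂ : SmoothFieldOn B₂ W)
    (h₁ : ∀ x ∈ W, (g.gram (A₁ x) (B₁ x)).det ≠ 0) (h₂ : ∀ x ∈ W, (g.gram (A₂ x) (B₂ x)).det ≠ 0)
    {V : Set (Coord m)} (hV : IsOpen V) (hzV : z ∈ V) {X Y : Coord m → Coord m}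
    (hX : ContDiffOn ℝ ∞ X V) (hY : ContDiffOn ℝ ∞ Y V)
    (hAX : ∀ y ∈ V, coordField e A₁ y - coordField e A₂ y = metricDet (g.coordMetric e) y • X y)
    (hBY : ∀ y ∈ V, coordField e B₁ y - coordField e B₂ y = metricDet (g.coordMetric e) y • Y y)
    {F₁ F₂ : M → ℝ} (hF₁ : g.IsGoodLimit W (g.sectional A₁ B₁) F₁)
    (hF₂ : g.IsGoodLimit W (g.sectional A₂ B₂) F₂) :
    ∃ c : ℝ, c ≠ 0 ∧ (F₁ (e.symm z) - F₂ (e.symm z)) *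
      (g.gram (A₁ (e.symm z)) (B₁ (e.symm z))).det =
        c * (g.Upsilon (push e z (X z)) (B₁ (e.symm z)) (A₁ (e.symm z)) (B₁ (e.symm z)) +
          g.Upsilon (A₁ (e.symm z)) (push e z (Y z)) (A₁ (e.symm z)) (B₁ (e.symm z))) := by
  have hδ := (g.mem_singularSet_iff he hz).1 hp
  have hG := isTransverseMetric_coordMetric hg he
  set G := g.coordMetric e
  set O := e.target ∩ e.symm ⁻¹' W ∩ V with hO
  have hOo : IsOpen O := (e.isOpen_inter_preimage_symm hW).inter hV
  have hzO : z ∈ O := ⟨⟨hz, hzW⟩, hzV⟩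
  have hOt : O ⊆ e.target := fun y hy => hy.1.1
  have hf {A : VField m M} (h : SmoothFieldOn A W) : ContDiffOn ℝ ∞ (coordField e A) O :=
    (contDiffOn_coordField he hW h).mono inter_subset_left
  have hr {f : M → ℝ} (h : ContMDiffOn (𝓡 m) 𝓘(ℝ, ℝ) ∞ f W) :
      ContDiffOn ℝ ∞ (fun y => f (e.symm y)) O :=
    (contDiffOn_comp_symm he h).mono inter_subset_left
  have hXO := hX.mono (inter_subset_right : O ⊆ V)
  have hYO := hY.mono (inter_subset_right : O ⊆ V)
  have hcn {a b c d : Coord m → Coord m} (ha : ContDiffOn ℝ ∞ a O) (hb : ContDiffOn ℝ ∞ b O)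
      (hc : ContDiffOn ℝ ∞ c O) (hd : ContDiffOn ℝ ∞ d O) :=
    hG.contDiffOn_curvNum hOt ha hb hc hd
  -- Off Σ the difference of the two numerators telescopes over the four slots, each step
  -- contributing a factor δ. Cancelling δ leaves an identity of continuous functions, which passes
  -- to the singular point.
  have hlim := eq_of_eq_off_singularSet hg he hz
    (((hr hF₁.1).mul (hr (contMDiffOn_gram_det hA₁ hB₁))).sub
      ((hr hF₂.1).mul (hr (contMDiffOn_gram_det hA₂ hB₂)))
      |>.continuousOn.continuousAt (hOo.mem_nhds hzO))
    ((((hcn hXO (hf hB₁) (hf hA₁) (hf hB₁)).add (hcn (hf hA₂) hYO (hf hA₁) (hf hB₁))).add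
      (hcn (hf hA₂) (hf hB₂) hXO (hf hB₁))).add (hcn (hf hA₂) (hf hB₂) (hf hA₂) hYO)
      |>.continuousOn.continuousAt (hOo.mem_nhds hzO)) (by
    filter_upwards [hOo.mem_nhds hzO] with y hy hy0
    have hyS : e.symm y ∉ g.singularSet := fun h => hy0 ((g.mem_singularSet_iff he hy.1.1).1 h)
    have h3 := sectional_mul he hy.1.1 hyS hW hy.1.2 hA₁ hB₁ (h₁ _ hy.1.2)
    have h4 := sectional_mul he hy.1.1 hyS hW hy.1.2 hA₂ hB₂ (h₂ _ hy.1.2)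
    refine mul_left_cancel₀ hy0 ?_
    simp only [hF₁.2 _ ⟨hy.1.2, hyS⟩,
      hF₂.2 _ ⟨hy.1.2, hyS⟩]
    rw [mul_sub, h3, h4, mul_add, mul_add, mul_add, ← curvNum_smul₁, ← curvNum_smul₂,
      ← curvNum_smul₃, ← curvNum_smul₄, ← hAX y hy.2, ← hBY y hy.2, curvNum_sub₁, curvNum_sub₂,
      curvNum_sub₃, curvNum_sub₄]
    ring)
  have hA : A₂ (e.symm z) = A₁ (e.symm z) := by
    have h3 := hAX z hzV
    rw [hδ, zero_smul, coordField, coordField, ← map_sub, pull_eq_zero_iff he hz] at h3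
    exact (sub_eq_zero.1 h3).symm
  have hB : B₂ (e.symm z) = B₁ (e.symm z) := by
    have h3 := hBY z hzV
    rw [hδ, zero_smul, coordField, coordField, ← map_sub, pull_eq_zero_iff he hz] at h3
    exact (sub_eq_zero.1 h3).symm
  obtain ⟨c, hc, hcΥ⟩ := exists_curvNum_eq hg he hz hp
  -- The factor 2 comes from the pair symmetry of Υ: the third and fourth slots repeat the
  -- contributions of the first and second.
  refine ⟨2 * c, mul_ne_zero two_ne_zero hc, ?_⟩
  simp only [coordField, hA, hB] at hlim
  rw [← pull_push he hz (X z), ← pull_push he hz (Y z), hcΥ, hcΥ, hcΥ, hcΥ] at hlim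
  rw [sub_mul, hlim]
  simp only [Upsilon_eq hg hp]
  rw [II_comm hg hp (A₁ (e.symm z)) (push e z (X z)), II_comm hg hp (B₁ (e.symm z)) (push e z (X z)),
    II_comm hg hp (A₁ (e.symm z)) (push e z (Y z)), II_comm hg hp (B₁ (e.symm z)) (push e z (Y z)),
    II_comm hg hp (B₁ (e.symm z)) (A₁ (e.symm z))]
  ring

end SymTensor

namespace SymTensor

variable {m : ℕ} {M : Type*} [TopologicalSpace M] [ChartedSpace (EuclideanSpace ℝ (Fin m)) M]
  [IsManifold (𝓡 m) ∞ M] {e : OpenPartialHomeomorph M (Coord m)} {g : SymTensor m M} {z : Coord m}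

/-! ### Well-defined sectional curvature on the singular set -/

theorem IsExtensionPair.det_ne_zero {W : Set M} {A B A' B' : VField m M}
    (h : g.IsExtensionPair W A B A' B') : ∀ x ∈ W, (g.gram (A' x) (B' x)).det ≠ 0 := fun x hx =>
  (rank_eq_two_iff _).1 (h.2.2.2 x hx)

theorem IsRankTwoPair.det_ne_zero {U : Set M} {A B : VField m M} (h : g.IsRankTwoPair U A B) :
    ∀ x ∈ g.singularSet ∩ U, (g.gram (A x) (B x)).det ≠ 0 := fun x hx =>
  (rank_eq_two_iff _).1 (h.2.2 x hx)

theorem eventually_gram_det_ne_zero {p : M} {W : Set M} (hW : IsOpen W) (hp : p ∈ W)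
    {A B : VField m M} (hA : SmoothFieldOn A W) (hB : SmoothFieldOn B W)
    (h : (g.gram (A p) (B p)).det ≠ 0) : ∀ᶠ x in 𝓝 p, (g.gram (A x) (B x)).det ≠ 0 :=
  ((contMDiffOn_gram_det hA hB).continuousOn.continuousAt (hW.mem_nhds hp)).eventually_ne h

/-- Adding to a vector field a multiple of the determinant of the metric. -/
def perturb (g : SymTensor m M) (e : OpenPartialHomeomorph M (Coord m)) (A : VField m M)
    (X : Coord m) : VField m M :=
  ofCoord e fun y => coordField e A y + metricDet (g.coordMetric e) y • X

theorem smoothFieldOn_perturb (he : e ∈ IsManifold.maximalAtlas (𝓡 m) ∞ M) {W : Set M}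
    (hW : IsOpen W) {A : VField m M} (hA : SmoothFieldOn A W) (X : Coord m) :
    SmoothFieldOn (g.perturb e A X) (e.source ∩ W) := by
  have h1 := e.isOpen_inter_preimage_symm hW
  refine (smoothFieldOn_ofCoord he h1 ((contDiffOn_coordField he hW hA).add
    (((g.isSmoothMetric_coordMetric he).contDiffOn_metricDet.mono inter_subset_left).smul
      contDiffOn_const))).mono ?_
  rintro x ⟨hx, hxW⟩
  exact ⟨hx, e.map_source hx, by rwa [mem_preimage, e.left_inv hx]⟩

theorem perturb_apply (he : e ∈ IsManifold.maximalAtlas (𝓡 m) ∞ M) {x : M} (hx : x ∈ e.source)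
    (hxS : x ∈ g.singularSet) (A : VField m M) (X : Coord m) : g.perturb e A X x = A x := by
  obtain ⟨y, hy, rfl⟩ := exists_symm_eq hx
  rw [perturb, ofCoord_symm_apply he hy, (g.mem_singularSet_iff he hy).1 hxS, zero_smul, add_zero,
    coordField, push_pull he hy]

variable (hg : g.IsTransverseRiemannLorentzTangent)
include hg

/-- Existence of the limit follows from Υ(A,B,A,B) = 0, a case of either contraction condition;
independence of the extension is measured by `isGoodLimit_sub`. In one direction, perturbing a given
extension by δX and δY realises every variation. In the other, Hadamard's lemma shows that any two
extensions differ by such terms. -/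
theorem sectionalWellDefined_iff {U : Set M} {A B : VField m M} (hAB : g.IsRankTwoPair U A B) :
    g.SectionalWellDefined U A B ↔ ∀ p ∈ g.singularSet ∩ U, ∀ c : TangentSpace (𝓡 m) p,
      g.Upsilon c (B p) (A p) (B p) = 0 ∧ g.Upsilon (A p) c (A p) (B p) = 0 := by
  constructor
  · rintro ⟨hex, hun⟩ p ⟨hp, hpU⟩
    obtain ⟨W₁, hW₁, hpW₁, hW₁U, A', hA', hA'A⟩ := hAB.1 p ⟨hp, hpU⟩
    obtain ⟨W₂, hW₂, hpW₂, hW₂U, B', hB', hB'B⟩ := hAB.2.1 p ⟨hp, hpU⟩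
    have hdet := hAB.det_ne_zero p ⟨hp, hpU⟩
    have hpA := hA'A p ⟨hp, hpW₁⟩
    have hpB := hB'B p ⟨hp, hpW₂⟩
    obtain ⟨e, he, z, hz, rfl⟩ := exists_coord m p
    -- The original and the perturbed extensions agree on Σ, so their limits agree. Setting X or Y
    -- to zero afterwards separates the two contractions.
    have key : ∀ X Y : Coord m,
        g.Upsilon (push e z X) (B (e.symm z)) (A (e.symm z)) (B (e.symm z)) +
          g.Upsilon (A (e.symm z)) (push e z Y) (A (e.symm z)) (B (e.symm z)) = 0 := by
      intro X Y
      have hes := e.map_target hz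
      have hO₁ : IsOpen (e.source ∩ W₁) := e.open_source.inter hW₁
      have hO₂ : IsOpen (e.source ∩ W₂) := e.open_source.inter hW₂
      have hA₁ := smoothFieldOn_perturb (g := g) he hW₁ hA' X
      have hB₁ := smoothFieldOn_perturb (g := g) he hW₂ hB' Y
      set A₁ := g.perturb e A' X with hA₁def
      set B₁ := g.perturb e B' Y with hB₁def
      have hs₁ : e.source ∩ W₁ ∩ (e.source ∩ W₂) ⊆ e.source ∩ W₁ := inter_subset_left
      have hs₂ : e.source ∩ W₁ ∩ (e.source ∩ W₂) ⊆ e.source ∩ W₂ := inter_subset_right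
      have hpO : e.symm z ∈ e.source ∩ W₁ ∩ (e.source ∩ W₂) := ⟨⟨hes, hpW₁⟩, hes, hpW₂⟩
      have hev : ∀ᶠ x in 𝓝 (e.symm z), x ∈ e.source ∩ W₁ ∩ (e.source ∩ W₂) ∧
          (g.gram (A' x) (B' x)).det ≠ 0 ∧ (g.gram (A₁ x) (B₁ x)).det ≠ 0 := by
        filter_upwards [(hO₁.inter hO₂).mem_nhds hpO,
          eventually_gram_det_ne_zero (g := g) (hO₁.inter hO₂) hpO
            (hA'.mono (hs₁.trans inter_subset_right)) (hB'.mono (hs₂.trans inter_subset_right))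
            (by rwa [hpA, hpB]),
          eventually_gram_det_ne_zero (g := g) (hO₁.inter hO₂) hpO (hA₁.mono hs₁) (hB₁.mono hs₂)
            (by rwa [hA₁def, hB₁def, perturb_apply he hes hp, perturb_apply he hes hp, hpA, hpB])]
          with x h1 h2 h3 using ⟨h1, h2, h3⟩
      obtain ⟨W, hW, hWo, hpW⟩ := eventually_nhds_iff.1 hev
      have hWs₁ : W ⊆ e.source ∩ W₁ := fun x hx => (hW x hx).1.1
      have hWs₂ : W ⊆ e.source ∩ W₂ := fun x hx => (hW x hx).1.2
      have hWU : W ⊆ U := fun x hx => hW₁U (hWs₁ hx).2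
      have hA'W := hA'.mono (hWs₁.trans inter_subset_right)
      have hB'W := hB'.mono (hWs₂.trans inter_subset_right)
      have hext' : g.IsExtensionPair W A B A' B' := ⟨hA'W, hB'W,
        fun x hx => ⟨hA'A x ⟨hx.1, (hWs₁ hx.2).2⟩, hB'B x ⟨hx.1, (hWs₂ hx.2).2⟩⟩,
        fun x hx => (rank_eq_two_iff _).2 (hW x hx).2.1⟩
      have hext₁ : g.IsExtensionPair W A B A₁ B₁ := by
        refine ⟨hA₁.mono hWs₁, hB₁.mono hWs₂, fun x hx => ?_,
          fun x hx => (rank_eq_two_iff _).2 (hW x hx).2.2⟩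
        rw [hA₁def, hB₁def, perturb_apply he (hWs₁ hx.2).1 hx.1,
          perturb_apply he (hWs₁ hx.2).1 hx.1]
        exact hext'.2.2.1 x hx
      obtain ⟨F', hF'⟩ := hex W hWo hWU A' B' hext'
      obtain ⟨F₁, hF₁⟩ := hex W hWo hWU A₁ B₁ hext₁
      have hFF := hun W hWo hWU A₁ B₁ A' B' hext₁ hext' F₁ F' hF₁ hF' _ ⟨hp, hpW⟩
      obtain ⟨c, hc, h⟩ := isGoodLimit_sub hg he hz hp hWo hpW hext₁.1 hext₁.2.1 hA'W hB'W
        hext₁.det_ne_zero hext'.det_ne_zero e.open_target hz (X := fun _ => X) (Y := fun _ => Y)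
        contDiffOn_const contDiffOn_const
        (fun y hy => by rw [hA₁def, perturb, coordField_ofCoord he hy, add_sub_cancel_left])
        (fun y hy => by rw [hB₁def, perturb, coordField_ofCoord he hy, add_sub_cancel_left])
        hF₁ hF'
      rw [hFF, sub_self, zero_mul, (hext₁.2.2.1 _ ⟨hp, hpW⟩).1,
        (hext₁.2.2.1 _ ⟨hp, hpW⟩).2] at h
      exact (mul_eq_zero.1 h.symm).resolve_left hc
    have h0 : g.Upsilon (push e z 0) (B (e.symm z)) (A (e.symm z)) (B (e.symm z)) = 0 ∧
        g.Upsilon (A (e.symm z)) (push e z 0) (A (e.symm z)) (B (e.symm z)) = 0 := by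
      simp [Upsilon_eq hg hp, II_zero_left hg hp]
    intro c
    constructor
    · have h1 := key (pull e z c) 0
      rwa [h0.2, push_pull he hz, add_zero] at h1
    · have h1 := key 0 (pull e z c)
      rwa [h0.1, push_pull he hz, zero_add] at h1
  · intro h
    refine ⟨fun W hW hWU A' B' hext => ?_, ?_⟩
    · refine exists_isGoodLimit_sectional hg hW hext.1 hext.2.1 hext.det_ne_zero fun x hx => ?_
      rw [(hext.2.2.1 x hx).1, (hext.2.2.1 x hx).2]
      exact (h x ⟨hx.1, hWU hx.2⟩ _).1
    · rintro W hW hWU A₁ B₁ A₂ B₂ h₁ h₂ F₁ F₂ hF₁ hF₂ x ⟨hxS, hxW⟩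
      obtain ⟨e, he, z, hz, rfl⟩ := exists_coord m x
      have hG := isTransverseMetric_coordMetric hg he
      have hδ := (g.mem_singularSet_iff he hz).1 hxS
      have hfac : ∀ {A A' : VField m M}, SmoothFieldOn A W → SmoothFieldOn A' W →
          (∀ x ∈ g.singularSet ∩ W, A x = A' x) → ∃ V : Set (Coord m), IsOpen V ∧ z ∈ V ∧
            ∃ X : Coord m → Coord m, ContDiffOn ℝ ∞ X V ∧ ∀ y ∈ V,
              coordField e A y - coordField e A' y = metricDet (g.coordMetric e) y • X y := by
        intro A A' hA hA' hAA
        obtain ⟨V, -, hV, hzV, X, hX, hXV⟩ := exists_contDiffOn_factor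
          (e.isOpen_inter_preimage_symm hW)
          ((contDiffOn_coordField he hW hA).sub (contDiffOn_coordField he hW hA'))
          (hG.contDiffOn_metricDet.mono inter_subset_left) ⟨hz, hxW⟩ hδ (hG.fderiv_ne_zero z hz hδ)
          (fun y hy hy0 => by
            have h1 := hAA (e.symm y) ⟨(g.mem_singularSet_iff he hy.1).2 hy0, hy.2⟩
            simp only [coordField, h1, sub_self])
        exact ⟨V, hV, hzV, X, hX, hXV⟩
      obtain ⟨V₁, hV₁, hzV₁, X, hX, hXV⟩ := hfac h₁.1 h₂.1 fun x hx => by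
        rw [(h₁.2.2.1 x hx).1, (h₂.2.2.1 x hx).1]
      obtain ⟨V₂, hV₂, hzV₂, Y, hY, hYV⟩ := hfac h₁.2.1 h₂.2.1 fun x hx => by
        rw [(h₁.2.2.1 x hx).2, (h₂.2.2.1 x hx).2]
      obtain ⟨c, -, hc⟩ := isGoodLimit_sub hg he hz hxS hW hxW h₁.1 h₁.2.1 h₂.1 h₂.2.1
        h₁.det_ne_zero h₂.det_ne_zero (hV₁.inter hV₂) ⟨hzV₁, hzV₂⟩ (hX.mono inter_subset_left)
        (hY.mono inter_subset_right) (fun y hy => hXV y hy.1) (fun y hy => hYV y hy.2) hF₁ hF₂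
      rw [(h₁.2.2.1 _ ⟨hxS, hxW⟩).1, (h₁.2.2.1 _ ⟨hxS, hxW⟩).2, (h _ ⟨hxS, hWU hxW⟩ _).1,
        (h _ ⟨hxS, hWU hxW⟩ _).2, add_zero, mul_zero] at hc
      have h3 := h₁.det_ne_zero _ hxW
      rw [(h₁.2.2.1 _ ⟨hxS, hxW⟩).1, (h₁.2.2.1 _ ⟨hxS, hxW⟩).2] at h3
      exact sub_eq_zero.1 ((mul_eq_zero.1 hc).resolve_right h3)

/-- A screen vector extends to a smooth field which at singular points lies in the screen, and which
together with a smooth extension of a multiple of the main normal is of rank two. -/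
theorem exists_isRankTwoPair_of_mem_screen {p : M} (hp : p ∈ g.singularSet)
    {v : TangentSpace (𝓡 m) p} (hv : v ∈ g.screen p) (hv0 : v ≠ 0) :
    ∃ U : Set M, IsOpen U ∧ p ∈ U ∧ ∃ A B : VField m M, g.IsRankTwoPair U A B ∧ A p = v ∧
      ∀ q ∈ g.singularSet ∩ U, A q ∈ g.screen q ∧ ∃ c : ℝ, c ≠ 0 ∧ B q = c • g.N q := by
  obtain ⟨e, he, z, hz, rfl⟩ := exists_coord m p
  have hG := isTransverseMetric_coordMetric hg he
  have hδ := (g.mem_singularSet_iff he hz).1 hp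
  obtain ⟨V, hVt, hV, hzV, n, Y, hn, hY, hne, hsing⟩ := hG.exists_frame hz hδ
  -- At a singular point the frame field n is normal and II-isotropic with ν(n) ≠ 0, so `eq_smul_N`
  -- identifies it as a multiple of the main normal. The multiple is allowed to vary, which avoids
  -- proving smoothness of N itself.
  have hB : ∀ y ∈ V, metricDet (g.coordMetric e) y = 0 →
      ∃ c : ℝ, c ≠ 0 ∧ push e y (n y) = c • g.N (e.symm y) := by
    intro y hy hy0
    have hyt := hVt hy
    have hyS := (g.mem_singularSet_iff he hyt).2 hy0
    obtain ⟨hY0, hYr, ⟨k, hk, hnk⟩, hnn⟩ := hsing y hy hy0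
    obtain ⟨t, ht⟩ := hG.radical_eq_smul hyt hy0 (hG.fderiv_ne_zero y hyt hy0) hY0 hYr
      ((g.mem_radical_iff he hyt _).1 (R_mem_radical hg hyS))
    have hν : g.nu (push e y (n y)) ≠ 0 := by
      obtain ⟨c, hc, -, h⟩ := exists_metricAdj_R hg he hyt hyS
      rw [nu_eq hg hyS, h, pull_push he hyt]
      exact mul_ne_zero (inv_ne_zero (mul_ne_zero two_ne_zero hc)) (hne y hy).1
    refine ⟨_, hν, eq_smul_N hg hyS (fun w hw => ?_) ?_ hν⟩
    · rw [← g.coordMetric_pull he hyt, pull_push he hyt, hnk,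
        (mem_tangentSigma_iff hg.transverse he hyt hy0 w).1 hw, mul_zero]
    · rw [II_eq hg he hyt hyS, pull_push he hyt, ht, map_smul, hnn, smul_zero]
  -- The frame (n, Y) and the pair (N, R) are proportional with non-zero factors, so they cut out
  -- the same screen.
  have hscr : ∀ y ∈ V, metricDet (g.coordMetric e) y = 0 → ∀ w : TangentSpace (𝓡 m) (e.symm y),
      w ∈ g.screen (e.symm y) ↔ fderiv ℝ (metricDet (g.coordMetric e)) y (pull e y w) = 0 ∧
        christoffel (g.coordMetric e) y (pull e y w) (n y) (Y y) = 0 := by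
    intro y hy hy0 w
    have hyt := hVt hy
    have hyS := (g.mem_singularSet_iff he hyt).2 hy0
    obtain ⟨hY0, hYr, -, -⟩ := hsing y hy hy0
    obtain ⟨t, ht⟩ := hG.radical_eq_smul hyt hy0 (hG.fderiv_ne_zero y hyt hy0) hY0 hYr
      ((g.mem_radical_iff he hyt _).1 (R_mem_radical hg hyS))
    have ht0 : t ≠ 0 := by
      rintro rfl
      exact pull_R_ne_zero hg he hyt hyS (by rw [ht, zero_smul])
    obtain ⟨c, hc, hcn⟩ := hB y hy hy0
    have h1 : c * g.II w (g.N (e.symm y)) =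
        t * christoffel (g.coordMetric e) y (pull e y w) (n y) (Y y) := by
      rw [← II_smul_right hg hyS, ← hcn, II_eq hg he hyt hyS, pull_push he hyt, ht, map_smul,
        smul_eq_mul]
    rw [mem_screen_iff hg hyS, ← mem_tangentSigma_iff_II hg hyS,
      mem_tangentSigma_iff hg.transverse he hyt hy0]
    refine and_congr_right fun _ => ?_
    rw [← or_iff_right (a := c = 0) (b := g.II w (g.N (e.symm y)) = 0) hc, ← mul_eq_zero, h1,
      mul_eq_zero, or_iff_right ht0]
  obtain ⟨hv1, hv2⟩ := (hscr z hzV hδ v).1 hv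
  obtain ⟨A, hA, hAz, hAs⟩ := hG.exists_screenField hVt hn hY hne
    (fun y hy hy0 => (hsing y hy hy0).2.1) hv1 hv2
  have hO := e.isOpen_inter_preimage hV
  have hpO : e.symm z ∈ e.source ∩ e ⁻¹' V :=
    ⟨e.map_target hz, by rwa [mem_preimage, e.right_inv hz]⟩
  have hA' := smoothFieldOn_ofCoord he hV hA
  have hn' := smoothFieldOn_ofCoord he hV hn
  have hAp : ofCoord e A (e.symm z) = v := by
    rw [ofCoord_symm_apply he hz, hAz, push_pull he hz]
  obtain ⟨c, hc, hcn⟩ := hB z hzV hδ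
  -- The Gram matrix is diagonal at p, because screen vectors are orthogonal to N, with entries
  -- ⟨v,v⟩ > 0 and c².
  have hdet : (g.gram (ofCoord e A (e.symm z)) (ofCoord e n (e.symm z))).det ≠ 0 := by
    have h1 : g.form (e.symm z) v (g.N (e.symm z)) = 0 :=
      (nu_eq hg hp v).trans ((mem_screen_iff hg hp).1 hv).1
    rw [hAp, ofCoord_symm_apply he hz, hcn, gram_det]
    simp only [map_smul, smul_apply, smul_eq_mul, h1, form_N_N hg hp]
    have := (form_pos_of_mem_screen hg hp hv hv0).ne'
    simp [this, hc]
  obtain ⟨U, hU, hUo, hpU⟩ := eventually_nhds_iff.1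
    ((eventually_gram_det_ne_zero hO hpO hA' hn' hdet).and (hO.mem_nhds hpO))
  refine ⟨U, hUo, hpU, ofCoord e A, ofCoord e n, ⟨fun q hq => ⟨U, hUo, hq.2, Subset.rfl, _,
    hA'.mono fun x hx => (hU x hx).2, fun _ _ => rfl⟩, fun q hq => ⟨U, hUo, hq.2, Subset.rfl, _,
    hn'.mono fun x hx => (hU x hx).2, fun _ _ => rfl⟩, fun q hq =>
    (rank_eq_two_iff _).2 (hU q hq.2).1⟩, hAp, ?_⟩
  rintro q ⟨hqS, hqU⟩
  obtain ⟨hqs, hqV⟩ := (hU q hqU).2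
  obtain ⟨y, hy, rfl⟩ := exists_symm_eq hqs
  rw [mem_preimage, e.right_inv hy] at hqV
  have hy0 := (g.mem_singularSet_iff he hy).1 hqS
  rw [ofCoord_symm_apply he hy, ofCoord_symm_apply he hy, hscr y hqV hy0, pull_push he hy]
  exact ⟨hAs y hqV hy0, hB y hqV hy0⟩

/-- Without flatness there is a screen vector v with II(v,v) ≠ 0. Extended by screen vectors and
paired with multiples cN of the main normal, it gives planes meeting the screen in exactly a line.
At p, however, Υ(A,R,A,B) = II(v,v) · c ≠ 0, because II(R,N) = 1 and II(R,v) = 0. -/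
theorem iiFlat_of_sectionalWellDefined
    (h : ∀ U : Set M, IsOpen U → ∀ A B : VField m M, g.IsRankTwoPair U A B →
      (∀ p ∈ g.singularSet ∩ U, g.screenDim (A p) (B p) = 1) → g.SectionalWellDefined U A B) :
    g.IIFlat := by
  by_contra hflat
  obtain ⟨p, hp, v, hv, hvv⟩ := exists_II_self_ne_zero hg hflat
  have hv0 : v ≠ 0 := by
    rintro rfl
    exact hvv (II_zero_left hg hp _)
  obtain ⟨U, hU, hpU, A, B, hAB, hAp, hscr⟩ := exists_isRankTwoPair_of_mem_screen hg hp hv hv0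
  have h1 := h U hU A B hAB fun q hq => by
    obtain ⟨hA, c, hc, hcB⟩ := hscr q hq
    have hA0 : A q ≠ 0 := by
      intro h0
      apply hAB.det_ne_zero q hq
      rw [gram_det, h0]
      simp
    rw [hcB]
    exact screenDim_eq_one hg hq.1 hA hA0 hc
  have h2 := ((sectionalWellDefined_iff hg hAB).1 h1 p ⟨hp, hpU⟩ (g.R p)).2
  obtain ⟨-, c, hc, hcB⟩ := hscr p ⟨hp, hpU⟩
  have h3 := ((mem_screen_iff hg hp).1 hv).1
  rw [Upsilon_eq hg hp, hAp, hcB, II_smul_right hg hp, II_R_N hg hp, II_comm hg hp (g.R p), h3] at h2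
  simp [hvv, hc] at h2

end SymTensor

end RiemannLorentz

end

theorem mainTheorem7 {m : ℕ} (hm : 2 < m) {M : Type*} [TopologicalSpace M] [T2Space M]
    [SecondCountableTopology M] [ConnectedSpace M]
    [ChartedSpace (EuclideanSpace ℝ (Fin m)) M] [IsManifold (𝓡 m) ∞ M]
    (g : RiemannLorentz.SymTensor m M) (hg : g.IsTransverseRiemannLorentzTangent) :
    (∀ (U : Set M), IsOpen U → ∀ A B : RiemannLorentz.VField m M, g.IsRankTwoPair U A B →
      ((g.SectionalWellDefined U A B ↔
          ∀ p ∈ g.singularSet ∩ U, ∀ c : TangentSpace (𝓡 m) p,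
            g.Upsilon c (B p) (A p) (B p) = 0 ∧ g.Upsilon (A p) c (A p) (B p) = 0) ∧
        (g.IIFlat →
          ((∀ p ∈ g.singularSet ∩ U, ∀ c : TangentSpace (𝓡 m) p,
              g.Upsilon c (B p) (A p) (B p) = 0 ∧ g.Upsilon (A p) c (A p) (B p) = 0) ↔
            ∀ p ∈ g.singularSet ∩ U,
              Matrix.det !![g.nu (A p), g.nu (B p); g.rho (A p), g.rho (B p)] = 0)) ∧
        (∀ p ∈ g.singularSet ∩ U,
          (Matrix.det !![g.nu (A p), g.nu (B p); g.rho (A p), g.rho (B p)] = 0 ↔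
            1 ≤ g.screenDim (A p) (B p))))) ∧
    List.TFAE
      [∀ U : Set M, IsOpen U → ∀ A B : RiemannLorentz.VField m M, g.IsRankTwoPair U A B →
          (∀ p ∈ g.singularSet ∩ U, 1 ≤ g.screenDim (A p) (B p)) → g.SectionalWellDefined U A B,
        g.IIFlat,
        ∀ U : Set M, IsOpen U → ∀ A B : RiemannLorentz.VField m M, g.IsRankTwoPair U A B →
          (∀ p ∈ g.singularSet ∩ U, g.screenDim (A p) (B p) = 1) →
            g.SectionalWellDefined U A B] := by
  refine ⟨fun U _ A B hAB => ⟨RiemannLorentz.SymTensor.sectionalWellDefined_iff hg hAB,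
    fun hflat => forall₂_congr fun p hp =>
      RiemannLorentz.SymTensor.Upsilon_eq_zero_iff_of_flat hg hp.1 hflat (A p) (B p),
    fun p hp => RiemannLorentz.SymTensor.det_eq_zero_iff_screenDim hg hp.1
      (hAB.det_ne_zero p hp)⟩, ?_⟩
  tfae_have 1 → 3 := fun h U hU A B hAB hdim => h U hU A B hAB fun p hp => (hdim p hp).ge
  tfae_have 3 → 2 := RiemannLorentz.SymTensor.iiFlat_of_sectionalWellDefined hg
  tfae_have 2 → 1 := fun hflat U _ A B hAB hdim =>
    (RiemannLorentz.SymTensor.sectionalWellDefined_iff hg hAB).2 fun p hp =>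
      (RiemannLorentz.SymTensor.Upsilon_eq_zero_iff_of_flat hg hp.1 hflat (A p) (B p)).2
        ((RiemannLorentz.SymTensor.det_eq_zero_iff_screenDim hg hp.1
          (hAB.det_ne_zero p hp)).2 (hdim p hp))
  tfae_finish
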